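/- Theorem 3 (2D linear programming in read-only memory). Consider the problem of minimising $c_1x_1+c_2x_2$ over $(x_1,x_2)\in\mathbb R^2$ subject to $n$ constraints $a_ix_1+b_ix_2\ge\beta_i$ ($i=1,\dots,n$), where $c_1,c_2,a_i,b_i,\beta_i$ are arbitrary real numbers. The model is a deterministic real RAM. The input numbers are in read-only memory with random access, and $n$ is available to the program. The work space consists of integer cells and real cells, all initially $0$, with indirect addressing. Constants, memory accesses, the operations $+,-,\times,\div$ on integers (truncated subtraction, integer division) and on reals, and comparisons take unit time. Extra space $s$ means that at most $s$ integer cells and at most $s$ real cells are used, where all integers that occur are bounded by a fixed power of $n$ (words of $O(\log n)$ bits), and every real number that is computed is the value of an expression with $O(1)$ arithmetic operations in the input numbers and integer constants (so that a real cell cannot be used to pack a growing amount of data). There are one program and one constant $C$, independent of $n$, of $\epsilon$ and of the input, such that for every $n\ge 3$ and every such linear program the program halts with the correct answer: it reports that the problem is infeasible, or that it is feasible with objective unbounded below, or it reports an optimal solution $(x_1,x_2)$. It uses at most $C\log n$ extra space, and its running time is at most $C\,n^{1+\epsilon}$ for every $\epsilon$ with $\sqrt{\log\log n/\log n}<\epsilon<1$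 (natural logarithms). -/

import Mathlib

namespace ReadOnlyLP

/-- A linear program in the plane with `n` constraints:
minimise `c₁ * x₁ + c₂ * x₂` subject to `a i * x₁ + b i * x₂ ≥ rhs i` for all `i`.
No nondegeneracy is assumed. -/
structure LP (n : ℕ) where
  a : Fin n → ℝ
  b : Fin n → ℝ
  rhs : Fin n → ℝ
  c₁ : ℝ
  c₂ : ℝ

/-- `(x₁, x₂)` satisfies all constraints. -/
def LP.Feasible {n : ℕ} (L : LP n) (x₁ x₂ : ℝ) : Prop :=
  ∀ i, L.rhs i ≤ L.a i * x₁ + L.b i * x₂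

/-- The objective function. -/
def LP.obj {n : ℕ} (L : LP n) (x₁ x₂ : ℝ) : ℝ :=
  L.c₁ * x₁ + L.c₂ * x₂

/-- The constraints have no common solution. -/
def LP.IsInfeasible {n : ℕ} (L : LP n) : Prop :=
  ∀ x₁ x₂, ¬ L.Feasible x₁ x₂

/-- The objective is not bounded below on the feasible region (which is then nonempty). -/
def LP.IsUnbounded {n : ℕ} (L : LP n) : Prop :=
  ∀ M : ℝ, ∃ x₁ x₂, L.Feasible x₁ x₂ ∧ L.obj x₁ x₂ < M

/-- `(x₁, x₂)` is an optimal solution. -/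
def LP.IsOptimal {n : ℕ} (L : LP n) (x₁ x₂ : ℝ) : Prop :=
  L.Feasible x₁ x₂ ∧ ∀ y₁ y₂, L.Feasible y₁ y₂ → L.obj x₁ x₂ ≤ L.obj y₁ y₂

/-- The content of a real work cell: a real number, together with a bookkeeping counter, the
number of arithmetic operations in the expression in the input numbers and integer constants
by which the number was obtained. Programs cannot look at the counter; it only serves to
forbid packing many pieces of data into one real number. -/
structure Num where
  val : ℝ
  ops : ℕ

/-- The work space: integer cells and real cells. -/
structure State where
  int : ℕ → ℕ
  num : ℕ → Num

/-- The cleared work space. -/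
def State.blank : State where
  int := fun _ => 0
  num := fun _ => ⟨0, 0⟩

/-- The resources granted to a run: only the integer cells and the real cells with address
`< cells` may be accessed, all integers that occur are `≤ maxInt`, and all real numbers that
occur are given by expressions with at most `maxOps` arithmetic operations. A run that
violates a limit is stuck. -/
structure Limits where
  cells : ℕ
  maxInt : ℕ
  maxOps : ℕ

def Limits.checkInt (B : Limits) (k : ℕ) : Option ℕ :=
  if k ≤ B.maxInt then some k else none

def Limits.checkNum (B : Limits) (x : Num) : Option Num :=
  if x.ops ≤ B.maxOps then some x else none

def Limits.checkAddr (B : Limits) (k : ℕ) : Option ℕ :=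
  if k < B.cells then some k else none

/-- Arithmetic operations on integers (`sub` is truncated at `0`, `div` rounds down). -/
inductive IntOp where
  | add
  | sub
  | mul
  | div

def IntOp.apply : IntOp → ℕ → ℕ → Option ℕ
  | .add, x, y => some (x + y)
  | .sub, x, y => some (x - y)
  | .mul, x, y => some (x * y)
  | .div, x, y => if y = 0 then none else some (x / y)

/-- Arithmetic operations on real numbers. -/
inductive NumOp where
  | add
  | sub
  | mul
  | div

noncomputable def NumOp.apply : NumOp → Num → Num → Option Num
  | .add, x, y => some ⟨x.val + y.val, x.ops + y.ops + 1⟩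
  | .sub, x, y => some ⟨x.val - y.val, x.ops + y.ops + 1⟩
  | .mul, x, y => some ⟨x.val * y.val, x.ops + y.ops + 1⟩
  | .div, x, y => if y.val = 0 then none else some ⟨x.val / y.val, x.ops + y.ops + 1⟩

/-- Integer expressions: constants, the number of constraints, the integer work cell with a
computed address, and arithmetic. -/
inductive IntExpr where
  | lit (k : ℕ)
  | size
  | cell (addr : IntExpr)
  | op (o : IntOp) (e f : IntExpr)

/-- Real expressions: integer constants, the entries of the read-only input, the real work
cell with a computed address, and arithmetic. -/
inductive NumExpr where
  | lit (k : ℤ)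
  | inA (i : IntExpr)
  | inB (i : IntExpr)
  | inRhs (i : IntExpr)
  | inC₁
  | inC₂
  | cell (addr : IntExpr)
  | op (o : NumOp) (e f : NumExpr)

/-- Tests: comparisons of two integers or of two real numbers. -/
inductive Test where
  | intLe (e f : IntExpr)
  | intEq (e f : IntExpr)
  | numLe (e f : NumExpr)
  | numEq (e f : NumExpr)

/-- Programs. The assignments write to the work cell with the computed address; nothing writes
to the input. -/
inductive Program where
  | skip
  | setInt (addr e : IntExpr)
  | setNum (addr : IntExpr) (e : NumExpr)
  | seq (p q : Program)
  | cond (b : Test) (p q : Program)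
  | loop (b : Test) (p : Program)

/-- The value of an integer expression (`none` if a limit is violated or an operation is
undefined). -/
def IntExpr.eval (B : Limits) (n : ℕ) (σ : State) : IntExpr → Option ℕ
  | .lit k => B.checkInt k
  | .size => B.checkInt n
  | .cell addr => ((addr.eval B n σ).bind B.checkAddr).map σ.int
  | .op o e f =>
      (e.eval B n σ).bind fun x => (f.eval B n σ).bind fun y =>
        (o.apply x y).bind B.checkInt

/-- The value of a real expression (`none` if a limit is violated, an operation is undefined,
or an index into the input is out of range). -/
noncomputable def NumExpr.eval (B : Limits) {n : ℕ} (L : LP n) (σ : State) :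
    NumExpr → Option Num
  | .lit k => some ⟨k, 0⟩
  | .inA i => (i.eval B n σ).bind fun k => if h : k < n then some ⟨L.a ⟨k, h⟩, 0⟩ else none
  | .inB i => (i.eval B n σ).bind fun k => if h : k < n then some ⟨L.b ⟨k, h⟩, 0⟩ else none
  | .inRhs i => (i.eval B n σ).bind fun k => if h : k < n then some ⟨L.rhs ⟨k, h⟩, 0⟩ else none
  | .inC₁ => some ⟨L.c₁, 0⟩
  | .inC₂ => some ⟨L.c₂, 0⟩
  | .cell addr => ((addr.eval B n σ).bind B.checkAddr).map σ.num
  | .op o e f =>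
      (e.eval B L σ).bind fun x => (f.eval B L σ).bind fun y =>
        (o.apply x y).bind B.checkNum

/-- The outcome of a test. -/
noncomputable def Test.eval (B : Limits) {n : ℕ} (L : LP n) (σ : State) : Test → Option Bool
  | .intLe e f =>
      (e.eval B n σ).bind fun x => (f.eval B n σ).map fun y => decide (x ≤ y)
  | .intEq e f =>
      (e.eval B n σ).bind fun x => (f.eval B n σ).map fun y => decide (x = y)
  | .numLe e f =>
      (e.eval B L σ).bind fun x => (f.eval B L σ).map fun y => decide (x.val ≤ y.val)
  | .numEq e f =>
      (e.eval B L σ).bind fun x => (f.eval B L σ).map fun y => decide (x.val = y.val)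

/-- Every constant, every memory access and every arithmetic operation costs one step. -/
def IntExpr.cost : IntExpr → ℕ
  | .lit _ => 1
  | .size => 1
  | .cell addr => addr.cost + 1
  | .op _ e f => e.cost + f.cost + 1

def NumExpr.cost : NumExpr → ℕ
  | .lit _ => 1
  | .inA i => i.cost + 1
  | .inB i => i.cost + 1
  | .inRhs i => i.cost + 1
  | .inC₁ => 1
  | .inC₂ => 1
  | .cell addr => addr.cost + 1
  | .op _ e f => e.cost + f.cost + 1

def Test.cost : Test → ℕ
  | .intLe e f => e.cost + f.cost + 1
  | .intEq e f => e.cost + f.cost + 1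
  | .numLe e f => e.cost + f.cost + 1
  | .numEq e f => e.cost + f.cost + 1

/-- Write `v` to the integer cell `k`. -/
def State.setInt (σ : State) (k v : ℕ) : State :=
  { σ with int := Function.update σ.int k v }

/-- Write `v` to the real cell `k`. -/
def State.setNum (σ : State) (k : ℕ) (v : Num) : State :=
  { σ with num := Function.update σ.num k v }

/-- `Exec B L p σ t σ'`: started with work space `σ` on the input `L`, the program `p` halts
after exactly `t` steps with work space `σ'`, and never violates the limits `B`. -/
inductive Exec (B : Limits) {n : ℕ} (L : LP n) : Program → State → ℕ → State → Prop
  | skip (σ : State) : Exec B L .skip σ 1 σ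
  | setInt (addr e : IntExpr) (σ : State) (k v : ℕ)
      (hk : (addr.eval B n σ).bind B.checkAddr = some k) (hv : e.eval B n σ = some v) :
      Exec B L (.setInt addr e) σ (addr.cost + e.cost + 1) (σ.setInt k v)
  | setNum (addr : IntExpr) (e : NumExpr) (σ : State) (k : ℕ) (v : Num)
      (hk : (addr.eval B n σ).bind B.checkAddr = some k) (hv : e.eval B L σ = some v) :
      Exec B L (.setNum addr e) σ (addr.cost + e.cost + 1) (σ.setNum k v)
  | seq (p q : Program) (σ σ' σ'' : State) (s t : ℕ)
      (hp : Exec B L p σ s σ') (hq : Exec B L q σ' t σ'') :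
      Exec B L (.seq p q) σ (s + t) σ''
  | condTrue (b : Test) (p q : Program) (σ σ' : State) (t : ℕ)
      (hb : b.eval B L σ = some true) (hp : Exec B L p σ t σ') :
      Exec B L (.cond b p q) σ (b.cost + t) σ'
  | condFalse (b : Test) (p q : Program) (σ σ' : State) (t : ℕ)
      (hb : b.eval B L σ = some false) (hq : Exec B L q σ t σ') :
      Exec B L (.cond b p q) σ (b.cost + t) σ'
  | loopDone (b : Test) (p : Program) (σ : State)
      (hb : b.eval B L σ = some false) :
      Exec B L (.loop b p) σ b.cost σ
  | loopStep (b : Test) (p : Program) (σ σ' σ'' : State) (s t : ℕ)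
      (hb : b.eval B L σ = some true) (hp : Exec B L p σ s σ')
      (hl : Exec B L (.loop b p) σ' t σ'') :
      Exec B L (.loop b p) σ (b.cost + s + t) σ''

/-- The final work space holds the correct answer to `L`: integer cell `0` contains `0` if `L`
is infeasible, `1` if `L` is feasible with objective unbounded below, and `2` if `L` has an
optimal solution, in which case real cells `0` and `1` contain such a solution. -/
def Answers {n : ℕ} (L : LP n) (σ : State) : Prop :=
  (σ.int 0 = 0 ∧ L.IsInfeasible) ∨
  (σ.int 0 = 1 ∧ L.IsUnbounded) ∨
  (σ.int 0 = 2 ∧ L.IsOptimal (σ.num 0).val (σ.num 1).val)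

/-- Logarithmic extra space with constant `C`, for an input of size `n`: at most `C * log n`
integer cells and `C * log n` real cells, where the integers have `O(log n)` bits and the real
numbers are given by expressions of constant size in the input numbers. -/
noncomputable def logSpace (C n : ℕ) : Limits where
  cells := ⌊C * Real.log n⌋₊
  maxInt := n ^ C
  maxOps := C

end ReadOnlyLP

namespace ReadOnlyLP

/-! ### Program verification: values, safety and weakest preconditions -/

/-! Rotate and scale the coordinates so that the objective becomes a nonnegative multiple of `y`.
Every constraint is then a lower bound for `y`, a lower bound for `-y`, or a condition on `x` alone;
the conditions of the last kind cut out an interval of abscissae, the strip. For an abscissa `v` in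
the strip, one pass over the input finds the highest line of each sign at `v`. Their values and
slopes tell which side of `v` to keep: every feasible point on the other side can be replaced by a
feasible point at `v` that is not higher (`LP.feas_turn`). So the strip can be cut at any of its
points in linear time.

The aim is a strip on which one line of each sign dominates all others of that sign; there the
problem is to minimise one affine function on an interval, after one more clipping by the upper
line. For each sign the constraints are grouped into blocks of length `h = 1, 2, 4, ...`, with the
invariant that in every block some line dominates over the strip. The dominating lines are not
stored: the best line of a block at the middle point of the strip coincides on the strip with the
dominating one (`LP.Dominated.best`). To double `h`, consider for every pair of neighbouring blocks
the crossing of their two dominating lines, the candidate. If no candidate is inside the strip, then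
in every pair the difference of the lines has constant sign, and the united block is dominated
(`LP.Dominated.double`). So a doubling consists of cutting the strip until it contains no candidate,
and cuts at approximate medians achieve this in `O(log n)` rounds.

An approximate median has to be found in little memory. The candidates are the leaves of a tree of
degree `m = 2 ^ g` and depth `g`, where `g` is about the square root of the binary logarithm of `n`.
A node asks its children cyclically for splitters, i.e. candidates with at least a quarter of the
child's candidates on either side, and tests them on its own candidates. If fewer than a quarter of
these are on one side, that side is cut off from a working copy of the strip, and the child loses a
quarter of its candidates. After three fruitless sweeps at most 27/64 of the node's candidates would
be left, whereas always less than a quarter has been lost on either side, so that more than half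
remain. Hence three sweeps suffice (`searches`). The memory is a constant number of cells and one
strip per level, and the search costs `3 ^ g` times a polynomial in `m` times one scan. All numbers
are computed afresh from the input, so the sizes of their expressions stay bounded.

Altogether the time is `O(n * (2 ^ g) ^ 9)`, and `2 ^ (9 * g)` is at most the exponential of a
multiple of `√(log n)`. If `ε * √(log n)` is large, `n ^ ε` absorbs this; otherwise the assumption
on `ε` bounds `n` (`gridSize_mul_le`). -/

instance : Add IntExpr := ⟨.op .add⟩
instance : Sub IntExpr := ⟨.op .sub⟩
instance : Mul IntExpr := ⟨.op .mul⟩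
instance : Div IntExpr := ⟨.op .div⟩
instance : Add NumExpr := ⟨.op .add⟩
instance : Sub NumExpr := ⟨.op .sub⟩
instance : Mul NumExpr := ⟨.op .mul⟩
instance : Div NumExpr := ⟨.op .div⟩

/-- The integer constant `k`. -/
abbrev ilit (k : ℕ) : IntExpr := .lit k
/-- The integer cell with fixed address `k`. -/
abbrev ivar (k : ℕ) : IntExpr := .cell (.lit k)
/-- The real constant `k`. -/
abbrev rlit (k : ℤ) : NumExpr := .lit k
/-- The real cell with fixed address `k`. -/
abbrev rvar (k : ℕ) : NumExpr := .cell (.lit k)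

notation:50 p:51 ";;" q:50 => Program.seq p q

/-- Assignment to an integer cell with fixed address. -/
abbrev iset (k : ℕ) (e : IntExpr) : Program := .setInt (.lit k) e
/-- Assignment to a real cell with fixed address. -/
abbrev rset (k : ℕ) (e : NumExpr) : Program := .setNum (.lit k) e

/-- Limits that leave room for the fixed cells, for integers polynomial in `n` and for
expressions of bounded size. -/
class Roomy (B : Limits) (n : ℕ) : Prop where
  size : 3 ≤ n
  cells : 64 ≤ B.cells
  ints : 1000 * n ^ 6 ≤ B.maxInt
  ops : 2000 ≤ B.maxOps

/-- The value of an integer expression, limits being ignored. -/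
def IntExpr.value (n : ℕ) (σ : State) : IntExpr → ℕ
  | .lit k => k
  | .size => n
  | .cell a => σ.int (a.value n σ)
  | .op .add e f => e.value n σ + f.value n σ
  | .op .sub e f => e.value n σ - f.value n σ
  | .op .mul e f => e.value n σ * f.value n σ
  | .op .div e f => e.value n σ / f.value n σ

/-- The evaluation of the expression violates no limit. -/
def IntExpr.Safe (B : Limits) (n : ℕ) (σ : State) : IntExpr → Prop
  | .lit k => k ≤ B.maxInt
  | .size => n ≤ B.maxInt
  | .cell a => a.Safe B n σ ∧ a.value n σ < B.cells
  | .op .add e f => e.Safe B n σ ∧ f.Safe B n σ ∧ e.value n σ + f.value n σ ≤ B.maxInt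
  | .op .sub e f => e.Safe B n σ ∧ f.Safe B n σ ∧ e.value n σ - f.value n σ ≤ B.maxInt
  | .op .mul e f => e.Safe B n σ ∧ f.Safe B n σ ∧ e.value n σ * f.value n σ ≤ B.maxInt
  | .op .div e f => e.Safe B n σ ∧ f.Safe B n σ ∧ f.value n σ ≠ 0 ∧
      e.value n σ / f.value n σ ≤ B.maxInt

/-- Splits the partial evaluation into a total value and a side condition. All later reasoning about
programs uses `value` and `Safe`, which `simp` can compute without case distinctions on `Option`. -/
theorem IntExpr.eval_eq {B : Limits} {n : ℕ} {σ : State} (e : IntExpr) (h : e.Safe B n σ) :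
    e.eval B n σ = some (e.value n σ) := by
  induction e with
  | lit k => simpa [eval, value, Safe, Limits.checkInt] using h
  | size => simpa [eval, value, Safe, Limits.checkInt] using h
  | cell a ih =>
    obtain ⟨h₁, h₂⟩ := h
    simp [eval, value, ih h₁, Limits.checkAddr, h₂]
  | op o e f ihe ihf =>
    cases o
    · obtain ⟨h₁, h₂, h₃⟩ := h
      simp [eval, value, ihe h₁, ihf h₂, IntOp.apply, Limits.checkInt, h₃]
    · obtain ⟨h₁, h₂, h₃⟩ := h
      simp only [eval, value, ihe h₁, ihf h₂, IntOp.apply, Limits.checkInt, h₃, Option.bind_some,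
        if_true]
    · obtain ⟨h₁, h₂, h₃⟩ := h
      simp [eval, value, ihe h₁, ihf h₂, IntOp.apply, Limits.checkInt, h₃]
    · obtain ⟨h₁, h₂, h₃, h₄⟩ := h
      simp [eval, value, ihe h₁, ihf h₂, IntOp.apply, Limits.checkInt, h₃, h₄]

/-- The coefficient of `x₁` in constraint `i`, and `0` if there is no such constraint. -/
noncomputable def LP.coeffA {n : ℕ} (L : LP n) (i : ℕ) : ℝ := if h : i < n then L.a ⟨i, h⟩ else 0
/-- The coefficient of `x₂` in constraint `i`, and `0` if there is no such constraint. -/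
noncomputable def LP.coeffB {n : ℕ} (L : LP n) (i : ℕ) : ℝ := if h : i < n then L.b ⟨i, h⟩ else 0
/-- The right hand side of constraint `i`, and `0` if there is no such constraint. -/
noncomputable def LP.bound {n : ℕ} (L : LP n) (i : ℕ) : ℝ :=
  if h : i < n then L.rhs ⟨i, h⟩ else 0

/-- The value of a real expression, limits being ignored. -/
noncomputable def NumExpr.value {n : ℕ} (L : LP n) (σ : State) : NumExpr → ℝ
  | .lit k => k
  | .inA i => L.coeffA (i.value n σ)
  | .inB i => L.coeffB (i.value n σ)
  | .inRhs i => L.bound (i.value n σ)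
  | .inC₁ => L.c₁
  | .inC₂ => L.c₂
  | .cell a => (σ.num (a.value n σ)).val
  | .op .add e f => e.value L σ + f.value L σ
  | .op .sub e f => e.value L σ - f.value L σ
  | .op .mul e f => e.value L σ * f.value L σ
  | .op .div e f => e.value L σ / f.value L σ

/-- The number of operations by which the value of a real expression is obtained. -/
def NumExpr.ops (n : ℕ) (σ : State) : NumExpr → ℕ
  | .lit _ => 0
  | .inA _ => 0
  | .inB _ => 0
  | .inRhs _ => 0
  | .inC₁ => 0
  | .inC₂ => 0
  | .cell a => (σ.num (a.value n σ)).ops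
  | .op _ e f => e.ops n σ + f.ops n σ + 1

/-- The evaluation of the expression violates no limit. -/
def NumExpr.Safe (B : Limits) {n : ℕ} (L : LP n) (σ : State) : NumExpr → Prop
  | .lit _ => True
  | .inA i => i.Safe B n σ ∧ i.value n σ < n
  | .inB i => i.Safe B n σ ∧ i.value n σ < n
  | .inRhs i => i.Safe B n σ ∧ i.value n σ < n
  | .inC₁ => True
  | .inC₂ => True
  | .cell a => a.Safe B n σ ∧ a.value n σ < B.cells
  | .op .add e f => e.Safe B L σ ∧ f.Safe B L σ ∧ e.ops n σ + f.ops n σ + 1 ≤ B.maxOps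
  | .op .sub e f => e.Safe B L σ ∧ f.Safe B L σ ∧ e.ops n σ + f.ops n σ + 1 ≤ B.maxOps
  | .op .mul e f => e.Safe B L σ ∧ f.Safe B L σ ∧ e.ops n σ + f.ops n σ + 1 ≤ B.maxOps
  | .op .div e f => e.Safe B L σ ∧ f.Safe B L σ ∧ f.value L σ ≠ 0 ∧
      e.ops n σ + f.ops n σ + 1 ≤ B.maxOps

theorem NumExpr.eval_eq {B : Limits} {n : ℕ} {L : LP n} {σ : State} (e : NumExpr)
    (h : e.Safe B L σ) : e.eval B L σ = some ⟨e.value L σ, e.ops n σ⟩ := by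
  induction e with
  | lit k => rfl
  | inA i => simp [eval, value, ops, i.eval_eq h.1, h.2, LP.coeffA]
  | inB i => simp [eval, value, ops, i.eval_eq h.1, h.2, LP.coeffB]
  | inRhs i => simp [eval, value, ops, i.eval_eq h.1, h.2, LP.bound]
  | inC₁ => rfl
  | inC₂ => rfl
  | cell a => simp [eval, value, ops, a.eval_eq h.1, h.2, Limits.checkAddr]
  | op o e f ihe ihf =>
    cases o
    · obtain ⟨h₁, h₂, h₃⟩ := h
      simp [eval, value, ops, ihe h₁, ihf h₂, NumOp.apply, Limits.checkNum, Nat.lt_of_succ_le h₃]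
    · obtain ⟨h₁, h₂, h₃⟩ := h
      simp [eval, value, ops, ihe h₁, ihf h₂, NumOp.apply, Limits.checkNum, Nat.lt_of_succ_le h₃]
    · obtain ⟨h₁, h₂, h₃⟩ := h
      simp [eval, value, ops, ihe h₁, ihf h₂, NumOp.apply, Limits.checkNum, Nat.lt_of_succ_le h₃]
    · obtain ⟨h₁, h₂, h₃, h₄⟩ := h
      simp [eval, value, ops, ihe h₁, ihf h₂, NumOp.apply, Limits.checkNum, h₃, Nat.lt_of_succ_le h₄]

/-- The test succeeds, limits being ignored. -/
def Test.Holds {n : ℕ} (L : LP n) (σ : State) : Test → Prop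
  | .intLe e f => e.value n σ ≤ f.value n σ
  | .intEq e f => e.value n σ = f.value n σ
  | .numLe e f => e.value L σ ≤ f.value L σ
  | .numEq e f => e.value L σ = f.value L σ

/-- The evaluation of the test violates no limit. -/
def Test.Safe (B : Limits) {n : ℕ} (L : LP n) (σ : State) : Test → Prop
  | .intLe e f => e.Safe B n σ ∧ f.Safe B n σ
  | .intEq e f => e.Safe B n σ ∧ f.Safe B n σ
  | .numLe e f => e.Safe B L σ ∧ f.Safe B L σ
  | .numEq e f => e.Safe B L σ ∧ f.Safe B L σ

open Classical in
theorem Test.eval_eq {B : Limits} {n : ℕ} {L : LP n} {σ : State} (b : Test)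
    (h : b.Safe B L σ) : b.eval B L σ = some (decide (b.Holds L σ)) := by
  cases b with
  | intLe e f => simp [eval, e.eval_eq h.1, f.eval_eq h.2, Holds]; congr
  | intEq e f => simp [eval, e.eval_eq h.1, f.eval_eq h.2, Holds]; congr
  | numLe e f => simp [eval, e.eval_eq h.1, f.eval_eq h.2, Holds]; congr
  | numEq e f => simp [eval, e.eval_eq h.1, f.eval_eq h.2, Holds]; congr

/-- Started in `σ`, the program halts within `T` steps in a state that satisfies `Q`. -/
def Runs (B : Limits) {n : ℕ} (L : LP n) (p : Program) (σ : State) (T : ℕ)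
    (Q : State → Prop) : Prop :=
  ∃ t σ', Exec B L p σ t σ' ∧ t ≤ T ∧ Q σ'

/-! ### Rules for total correctness with a time bound -/

section Rules

variable {B : Limits} {n : ℕ} {L : LP n} {σ : State} {p q : Program} {b : Test}
  {S T U : ℕ} {Q R : State → Prop}

theorem Runs.mono (h : Runs B L p σ T Q) (hT : T ≤ U) (hQ : ∀ σ', Q σ' → R σ') :
    Runs B L p σ U R := by
  obtain ⟨t, σ', h₁, h₂, h₃⟩ := h
  exact ⟨t, σ', h₁, h₂.trans hT, hQ _ h₃⟩

theorem Runs.seq (h : Runs B L p σ S (fun σ' => Runs B L q σ' T Q)) :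
    Runs B L (p ;; q) σ (S + T) Q := by
  obtain ⟨s, σ', h₁, h₂, t, σ'', h₃, h₄, h₅⟩ := h
  exact ⟨_, _, .seq _ _ _ _ _ _ _ h₁ h₃, by omega, h₅⟩

theorem Runs.andThen (h : Runs B L p σ S R) (h' : ∀ σ', R σ' → Runs B L q σ' T Q) :
    Runs B L (p ;; q) σ (S + T) Q :=
  Runs.seq (h.mono le_rfl h')

theorem Runs.cond (hb : b.Safe B L σ) (hp : b.Holds L σ → Runs B L p σ T Q)
    (hq : ¬ b.Holds L σ → Runs B L q σ T Q) : Runs B L (.cond b p q) σ (b.cost + T) Q := by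
  classical
  by_cases h : b.Holds L σ
  · obtain ⟨t, σ', h₁, h₂, h₃⟩ := hp h
    exact ⟨_, _, .condTrue _ _ _ _ _ _ (by simp [b.eval_eq hb, h]) h₁, by omega, h₃⟩
  · obtain ⟨t, σ', h₁, h₂, h₃⟩ := hq h
    exact ⟨_, _, .condFalse _ _ _ _ _ _ (by simp [b.eval_eq hb, h]) h₁, by omega, h₃⟩

theorem Runs.loopDone (hb : b.Safe B L σ) (h : ¬ b.Holds L σ) (hQ : Q σ) :
    Runs B L (.loop b p) σ b.cost Q := by
  classical
  exact ⟨_, _, .loopDone _ _ _ (by simp [b.eval_eq hb, h]), le_rfl, hQ⟩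

theorem Runs.loopStep (hb : b.Safe B L σ) (h : b.Holds L σ)
    (hp : Runs B L p σ S (fun σ' => Runs B L (.loop b p) σ' T Q)) :
    Runs B L (.loop b p) σ (b.cost + S + T) Q := by
  classical
  obtain ⟨s, σ', h₁, h₂, t, σ'', h₃, h₄, h₅⟩ := hp
  exact ⟨_, _, .loopStep _ _ _ _ _ _ _ (by simp [b.eval_eq hb, h]) h₁ h₃, by omega, h₅⟩

/-- Loops with a known number of iterations. -/
theorem Runs.loop_for (I : ℕ → State → Prop) (c : ℕ → ℕ) (N : ℕ)
    (h0 : ∀ σ, I N σ → b.Safe B L σ ∧ ¬ b.Holds L σ ∧ Q σ)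
    (hs : ∀ j < N, ∀ σ, I j σ → b.Safe B L σ ∧ b.Holds L σ ∧ Runs B L p σ (c j) (I (j + 1)))
    (h : I 0 σ) :
    Runs B L (.loop b p) σ (∑ j ∈ Finset.range N, (b.cost + c j) + b.cost) Q := by
  -- The invariant is indexed by the iterations already done, the induction is on the number `k` of
  -- those still to come.
  suffices H : ∀ k j, j + k = N → ∀ σ, I j σ →
      Runs B L (.loop b p) σ (∑ i ∈ Finset.range k, (b.cost + c (j + i)) + b.cost) Q by
    simpa using H N 0 (zero_add N) σ h
  intro k
  induction k with
  | zero =>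
    rintro j rfl σ hj
    obtain ⟨h₁, h₂, h₃⟩ := h0 σ hj
    exact (Runs.loopDone h₁ h₂ h₃).mono (by simp) (fun _ h => h)
  | succ k ih =>
    intro j hjk σ hj
    obtain ⟨h₁, h₂, h₃⟩ := hs j (by omega) σ hj
    refine (Runs.loopStep h₁ h₂ (h₃.mono le_rfl fun σ' h => ih (j + 1) (by omega) σ' h)).mono ?_
      (fun _ h => h)
    rw [Finset.sum_range_succ']
    simp only [add_zero, add_assoc, add_comm 1]
    omega

end Rules

/-- The running time of a program without loops. -/
def Program.maxCost : Program → ℕ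
  | .skip => 1
  | .setInt a e => a.cost + e.cost + 1
  | .setNum a e => a.cost + e.cost + 1
  | .seq p q => p.maxCost + q.maxCost
  | .cond b p q => b.cost + max p.maxCost q.maxCost
  | .loop b _ => b.cost

/-- The weakest precondition of a program without loops. -/
def Program.wp (B : Limits) {n : ℕ} (L : LP n) : Program → State → (State → Prop) → Prop
  | .skip, σ, Q => Q σ
  | .setInt a e, σ, Q => a.Safe B n σ ∧ a.value n σ < B.cells ∧ e.Safe B n σ ∧
      Q (σ.setInt (a.value n σ) (e.value n σ))
  | .setNum a e, σ, Q => a.Safe B n σ ∧ a.value n σ < B.cells ∧ e.Safe B L σ ∧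
      Q (σ.setNum (a.value n σ) ⟨e.value L σ, e.ops n σ⟩)
  | .seq p q, σ, Q => p.wp B L σ (fun σ' => q.wp B L σ' Q)
  | .cond b p q, σ, Q => b.Safe B L σ ∧ (b.Holds L σ → p.wp B L σ Q) ∧
      (¬ b.Holds L σ → q.wp B L σ Q)
  | .loop _ _, _, _ => False

theorem Program.wp_mono {B : Limits} {n : ℕ} {L : LP n} {p : Program} {σ : State}
    {Q R : State → Prop} (h : p.wp B L σ Q) (hQ : ∀ σ', Q σ' → R σ') : p.wp B L σ R := by
  induction p generalizing σ Q R with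
  | skip => exact hQ _ h
  | setInt a e => exact ⟨h.1, h.2.1, h.2.2.1, hQ _ h.2.2.2⟩
  | setNum a e => exact ⟨h.1, h.2.1, h.2.2.1, hQ _ h.2.2.2⟩
  | seq p q ihp ihq => exact ihp h fun σ' h' => ihq h' hQ
  | cond b p q ihp ihq => exact ⟨h.1, fun hb => ihp (h.2.1 hb) hQ, fun hb => ihq (h.2.2 hb) hQ⟩
  | loop b p => exact h.elim

/-- A loop has the precondition `False`, so it does no harm that `maxCost` charges it for a single
test only. For programs with loops, `maxCost` serves below merely as a convenient constant for the
overhead outside of the loop bodies. -/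
theorem Runs.of_wp {B : Limits} {n : ℕ} {L : LP n} {p : Program} {σ : State} {Q : State → Prop}
    (h : p.wp B L σ Q) : Runs B L p σ p.maxCost Q := by
  induction p generalizing σ Q with
  | skip => exact ⟨_, _, .skip _, le_rfl, h⟩
  | setInt a e =>
    obtain ⟨h₁, h₂, h₃, h₄⟩ := h
    exact ⟨_, _, .setInt _ _ _ _ _ (by simp [a.eval_eq h₁, Limits.checkAddr, h₂])
      (e.eval_eq h₃), le_rfl, h₄⟩
  | setNum a e =>
    obtain ⟨h₁, h₂, h₃, h₄⟩ := h
    exact ⟨_, _, .setNum _ _ _ _ _ (by simp [a.eval_eq h₁, Limits.checkAddr, h₂])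
      (e.eval_eq h₃), le_rfl, h₄⟩
  | seq p q ihp ihq => exact Runs.seq ((ihp h).mono le_rfl fun σ' h' => ihq h')
  | cond b p q ihp ihq =>
    obtain ⟨h₁, h₂, h₃⟩ := h
    exact Runs.cond h₁ (fun hb => (ihp (h₂ hb)).mono (le_max_left _ _) fun _ h => h)
      (fun hb => (ihq (h₃ hb)).mono (le_max_right _ _) fun _ h => h)
  | loop b p => exact h.elim

/-! ### Simplification lemmas -/

theorem State.setInt_int (σ : State) (k v j : ℕ) :
    (σ.setInt k v).int j = if j = k then v else σ.int j := by
  simp [State.setInt, Function.update_apply]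

theorem State.setInt_num (σ : State) (k v : ℕ) : (σ.setInt k v).num = σ.num := rfl

theorem State.setNum_num (σ : State) (k : ℕ) (v : Num) (j : ℕ) :
    (σ.setNum k v).num j = if j = k then v else σ.num j := by
  simp [State.setNum, Function.update_apply]

theorem State.setNum_int (σ : State) (k : ℕ) (v : Num) : (σ.setNum k v).int = σ.int := rfl

section Values

variable (B : Limits) {n : ℕ} (L : LP n) (σ : State) (e f : IntExpr) (u v : NumExpr) (k : ℕ)

theorem IntExpr.value_add : (e + f).value n σ = e.value n σ + f.value n σ := rfl
theorem IntExpr.value_sub : (e - f).value n σ = e.value n σ - f.value n σ := rfl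
theorem IntExpr.value_mul : (e * f).value n σ = e.value n σ * f.value n σ := rfl
theorem IntExpr.value_div : (e / f).value n σ = e.value n σ / f.value n σ := rfl

theorem IntExpr.safe_add : (e + f).Safe B n σ ↔
    e.Safe B n σ ∧ f.Safe B n σ ∧ e.value n σ + f.value n σ ≤ B.maxInt := Iff.rfl
theorem IntExpr.safe_sub : (e - f).Safe B n σ ↔
    e.Safe B n σ ∧ f.Safe B n σ ∧ e.value n σ - f.value n σ ≤ B.maxInt := Iff.rfl
theorem IntExpr.safe_mul : (e * f).Safe B n σ ↔
    e.Safe B n σ ∧ f.Safe B n σ ∧ e.value n σ * f.value n σ ≤ B.maxInt := Iff.rfl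
theorem IntExpr.safe_div : (e / f).Safe B n σ ↔ e.Safe B n σ ∧ f.Safe B n σ ∧
    f.value n σ ≠ 0 ∧ e.value n σ / f.value n σ ≤ B.maxInt := Iff.rfl

theorem NumExpr.value_add : (u + v).value L σ = u.value L σ + v.value L σ := rfl
theorem NumExpr.value_sub : (u - v).value L σ = u.value L σ - v.value L σ := rfl
theorem NumExpr.value_mul : (u * v).value L σ = u.value L σ * v.value L σ := rfl
theorem NumExpr.value_div : (u / v).value L σ = u.value L σ / v.value L σ := rfl
theorem NumExpr.ops_add : (u + v).ops n σ = u.ops n σ + v.ops n σ + 1 := rfl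
theorem NumExpr.ops_sub : (u - v).ops n σ = u.ops n σ + v.ops n σ + 1 := rfl
theorem NumExpr.ops_mul : (u * v).ops n σ = u.ops n σ + v.ops n σ + 1 := rfl
theorem NumExpr.ops_div : (u / v).ops n σ = u.ops n σ + v.ops n σ + 1 := rfl

theorem NumExpr.safe_add : (u + v).Safe B L σ ↔ u.Safe B L σ ∧ v.Safe B L σ ∧
    u.ops n σ + v.ops n σ + 1 ≤ B.maxOps := Iff.rfl
theorem NumExpr.safe_sub : (u - v).Safe B L σ ↔ u.Safe B L σ ∧ v.Safe B L σ ∧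
    u.ops n σ + v.ops n σ + 1 ≤ B.maxOps := Iff.rfl
theorem NumExpr.safe_mul : (u * v).Safe B L σ ↔ u.Safe B L σ ∧ v.Safe B L σ ∧
    u.ops n σ + v.ops n σ + 1 ≤ B.maxOps := Iff.rfl
theorem NumExpr.safe_div : (u / v).Safe B L σ ↔ u.Safe B L σ ∧ v.Safe B L σ ∧
    v.value L σ ≠ 0 ∧ u.ops n σ + v.ops n σ + 1 ≤ B.maxOps := Iff.rfl

theorem IntExpr.value_lit : (IntExpr.lit k).value n σ = k := rfl
theorem IntExpr.value_size : IntExpr.size.value n σ = n := rfl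
theorem IntExpr.value_cell : (IntExpr.cell e).value n σ = σ.int (e.value n σ) := rfl
theorem NumExpr.value_lit (k : ℤ) : (NumExpr.lit k).value L σ = k := rfl
theorem NumExpr.value_inA : (NumExpr.inA e).value L σ = L.coeffA (e.value n σ) := rfl
theorem NumExpr.value_inB : (NumExpr.inB e).value L σ = L.coeffB (e.value n σ) := rfl
theorem NumExpr.value_inRhs : (NumExpr.inRhs e).value L σ = L.bound (e.value n σ) := rfl
theorem NumExpr.value_inC₁ : NumExpr.inC₁.value L σ = L.c₁ := rfl
theorem NumExpr.value_inC₂ : NumExpr.inC₂.value L σ = L.c₂ := rfl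
theorem NumExpr.value_cell :
    (NumExpr.cell e).value L σ = (σ.num (e.value n σ)).val := rfl
theorem NumExpr.ops_lit (k : ℤ) : (NumExpr.lit k).ops n σ = 0 := rfl
theorem NumExpr.ops_inA : (NumExpr.inA e).ops n σ = 0 := rfl
theorem NumExpr.ops_inB : (NumExpr.inB e).ops n σ = 0 := rfl
theorem NumExpr.ops_inRhs : (NumExpr.inRhs e).ops n σ = 0 := rfl
theorem NumExpr.ops_inC₁ : NumExpr.inC₁.ops n σ = 0 := rfl
theorem NumExpr.ops_inC₂ : NumExpr.inC₂.ops n σ = 0 := rfl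
theorem NumExpr.ops_cell : (NumExpr.cell e).ops n σ = (σ.num (e.value n σ)).ops := rfl

theorem NumExpr.safe_lit (k : ℤ) : (NumExpr.lit k).Safe B L σ ↔ True := Iff.rfl
theorem NumExpr.safe_inC₁ : NumExpr.inC₁.Safe B L σ ↔ True := Iff.rfl
theorem NumExpr.safe_inC₂ : NumExpr.inC₂.Safe B L σ ↔ True := Iff.rfl
theorem NumExpr.safe_inA : (NumExpr.inA e).Safe B L σ ↔ e.Safe B n σ ∧ e.value n σ < n := Iff.rfl
theorem NumExpr.safe_inB : (NumExpr.inB e).Safe B L σ ↔ e.Safe B n σ ∧ e.value n σ < n := Iff.rfl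
theorem NumExpr.safe_inRhs :
    (NumExpr.inRhs e).Safe B L σ ↔ e.Safe B n σ ∧ e.value n σ < n := Iff.rfl
theorem NumExpr.safe_cell :
    (NumExpr.cell e).Safe B L σ ↔ e.Safe B n σ ∧ e.value n σ < B.cells := Iff.rfl
theorem IntExpr.safe_cell :
    (IntExpr.cell e).Safe B n σ ↔ e.Safe B n σ ∧ e.value n σ < B.cells := Iff.rfl

theorem Program.wp_seq (p q : Program) (Q : State → Prop) :
    (p ;; q).wp B L σ Q ↔ p.wp B L σ (fun σ' => q.wp B L σ' Q) := Iff.rfl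

theorem Program.wp_skip (Q : State → Prop) : Program.skip.wp B L σ Q ↔ Q σ := Iff.rfl

theorem Program.wp_cond (b : Test) (p q : Program) (Q : State → Prop) :
    (Program.cond b p q).wp B L σ Q ↔ b.Safe B L σ ∧ (b.Holds L σ → p.wp B L σ Q) ∧
      (¬ b.Holds L σ → q.wp B L σ Q) := Iff.rfl

theorem Program.wp_setNum (a : IntExpr) (e : NumExpr) (Q : State → Prop) :
    (Program.setNum a e).wp B L σ Q ↔ a.Safe B n σ ∧ a.value n σ < B.cells ∧ e.Safe B L σ ∧
      Q (σ.setNum (a.value n σ) ⟨e.value L σ, e.ops n σ⟩) := Iff.rfl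

theorem Test.safe_intLe : (Test.intLe e f).Safe B L σ ↔ e.Safe B n σ ∧ f.Safe B n σ := Iff.rfl
theorem Test.safe_intEq : (Test.intEq e f).Safe B L σ ↔ e.Safe B n σ ∧ f.Safe B n σ := Iff.rfl
theorem Test.safe_numLe : (Test.numLe u v).Safe B L σ ↔ u.Safe B L σ ∧ v.Safe B L σ := Iff.rfl
theorem Test.safe_numEq : (Test.numEq u v).Safe B L σ ↔ u.Safe B L σ ∧ v.Safe B L σ := Iff.rfl
theorem Test.holds_intLe : (Test.intLe e f).Holds L σ ↔ e.value n σ ≤ f.value n σ := Iff.rfl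
theorem Test.holds_intEq : (Test.intEq e f).Holds L σ ↔ e.value n σ = f.value n σ := Iff.rfl
theorem Test.holds_numLe : (Test.numLe u v).Holds L σ ↔ u.value L σ ≤ v.value L σ := Iff.rfl
theorem Test.holds_numEq : (Test.numEq u v).Holds L σ ↔ u.value L σ = v.value L σ := Iff.rfl

variable [Roomy B n]

/-- Linear consequences of the polynomial limit, in a form that `omega` can use; 3000 comes from `n
≥ 3`. -/
theorem Roomy.maxInt : 1000 * n ≤ B.maxInt ∧ 3000 ≤ B.maxInt := by
  have h₁ := Roomy.size B (n := n)
  have h₂ := Roomy.ints (B := B) (n := n)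
  have h₃ : n ≤ n ^ 6 := Nat.le_self_pow (by norm_num) n
  omega

theorem IntExpr.safe_size : IntExpr.size.Safe B n σ ↔ True := by
  have := Roomy.maxInt B (n := n)
  simp only [Safe]
  constructor
  · simp
  · intro
    omega

theorem IntExpr.safe_lit (hk : k ≤ 3000) : (IntExpr.lit k).Safe B n σ ↔ True := by
  have := Roomy.maxInt B (n := n)
  simp only [Safe]
  constructor
  · simp
  · intro
    omega

theorem Roomy.lt_cells (n : ℕ) [Roomy B n] (hk : k < 64) : k < B.cells :=
  hk.trans_le (Roomy.cells n)

theorem IntExpr.safe_ivar (hk : k < 64) : (IntExpr.cell (.lit k)).Safe B n σ ↔ True := by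
  have := Roomy.lt_cells B k n hk
  simp [IntExpr.safe_cell, IntExpr.safe_lit B σ k (by omega), IntExpr.value_lit, this]

theorem NumExpr.safe_rvar (hk : k < 64) : (NumExpr.cell (.lit k)).Safe B L σ ↔ True := by
  have := Roomy.lt_cells B k n hk
  simp [NumExpr.safe_cell, IntExpr.safe_lit B σ k (by omega), IntExpr.value_lit, this]

theorem Program.wp_iset (e : IntExpr) (Q : State → Prop) (hk : k < 64) :
    (Program.setInt (.lit k) e).wp B L σ Q ↔ e.Safe B n σ ∧ Q (σ.setInt k (e.value n σ)) := by
  have := Roomy.lt_cells B k n hk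
  simp [Program.wp, IntExpr.safe_lit B σ k (by omega), IntExpr.value_lit, this]

theorem Program.wp_rset (e : NumExpr) (Q : State → Prop) (hk : k < 64) :
    (Program.setNum (.lit k) e).wp B L σ Q ↔
      e.Safe B L σ ∧ Q (σ.setNum k ⟨e.value L σ, e.ops n σ⟩) := by
  have := Roomy.lt_cells B k n hk
  simp [Program.wp, IntExpr.safe_lit B σ k (by omega), IntExpr.value_lit, this]

end Values

attribute [simp] State.setInt_int State.setInt_num State.setNum_num State.setNum_int
  IntExpr.value_add IntExpr.value_sub IntExpr.value_mul IntExpr.value_div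
  IntExpr.safe_add IntExpr.safe_sub IntExpr.safe_mul IntExpr.safe_div
  NumExpr.value_add NumExpr.value_sub NumExpr.value_mul NumExpr.value_div
  NumExpr.ops_add NumExpr.ops_sub NumExpr.ops_mul NumExpr.ops_div
  NumExpr.safe_add NumExpr.safe_sub NumExpr.safe_mul NumExpr.safe_div
  IntExpr.value_lit IntExpr.value_size IntExpr.value_cell NumExpr.value_lit
  NumExpr.value_inA NumExpr.value_inB NumExpr.value_inRhs NumExpr.value_inC₁ NumExpr.value_inC₂
  NumExpr.value_cell NumExpr.ops_lit NumExpr.ops_inA NumExpr.ops_inB NumExpr.ops_inRhs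
  NumExpr.ops_inC₁ NumExpr.ops_inC₂ NumExpr.ops_cell NumExpr.safe_lit NumExpr.safe_inC₁
  NumExpr.safe_inC₂ NumExpr.safe_inA NumExpr.safe_inB NumExpr.safe_inRhs
  IntExpr.safe_size IntExpr.safe_lit IntExpr.safe_ivar NumExpr.safe_rvar
  Program.wp_iset Program.wp_rset Program.wp_seq Program.wp_skip Program.wp_cond
  Test.safe_intLe Test.safe_intEq Test.safe_numLe Test.safe_numEq
  Test.holds_intLe Test.holds_intEq Test.holds_numLe Test.holds_numEq


/-! ### Rotated coordinates, lines and strips -/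

section Lines

variable {n : ℕ} (L : LP n) (c : ℝ × ℝ)

/-- The coefficient of `x` in constraint `i` after the substitution
`x₁ = c.1 * y - c.2 * x`, `x₂ = c.2 * y + c.1 * x`. -/
noncomputable def LP.coeffX (i : ℕ) : ℝ := L.coeffB i * c.1 - L.coeffA i * c.2

/-- The coefficient of `y` in constraint `i` after the substitution
`x₁ = c.1 * y - c.2 * x`, `x₂ = c.2 * y + c.1 * x`. -/
noncomputable def LP.coeffY (i : ℕ) : ℝ := L.coeffA i * c.1 + L.coeffB i * c.2

/-- Feasibility in the new coordinates. -/
def LP.Feas (x y : ℝ) : Prop := ∀ i < n, L.bound i ≤ L.coeffX c i * x + L.coeffY c i * y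

theorem LP.feasible_iff (x y : ℝ) :
    L.Feasible (c.1 * y - c.2 * x) (c.2 * y + c.1 * x) ↔ L.Feas c x y := by
  constructor
  · intro h i hi
    have := h ⟨i, hi⟩
    simp only [LP.bound, LP.coeffX, LP.coeffY, LP.coeffA, LP.coeffB, hi, dif_pos]
    linarith
  · intro h i
    have := h i i.2
    simp only [LP.bound, LP.coeffX, LP.coeffY, LP.coeffA, LP.coeffB, i.2, dif_pos] at this
    linarith

/-- The constraint `i` as a lower bound `l.1 * x + l.2` for `s * y`, if `coeffY` has the
same sign as `s`. -/
noncomputable def LP.line (s : ℝ) (i : ℕ) : Option (ℝ × ℝ) :=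
  if 0 < s * L.coeffY c i then
    -- Real expressions have no negation, hence `0 -`, as in the program.
    some ((0 - L.coeffX c i) / (s * L.coeffY c i), L.bound i / (s * L.coeffY c i))
  else none

/-- The value of a line at `x`. -/
def lineAt (l : ℝ × ℝ) (x : ℝ) : ℝ := l.1 * x + l.2

variable {L c}

/-- Missing constraints have coefficients `0` and so define no line. Blocks may therefore reach
beyond `n`. -/
theorem LP.line_of_le {s : ℝ} {i : ℕ} (hi : n ≤ i) : L.line c s i = none := by
  simp [LP.line, LP.coeffY, LP.coeffA, LP.coeffB, hi.not_gt]

/-- Multiply by `s * coeffY`, which is positive whenever the line exists; `s * s = 1` then removes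
the sign. This treats lower and upper constraints at once. -/
theorem LP.lineAt_le_iff {s : ℝ} (hs : s * s = 1) {i : ℕ} {l : ℝ × ℝ} (hl : L.line c s i = some l)
    (x y : ℝ) : lineAt l x ≤ s * y ↔ L.bound i ≤ L.coeffX c i * x + L.coeffY c i * y := by
  unfold LP.line at hl
  split_ifs at hl with h
  cases hl
  have : lineAt ((0 - L.coeffX c i) / (s * L.coeffY c i), L.bound i / (s * L.coeffY c i)) x =
      (L.bound i - L.coeffX c i * x) / (s * L.coeffY c i) := by
    simp only [lineAt]
    ring
  rw [this, div_le_iff₀ h]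
  have : s * y * (s * L.coeffY c i) = L.coeffY c i * y := by
    linear_combination L.coeffY c i * y * hs
  rw [this]
  constructor <;> intro _ <;> linarith

theorem LP.Feas.lineAt_le {x y : ℝ} (h : L.Feas c x y) {s : ℝ} (hs : s * s = 1) {i : ℕ}
    {l : ℝ × ℝ} (hl : L.line c s i = some l) : lineAt l x ≤ s * y := by
  rw [LP.lineAt_le_iff hs hl]
  by_cases hi : i < n
  · exact h i hi
  · rw [LP.line_of_le (by omega)] at hl
    cases hl

theorem LP.feas_of_lines {x y : ℝ}
    (h₁ : ∀ i l, L.line c 1 i = some l → lineAt l x ≤ y)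
    (h₂ : ∀ i l, L.line c (-1) i = some l → lineAt l x ≤ -y)
    (h₀ : ∀ i < n, L.coeffY c i = 0 → L.bound i ≤ L.coeffX c i * x) : L.Feas c x y := by
  intro i hi
  rcases lt_trichotomy (L.coeffY c i) 0 with h | h | h
  · have hl : L.line c (-1) i = some _ := if_pos (by linarith)
    exact (LP.lineAt_le_iff (by norm_num) hl x y).1 (by linarith [h₂ i _ hl])
  · simpa [h] using h₀ i hi h
  · have hl : L.line c 1 i = some _ := if_pos (by linarith)
    exact (LP.lineAt_le_iff (by norm_num) hl x y).1 (by linarith [h₁ i _ hl])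

variable (L c)

/-- The line of highest value at `X` among the lines of sign `s` with index in
`[a, a + len)`. -/
noncomputable def LP.best (s X : ℝ) (a : ℕ) : ℕ → Option (ℝ × ℝ)
  | 0 => none
  | len + 1 =>
    match L.line c s (a + len), LP.best s X a len with
    | none, o => o
    | some l, none => some l
    | some l, some l' => if lineAt l X ≤ lineAt l' X then some l' else some l

variable {L c}

theorem LP.best_eq_none {s X : ℝ} {a len : ℕ} (h : L.best c s X a len = none) (i : ℕ)
    (hi : a ≤ i) (hi' : i < a + len) : L.line c s i = none := by
  induction len with
  | zero => omega
  | succ len ih =>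
    rw [LP.best] at h
    split at h
    · rename_i h₁
      rcases Nat.lt_succ_iff_lt_or_eq.1 (show i < (a + len).succ by omega) with h₂ | rfl
      · exact ih h h₂
      · exact h₁
    · cases h
    · split_ifs at h

theorem LP.best_eq_some {s X : ℝ} {a len : ℕ} {l : ℝ × ℝ} (h : L.best c s X a len = some l) :
    (∃ i, a ≤ i ∧ i < a + len ∧ L.line c s i = some l) ∧
    ∀ i, a ≤ i → i < a + len → ∀ l', L.line c s i = some l' → lineAt l' X ≤ lineAt l X := by
  induction len generalizing l with
  | zero => cases h
  | succ len ih =>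
    rw [LP.best] at h
    split at h
    · rename_i h₁
      obtain ⟨⟨i, hi₁, hi₂, hi₃⟩, h₂⟩ := ih h
      refine ⟨⟨i, hi₁, by omega, hi₃⟩, fun j hj hj' l' hl' => ?_⟩
      rcases Nat.lt_succ_iff_lt_or_eq.1 (show j < (a + len).succ by omega) with h₃ | rfl
      · exact h₂ j hj h₃ l' hl'
      · rw [h₁] at hl'
        cases hl'
    · rename_i h₁ h₂
      cases h
      refine ⟨⟨_, by omega, by omega, h₁⟩, fun j hj hj' l' hl' => ?_⟩
      rcases Nat.lt_succ_iff_lt_or_eq.1 (show j < (a + len).succ by omega) with h₃ | rfl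
      · rw [LP.best_eq_none h₂ j hj h₃] at hl'
        cases hl'
      · rw [h₁] at hl'
        cases hl'
        exact le_rfl
    · rename_i l₁ l₂ h₁ h₂
      obtain ⟨⟨i, hi₁, hi₂, hi₃⟩, h₄⟩ := ih h₂
      split_ifs at h with h₅
      · cases h
        refine ⟨⟨i, hi₁, by omega, hi₃⟩, fun j hj hj' l' hl' => ?_⟩
        rcases Nat.lt_succ_iff_lt_or_eq.1 (show j < (a + len).succ by omega) with h₃ | rfl
        · exact h₄ j hj h₃ l' hl'
        · rw [h₁] at hl'
          cases hl'
          exact h₅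
      · cases h
        refine ⟨⟨_, by omega, by omega, h₁⟩, fun j hj hj' l' hl' => ?_⟩
        rcases Nat.lt_succ_iff_lt_or_eq.1 (show j < (a + len).succ by omega) with h₃ | rfl
        · exact (h₄ j hj h₃ l' hl').trans (not_le.1 h₅).le
        · rw [h₁] at hl'
          cases hl'
          exact le_rfl

theorem LP.best_of_le {s X : ℝ} {a : ℕ} (ha : n ≤ a) (len : ℕ) : L.best c s X a len = none := by
  induction len with
  | zero => rfl
  | succ len ih => rw [LP.best, LP.line_of_le (by omega), ih]

/-- Justifies that the program stops reading a block at the index `n`. -/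
theorem LP.best_min {s X : ℝ} {a : ℕ} (len : ℕ) :
    L.best c s X a (min len (n - a)) = L.best c s X a len := by
  induction len with
  | zero => simp
  | succ len ih =>
    by_cases h : len < n - a
    · rw [min_eq_left (show len + 1 ≤ n - a by omega)]
    · rw [min_eq_right (show n - a ≤ len + 1 by omega)]
      rw [min_eq_right (show n - a ≤ len by omega)] at ih
      rw [ih, LP.best, LP.line_of_le (show n ≤ a + len by omega)]

end Lines

/-- An interval with end points `lx / lw` and `hx / hw`, where `(-1, 0)` and `(1, 0)` stand
for `-∞` and `∞`. -/
structure Strip where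
  lx : ℝ
  lw : ℝ
  hx : ℝ
  hw : ℝ

/-! ### Intervals with possibly infinite ends, and affine functions on them -/

namespace Strip

/-- Membership in the open interval. -/
def Mem (G : Strip) (x : ℝ) : Prop := G.lx < x * G.lw ∧ x * G.hw < G.hx

/-- Membership in the closed interval. -/
def CMem (G : Strip) (x : ℝ) : Prop := G.lx ≤ x * G.lw ∧ x * G.hw ≤ G.hx

/-- The end points are given in the required form. -/
structure Ends (G : Strip) : Prop where
  lo : G.lw = 1 ∨ (G.lw = 0 ∧ G.lx = -1)
  hi : G.hw = 1 ∨ (G.hw = 0 ∧ G.hx = 1)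

/-- The end points are given in the required form, and in the right order. -/
structure Valid (G : Strip) : Prop extends G.Ends where
  le : G.lx * G.hw ≤ G.hx * G.lw

/-- Replace the lower end. -/
def setLo (G : Strip) (v : ℝ) : Strip := { G with lx := v, lw := 1 }
/-- Replace the upper end. -/
def setHi (G : Strip) (v : ℝ) : Strip := { G with hx := v, hw := 1 }

open Classical in
/-- A point of the interval, which is an inner point unless the interval is a singleton. -/
noncomputable def mid (G : Strip) : ℝ :=
  -- One formula for all cases: the midpoint of a bounded interval, `lx + 1` or `hx - 1` on a half
  -- line, and `0` on the whole line.
  if G.lw + G.hw = 0 then 0 else (G.lx + G.hx) / (G.lw + G.hw)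

variable {G : Strip} {x v α β : ℝ}

theorem Ends.lw_nonneg (h : G.Ends) : 0 ≤ G.lw := by
  rcases h.lo with h | ⟨h, -⟩ <;> rw [h] <;> norm_num

theorem Ends.hw_nonneg (h : G.Ends) : 0 ≤ G.hw := by
  rcases h.hi with h | ⟨h, -⟩ <;> rw [h] <;> norm_num

theorem Ends.setLo (h : G.Ends) (v : ℝ) : (G.setLo v).Ends := ⟨Or.inl rfl, h.hi⟩
theorem Ends.setHi (h : G.Ends) (v : ℝ) : (G.setHi v).Ends := ⟨h.lo, Or.inl rfl⟩

theorem Mem.cMem (h : G.Mem x) : G.CMem x := ⟨h.1.le, h.2.le⟩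

/-- As `v` lies in the interval, the new end implies the old one. Since the weight `lw` is
nonnegative, the same multiplication covers finite and infinite ends. -/
theorem mem_setLo (h : G.Ends) (hv : G.Mem v) : (G.setLo v).Mem x ↔ G.Mem x ∧ v < x := by
  simp only [Mem, Strip.setLo, mul_one]
  constructor
  · rintro ⟨h₁, h₂⟩
    exact ⟨⟨hv.1.trans_le (mul_le_mul_of_nonneg_right h₁.le h.lw_nonneg), h₂⟩, h₁⟩
  · rintro ⟨⟨_, h₂⟩, h₁⟩
    exact ⟨h₁, h₂⟩

theorem mem_setHi (h : G.Ends) (hv : G.Mem v) : (G.setHi v).Mem x ↔ G.Mem x ∧ x < v := by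
  simp only [Mem, Strip.setHi, mul_one]
  constructor
  · rintro ⟨h₁, h₂⟩
    exact ⟨⟨h₁, (mul_le_mul_of_nonneg_right h₂.le h.hw_nonneg).trans_lt hv.2⟩, h₂⟩
  · rintro ⟨⟨h₂, _⟩, h₁⟩
    exact ⟨h₂, h₁⟩

theorem cMem_setLo (h : G.Ends) (hv : G.CMem v) : (G.setLo v).CMem x ↔ G.CMem x ∧ v ≤ x := by
  simp only [CMem, Strip.setLo, mul_one]
  constructor
  · rintro ⟨h₁, h₂⟩
    exact ⟨⟨hv.1.trans (mul_le_mul_of_nonneg_right h₁ h.lw_nonneg), h₂⟩, h₁⟩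
  · rintro ⟨⟨_, h₂⟩, h₁⟩
    exact ⟨h₁, h₂⟩

theorem cMem_setHi (h : G.Ends) (hv : G.CMem v) : (G.setHi v).CMem x ↔ G.CMem x ∧ x ≤ v := by
  simp only [CMem, Strip.setHi, mul_one]
  constructor
  · rintro ⟨h₁, h₂⟩
    exact ⟨⟨h₁, (mul_le_mul_of_nonneg_right h₂ h.hw_nonneg).trans hv.2⟩, h₂⟩
  · rintro ⟨⟨h₂, _⟩, h₁⟩
    exact ⟨h₂, h₁⟩

theorem Valid.setLo (h : G.Valid) (hv : G.CMem v) : (G.setLo v).Valid :=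
  ⟨h.toEnds.setLo v, by simpa [Strip.setLo] using hv.2⟩

theorem Valid.setHi (h : G.Valid) (hv : G.CMem v) : (G.setHi v).Valid :=
  ⟨h.toEnds.setHi v, by simpa [Strip.setHi] using hv.1⟩

/-- Cross multiplication: both sides are compared with `x * lw * hw`. Together with `Valid.cMem_mid`
this makes the order of the ends a test for nonemptiness. -/
theorem Ends.valid_of_cMem (h : G.Ends) (hx : G.CMem x) : G.Valid := by
  refine ⟨h, ?_⟩
  have h₁ := mul_le_mul_of_nonneg_right hx.1 h.hw_nonneg
  have h₂ := mul_le_mul_of_nonneg_right hx.2 h.lw_nonneg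
  linarith

theorem Valid.cMem_mid (h : G.Valid) : G.CMem G.mid := by
  have hle := h.le
  unfold mid CMem
  rcases h.lo with h₁ | ⟨h₁, h₂⟩ <;> rcases h.hi with h₃ | ⟨h₃, h₄⟩ <;>
    simp only [*] at hle ⊢ <;> norm_num at hle ⊢ <;> constructor <;> linarith

/-- An affine function that is nonnegative on the interval and vanishes at its middle point
vanishes on the interval. -/
theorem Valid.affine_eq_zero (h : G.Valid) (hf : ∀ x, G.CMem x → 0 ≤ α * x + β)
    (hm : α * G.mid + β ≤ 0) (hx : G.CMem x) : α * x + β = 0 := by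
  have hle := h.le
  have h₀ := hf x hx
  unfold mid at hm
  unfold CMem at hf hx
  rcases h.lo with h₁ | ⟨h₁, h₂⟩ <;> rcases h.hi with h₃ | ⟨h₃, h₄⟩ <;>
    simp only [*] at hle hm hf hx <;> norm_num at hle hm hf hx
  -- Reflection in the midpoint: the values at `x` and at its mirror image are nonnegative, and
  -- their sum is twice the value at the midpoint.
  · have h₅ := hf (G.lx + G.hx - x) (by linarith) (by linarith)
    linarith
  -- On this half line the middle point is `lx + 1`, halfway between `lx` and `lx + 2`. So the
  -- function vanishes at both, and its slope is `0`.
  · have h₅ := hf G.lx le_rfl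
    have h₆ := hf (G.lx + 2) (by linarith)
    have h₇ : α = 0 := by linarith
    subst h₇
    linarith
  · have h₅ := hf G.hx le_rfl
    have h₆ := hf (G.hx - 2) (by linarith)
    have h₇ : α = 0 := by linarith
    subst h₇
    linarith
  · have h₅ := hf 1
    have h₆ := hf (-1)
    have h₇ : α = 0 := by linarith
    subst h₇
    linarith

theorem Ends.mem_of_between (h : G.Ends) {y z : ℝ} (hx : G.CMem x) (hy : G.CMem y)
    (h₁ : x < z) (h₂ : z < y) : G.Mem z := by
  unfold CMem at hx hy
  unfold Mem
  rcases h.lo with h₃ | ⟨h₃, h₄⟩ <;> rcases h.hi with h₅ | ⟨h₅, h₆⟩ <;>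
    simp only [*] at hx hy ⊢ <;> norm_num at hx hy ⊢ <;> first | (constructor <;> linarith) | linarith

/-- An affine function without zeros in the open interval has constant sign. -/
theorem Ends.affine_sign (h : G.Ends) (hf : ∀ z, G.Mem z → α * z + β = 0 → α = 0) :
    (∀ x, G.CMem x → α * x + β ≤ 0) ∨ (∀ x, G.CMem x → 0 ≤ α * x + β) := by
  by_contra! hc
  obtain ⟨⟨x, hx, hx'⟩, y, hy, hy'⟩ := hc
  rcases eq_or_ne α 0 with h0 | h0
  · subst h0
    linarith
  -- Strictly opposite signs at `x` and `y` force this zero to lie strictly between them, hence in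
  -- the open interval, where `hf` excludes it.
  have hz : α * (-β / α) + β = 0 := by
    field_simp
    ring
  set z := -β / α
  have h₁ : 0 < α * (x - z) := by linarith
  have h₂ : α * (y - z) < 0 := by linarith
  rcases lt_or_gt_of_ne h0 with h3 | h3
  · have h₄ : x < z := by nlinarith
    have h₅ : z < y := by nlinarith
    exact h0 (hf z (h.mem_of_between hx hy h₄ h₅) hz)
  · have h₄ : z < x := by nlinarith
    have h₅ : y < z := by nlinarith
    exact h0 (hf z (h.mem_of_between hy hx h₅ h₄) hz)

end Strip

/-! ### Dominating lines, and the side of a vertical line to keep -/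

section Geometry

variable {n : ℕ} (L : LP n) (c : ℝ × ℝ)

/-- On the strip `G`, one of the lines with index in `[a, a + len)` is above all others. -/
def LP.Dominated (s : ℝ) (G : Strip) (a len : ℕ) : Prop :=
  (∀ i, a ≤ i → i < a + len → L.line c s i = none) ∨
  ∃ l, (∃ i, a ≤ i ∧ i < a + len ∧ L.line c s i = some l) ∧
    ∀ i, a ≤ i → i < a + len → ∀ l', L.line c s i = some l' →
      ∀ x, G.CMem x → lineAt l' x ≤ lineAt l x

open Classical in
/-- The crossing of the best lines at `X` of the two halves of the block `i` of length
`2 * h`. -/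
noncomputable def LP.cand (s X : ℝ) (h i : ℕ) : Option ℝ :=
  match L.best c s X (i * 2 * h) h, L.best c s X (i * 2 * h + h) h with
  | some l, some l' => if l'.1 = l.1 then none else some ((l'.2 - l.2) / (l.1 - l'.1))
  | _, _ => none

variable {L c}

theorem LP.Dominated.mono {s : ℝ} {G G' : Strip} {a len : ℕ} (h : L.Dominated c s G a len)
    (hG : ∀ x, G'.CMem x → G.CMem x) : L.Dominated c s G' a len := by
  rcases h with h | ⟨l, hl, h⟩
  · exact Or.inl h
  · exact Or.inr ⟨l, hl, fun i hi hi' l' hl' x hx => h i hi hi' l' hl' x (hG x hx)⟩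

/-- The start of the merging process. -/
theorem LP.dominated_one (s : ℝ) (G : Strip) (a : ℕ) : L.Dominated c s G a 1 := by
  rcases h : L.line c s a with _ | l
  · refine Or.inl fun i hi hi' => ?_
    obtain rfl : i = a := by omega
    exact h
  · refine Or.inr ⟨l, ⟨a, le_rfl, by omega, h⟩, fun i hi hi' l' hl' x _ => ?_⟩
    obtain rfl : i = a := by omega
    rw [h] at hl'
    cases hl'
    exact le_rfl

/-- Let `l₀` be the dominating line. Then `l₀ - l` is nonnegative on the strip and at most `0` at
the middle point, so it vanishes on the strip. Thus dominating lines need no memory: one pass over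
the block at the middle point recovers them. -/
theorem LP.Dominated.best {s : ℝ} {G : Strip} {a len : ℕ} (h : L.Dominated c s G a len)
    (hG : G.Valid) {l : ℝ × ℝ} (hl : L.best c s G.mid a len = some l) {i : ℕ} (hi : a ≤ i)
    (hi' : i < a + len) {l' : ℝ × ℝ} (hl' : L.line c s i = some l') {x : ℝ} (hx : G.CMem x) :
    lineAt l' x ≤ lineAt l x := by
  obtain ⟨⟨j, hj, hj', hjl⟩, h₁⟩ := LP.best_eq_some hl
  rcases h with h | ⟨l₀, ⟨k, hk, hk', hkl⟩, h⟩
  · rw [h i hi hi'] at hl'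
    cases hl'
  · have h₂ := hG.affine_eq_zero (α := l₀.1 - l.1) (β := l₀.2 - l.2)
      (fun y hy => by have := h j hj hj' l hjl y hy; unfold lineAt at this; linarith)
      (by have := h₁ k hk hk' l₀ hkl; unfold lineAt at this; linarith) hx
    have h₃ := h i hi hi' l' hl' x hx
    unfold lineAt at *
    linarith

/-- If the halves of a block are dominated and the crossing of their best lines is outside of
the strip, then the block is dominated. -/
theorem LP.Dominated.double {s : ℝ} {G G' : Strip} {h i : ℕ}
    (h₁ : L.Dominated c s G (i * 2 * h) h) (h₂ : L.Dominated c s G (i * 2 * h + h) h)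
    (hG : G.Valid) (hG' : G'.Ends) (hGG : ∀ x, G'.CMem x → G.CMem x)
    (hc : ∀ x, L.cand c s G.mid h i = some x → ¬ G'.Mem x) :
    L.Dominated c s G' (i * 2 * h) (2 * h) := by
  rcases e₁ : L.best c s G.mid (i * 2 * h) h with _ | l
  · have h₃ := LP.best_eq_none e₁
    rcases h₂ with h₂ | ⟨l, ⟨k, hk, hk', hkl⟩, h₂⟩
    · refine Or.inl fun j hj hj' => ?_
      by_cases hh : j < i * 2 * h + h
      · exact h₃ j hj hh
      · exact h₂ j (by omega) (by omega)
    · refine Or.inr ⟨l, ⟨k, by omega, by omega, hkl⟩, fun j hj hj' l' hl' x hx => ?_⟩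
      by_cases hh : j < i * 2 * h + h
      · rw [h₃ j hj hh] at hl'
        cases hl'
      · exact h₂ j (by omega) (by omega) l' hl' x (hGG x hx)
  rcases e₂ : L.best c s G.mid (i * 2 * h + h) h with _ | l'
  · have h₃ := LP.best_eq_none e₂
    rcases h₁ with h₁ | ⟨l, ⟨k, hk, hk', hkl⟩, h₁⟩
    · refine Or.inl fun j hj hj' => ?_
      by_cases hh : j < i * 2 * h + h
      · exact h₁ j hj hh
      · exact h₃ j (by omega) (by omega)
    · refine Or.inr ⟨l, ⟨k, by omega, by omega, hkl⟩, fun j hj hj' l' hl' x hx => ?_⟩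
      by_cases hh : j < i * 2 * h + h
      · exact h₁ j (by omega) (by omega) l' hl' x (hGG x hx)
      · rw [h₃ j (by omega) (by omega)] at hl'
        cases hl'
  -- The two lines are parallel, or their difference vanishes only at the candidate, which is not in
  -- the open strip.
  have hsign : (∀ x, G'.CMem x → (l'.1 - l.1) * x + (l'.2 - l.2) ≤ 0) ∨
      (∀ x, G'.CMem x → 0 ≤ (l'.1 - l.1) * x + (l'.2 - l.2)) := by
    refine hG'.affine_sign fun z hz hz0 => ?_
    by_contra hne
    have hne' : l'.1 ≠ l.1 := fun h => hne (sub_eq_zero.2 h)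
    refine hc z ?_ hz
    simp only [LP.cand, e₁, e₂, if_neg hne', Option.some.injEq]
    rw [div_eq_iff (sub_ne_zero.2 hne'.symm)]
    linarith
  obtain ⟨⟨j, hj, hj', hjl⟩, -⟩ := LP.best_eq_some e₁
  obtain ⟨⟨k, hk, hk', hkl⟩, -⟩ := LP.best_eq_some e₂
  rcases hsign with hs | hs
  · refine Or.inr ⟨l, ⟨j, by omega, by omega, hjl⟩, fun m hm hm' l₀ hl₀ x hx => ?_⟩
    by_cases hh : m < i * 2 * h + h
    · exact h₁.best hG e₁ hm hh hl₀ (hGG x hx)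
    · have h₃ := h₂.best hG e₂ (by omega) (by omega) hl₀ (hGG x hx)
      have h₄ := hs x hx
      unfold lineAt at *
      linarith
  · refine Or.inr ⟨l', ⟨k, by omega, by omega, hkl⟩, fun m hm hm' l₀ hl₀ x hx => ?_⟩
    by_cases hh : m < i * 2 * h + h
    · have h₃ := h₁.best hG e₁ (by omega) (by omega) hl₀ (hGG x hx)
      have h₄ := hs x hx
      unfold lineAt at *
      linarith
    · exact h₂.best hG e₂ (by omega) (by omega) hl₀ (hGG x hx)

variable (L c)

/-- The constraints that bound `x` only are satisfied at `x`. -/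
def LP.InRange (x : ℝ) : Prop := ∀ i < n, L.coeffY c i = 0 → L.bound i ≤ L.coeffX c i * x

/-- The problem may be restricted to the strip. -/
structure LP.Reduces (G : Strip) : Prop where
  inRange : ∀ x, G.CMem x → L.InRange c x
  exists_feas : ∀ x y, L.Feas c x y → ∃ x' y', G.CMem x' ∧ y' ≤ y ∧ L.Feas c x' y'

/-- The side of `v` to which the search turns, given the best lower and upper line at `v`. -/
def TurnsRight (v : ℝ) : Option (ℝ × ℝ) → Option (ℝ × ℝ) → Prop
  | none, _ => True
  | some l, none => l.1 ≤ 0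
  | some l, some l' =>
    -- If there are feasible points above `v`, go where the lower line descends; otherwise go where
    -- the gap between the lower and the upper line shrinks.
    (lineAt l v + lineAt l' v ≤ 0 ∧ l.1 ≤ 0) ∨ (0 < lineAt l v + lineAt l' v ∧ l.1 + l'.1 < 0)

variable {L c}

theorem LP.best_bound {s X : ℝ} {l : ℝ × ℝ} (h : L.best c s X 0 n = some l) {i : ℕ} {l' : ℝ × ℝ}
    (hl' : L.line c s i = some l') : lineAt l' X ≤ lineAt l X := by
  refine (LP.best_eq_some h).2 i (Nat.zero_le i) ?_ l' hl'
  by_contra hi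
  rw [LP.line_of_le (by omega)] at hl'
  cases hl'

theorem LP.best_none {s X : ℝ} (h : L.best c s X 0 n = none) (i : ℕ) : L.line c s i = none := by
  by_cases hi : i < n
  · exact LP.best_eq_none h i (Nat.zero_le i) (by omega)
  · exact LP.line_of_le (by omega)

/-- Feasibility of a point on the vertical line at `v` in terms of the best lines. -/
theorem LP.feas_of_best {v y : ℝ} (hv : L.InRange c v)
    (h₁ : ∀ l, L.best c 1 v 0 n = some l → lineAt l v ≤ y)
    (h₂ : ∀ l, L.best c (-1) v 0 n = some l → lineAt l v ≤ -y) : L.Feas c v y := by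
  refine LP.feas_of_lines (fun i l hl => ?_) (fun i l hl => ?_) hv
  · rcases e : L.best c 1 v 0 n with _ | l₀
    · rw [LP.best_none e] at hl
      cases hl
    · exact (LP.best_bound e hl).trans (h₁ _ e)
  · rcases e : L.best c (-1) v 0 n with _ | l₀
    · rw [LP.best_none e] at hl
      cases hl
    · exact (LP.best_bound e hl).trans (h₂ _ e)

theorem LP.Feas.best_le {x y X s : ℝ} (h : L.Feas c x y) (hs : s * s = 1) {l : ℝ × ℝ}
    (hl : L.best c s X 0 n = some l) : lineAt l x ≤ s * y := by
  obtain ⟨⟨i, -, -, hi⟩, -⟩ := LP.best_eq_some hl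
  exact h.lineAt_le hs hi

/-- If the vertical line at `v` contains feasible points, the best lower line at `v` does not
descend towards the rejected side, so its point at `v` is feasible and not higher than `y`. If it
contains none, the sum of the two best lines is positive on the rejected side as well, which
contradicts the feasibility of `(x, y)`. Without any lower line, a point at `v` can be taken as low
as needed. -/
theorem LP.feas_turn {v x y : ℝ} (hv : L.InRange c v) (h : L.Feas c x y)
    (ht : (x < v ∧ TurnsRight v (L.best c 1 v 0 n) (L.best c (-1) v 0 n)) ∨
      (v < x ∧ ¬ TurnsRight v (L.best c 1 v 0 n) (L.best c (-1) v 0 n))) :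
    ∃ y' ≤ y, L.Feas c v y' := by
  rcases e₁ : L.best c 1 v 0 n with _ | l
  · rcases e₂ : L.best c (-1) v 0 n with _ | l'
    · exact ⟨y, le_rfl, LP.feas_of_best hv (by simp [e₁]) (by simp [e₂])⟩
    · refine ⟨min y (-lineAt l' v), min_le_left _ _, LP.feas_of_best hv (by simp [e₁]) ?_⟩
      intro l hl
      rw [e₂] at hl
      cases hl
      linarith [min_le_right y (-lineAt l' v)]
  have h₁ := h.best_le (by norm_num) e₁
  rcases e₂ : L.best c (-1) v 0 n with _ | l'
  · refine ⟨lineAt l v, ?_, LP.feas_of_best hv (by simp [e₁]) (by simp [e₂])⟩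
    simp only [e₁, e₂, TurnsRight, not_le] at ht
    unfold lineAt at *
    rcases ht with ⟨h₂, h₃⟩ | ⟨h₂, h₃⟩ <;> nlinarith
  have h₂ := h.best_le (by norm_num) e₂
  simp only [e₁, e₂, TurnsRight] at ht
  by_cases hf : lineAt l v + lineAt l' v ≤ 0
  · refine ⟨lineAt l v, ?_, LP.feas_of_best hv (by simp [e₁]) ?_⟩
    · simp only [hf, true_and, not_lt.2 hf, false_and, or_false, not_le] at ht
      unfold lineAt at *
      rcases ht with ⟨h₂, h₃⟩ | ⟨h₂, h₃⟩ <;> nlinarith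
    · intro l hl
      rw [e₂] at hl
      cases hl
      linarith
  · exfalso
    simp only [hf, false_and, not_le.1 hf, true_and, false_or, not_lt] at ht
    unfold lineAt at *
    rcases ht with ⟨h₂, h₃⟩ | ⟨h₂, h₃⟩ <;> nlinarith

theorem LP.Reduces.turnRight {G : Strip} {v : ℝ} (h : L.Reduces c G) (hG : G.Ends)
    (hv : G.CMem v) (ht : TurnsRight v (L.best c 1 v 0 n) (L.best c (-1) v 0 n)) :
    L.Reduces c (G.setLo v) := by
  refine ⟨fun x hx => h.inRange x ((Strip.cMem_setLo hG hv).1 hx).1, fun x y hxy => ?_⟩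
  obtain ⟨x', y', h₁, h₂, h₃⟩ := h.exists_feas x y hxy
  by_cases hx : v ≤ x'
  · exact ⟨x', y', (Strip.cMem_setLo hG hv).2 ⟨h₁, hx⟩, h₂, h₃⟩
  · obtain ⟨y'', h₄, h₅⟩ := LP.feas_turn (h.inRange v hv) h₃ (Or.inl ⟨not_le.1 hx, ht⟩)
    exact ⟨v, y'', (Strip.cMem_setLo hG hv).2 ⟨hv, le_rfl⟩, h₄.trans h₂, h₅⟩

theorem LP.Reduces.turnLeft {G : Strip} {v : ℝ} (h : L.Reduces c G) (hG : G.Ends)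
    (hv : G.CMem v) (ht : ¬ TurnsRight v (L.best c 1 v 0 n) (L.best c (-1) v 0 n)) :
    L.Reduces c (G.setHi v) := by
  refine ⟨fun x hx => h.inRange x ((Strip.cMem_setHi hG hv).1 hx).1, fun x y hxy => ?_⟩
  obtain ⟨x', y', h₁, h₂, h₃⟩ := h.exists_feas x y hxy
  by_cases hx : x' ≤ v
  · exact ⟨x', y', (Strip.cMem_setHi hG hv).2 ⟨h₁, hx⟩, h₂, h₃⟩
  · obtain ⟨y'', h₄, h₅⟩ := LP.feas_turn (h.inRange v hv) h₃ (Or.inr ⟨not_le.1 hx, ht⟩)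
    exact ⟨v, y'', (Strip.cMem_setHi hG hv).2 ⟨hv, le_rfl⟩, h₄.trans h₂, h₅⟩

/-- On a strip on which one line of each sign dominates, feasibility is decided by these
lines. -/
theorem LP.Reduces.feas_iff {G : Strip} (h : L.Reduces c G) (hG : G.Valid)
    (hd : ∀ s : ℝ, s = 1 ∨ s = -1 → L.Dominated c s G 0 n) {x : ℝ} (hx : G.CMem x) (y : ℝ) :
    L.Feas c x y ↔ (∀ l, L.best c 1 G.mid 0 n = some l → lineAt l x ≤ y) ∧
      (∀ l, L.best c (-1) G.mid 0 n = some l → lineAt l x ≤ -y) := by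
  constructor
  · intro hf
    constructor
    · intro l hl
      linarith [hf.best_le (s := 1) (by norm_num) hl]
    · intro l hl
      linarith [hf.best_le (s := -1) (by norm_num) hl]
  · rintro ⟨h₁, h₂⟩
    have key : ∀ s : ℝ, s = 1 ∨ s = -1 → ∀ z, (∀ l, L.best c s G.mid 0 n = some l → lineAt l x ≤ z) →
        ∀ i l, L.line c s i = some l → lineAt l x ≤ z := by
      intro s hs z hz i l hl
      have hi : i < n := by
        by_contra hi
        rw [LP.line_of_le (by omega)] at hl
        cases hl
      rcases e : L.best c s G.mid 0 n with _ | l₀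
      · rw [LP.best_none e] at hl
        cases hl
      · exact ((hd s hs).best hG e (Nat.zero_le i) (by omega) hl hx).trans (hz _ e)
    exact LP.feas_of_lines (key 1 (Or.inl rfl) y h₁) (key (-1) (Or.inr rfl) (-y) h₂)
      (h.inRange x hx)

end Geometry


/-! ### Finding the best line of a block -/

/-- The states agree except for the integer cells in `I` and the real cells in `R`. -/
structure Agree (I R : Finset ℕ) (σ σ' : State) : Prop where
  int : ∀ k, k ∉ I → σ'.int k = σ.int k
  num : ∀ k, k ∉ R → σ'.num k = σ.num k

theorem Agree.refl (I R : Finset ℕ) (σ : State) : Agree I R σ σ := ⟨fun _ _ => rfl, fun _ _ => rfl⟩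

theorem Agree.trans {I R : Finset ℕ} {σ σ' σ'' : State} (h : Agree I R σ σ')
    (h' : Agree I R σ' σ'') : Agree I R σ σ'' :=
  ⟨fun k hk => (h'.int k hk).trans (h.int k hk), fun k hk => (h'.num k hk).trans (h.num k hk)⟩

theorem Agree.mono {I R I' R' : Finset ℕ} {σ σ' : State} (h : Agree I R σ σ') (hI : I ⊆ I')
    (hR : R ⊆ R') : Agree I' R' σ σ' :=
  ⟨fun k hk => h.int k fun h => hk (hI h), fun k hk => h.num k fun h => hk (hR h)⟩

theorem Agree.setInt {I R : Finset ℕ} {σ σ' : State} (h : Agree I R σ σ') {k : ℕ} (hk : k ∈ I)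
    (v : ℕ) : Agree I R σ (σ'.setInt k v) := by
  refine ⟨fun j hj => ?_, h.num⟩
  rw [State.setInt_int, if_neg (by rintro rfl; exact hj hk), h.int j hj]

theorem Agree.setNum {I R : Finset ℕ} {σ σ' : State} (h : Agree I R σ σ') {k : ℕ} (hk : k ∈ R)
    (v : Num) : Agree I R σ (σ'.setNum k v) := by
  refine ⟨h.int, fun j hj => ?_⟩
  rw [State.setNum_num, if_neg (by rintro rfl; exact hj hk), h.num j hj]

/-- The real parameters: the direction `c` in cells 2 and 3, the sign in cell 4 and the
abscissa in cell 5. -/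
structure Params (c : ℝ × ℝ) (s X : ℝ) (σ : State) : Prop where
  val₂ : (σ.num 2).val = c.1
  ops₂ : (σ.num 2).ops = 0
  val₃ : (σ.num 3).val = c.2
  ops₃ : (σ.num 3).ops = 0
  val₄ : (σ.num 4).val = s
  ops₄ : (σ.num 4).ops = 0
  val₅ : (σ.num 5).val = X
  -- The abscissa is either a pivot with at most 40 operations or a middle point, a quotient of two
  -- sums of such numbers, with at most 163.
  ops₅ : (σ.num 5).ops ≤ 200

theorem Params.congr {c : ℝ × ℝ} {s X : ℝ} {σ σ' : State} (h : Params c s X σ)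
    (h₂ : σ'.num 2 = σ.num 2) (h₃ : σ'.num 3 = σ.num 3) (h₄ : σ'.num 4 = σ.num 4)
    (h₅ : σ'.num 5 = σ.num 5) : Params c s X σ' := by
  obtain ⟨h1, h2, h3, h4, h5, h6, h7, h8⟩ := h
  constructor <;> simp_all

theorem Params.agree {c : ℝ × ℝ} {s X : ℝ} {σ σ' : State} {I R : Finset ℕ} (h : Params c s X σ)
    (ha : Agree I R σ σ') (h₂ : 2 ∉ R := by decide) (h₃ : 3 ∉ R := by decide)
    (h₄ : 4 ∉ R := by decide) (h₅ : 5 ∉ R := by decide) : Params c s X σ' :=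
  h.congr (ha.num 2 h₂) (ha.num 3 h₃) (ha.num 4 h₄) (ha.num 5 h₅)

/-- Integer cell 28 tells whether a line has been found, which then is in the real cells 12
and 13. -/
def HasBest (σ : State) : Option (ℝ × ℝ) → Prop
  | none => σ.int 28 = 0
  | some l => σ.int 28 = 1 ∧ (σ.num 12).val = l.1 ∧ (σ.num 13).val = l.2 ∧
      -- The divisor `s * coeffY` takes 4 operations, `0 - coeffX` takes 4, and the division is one
      -- more.
      (σ.num 12).ops ≤ 9 ∧ (σ.num 13).ops ≤ 9

/-- Take the line with index in cell 26 into account. -/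
def bestStep : Program :=
  rset 14 (rvar 4 * (.inA (ivar 26) * rvar 2 + .inB (ivar 26) * rvar 3)) ;;
  .cond (.numLe (rvar 14) (rlit 0)) .skip
    (rset 15 ((rlit 0 - (.inB (ivar 26) * rvar 2 - .inA (ivar 26) * rvar 3)) / rvar 14) ;;
      rset 14 (.inRhs (ivar 26) / rvar 14) ;;
      .cond (.intEq (ivar 28) (ilit 0))
        (rset 12 (rvar 15) ;; rset 13 (rvar 14) ;; iset 28 (ilit 1))
        (.cond (.numLe (rvar 15 * rvar 5 + rvar 14) (rvar 12 * rvar 5 + rvar 13)) .skip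
          (rset 12 (rvar 15) ;; rset 13 (rvar 14)))) ;;
  iset 26 (ivar 26 + ilit 1)

/-- Initialization of `bestProg`. -/
def bestInit : Program :=
  .cond (.intLe (ivar 27) .size) .skip (iset 27 .size) ;; iset 28 (ilit 0)

/-- Find the best line with index from the value of cell 26 up to that of cell 27. -/
def bestProg : Program := bestInit ;; .loop (.intLe (ivar 26 + ilit 1) (ivar 27)) bestStep

abbrev bestInts : Finset ℕ := {26, 27, 28}
abbrev bestNums : Finset ℕ := {12, 13, 14, 15}

section

variable {B : Limits} {n : ℕ} [Roomy B n] {L : LP n} {c : ℝ × ℝ} {s X : ℝ}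

/-- Symbolic execution of the loop body; the cases are those of the recursion for `best`. -/
theorem wp_bestStep {σ : State} (hp : Params c s X σ) {a len : ℕ} (hi : σ.int 26 = a + len)
    (hn : a + len < n) (hb : HasBest σ (L.best c s X a len)) :
    bestStep.wp B L σ fun σ' => σ'.int 26 = a + (len + 1) ∧ σ'.int 27 = σ.int 27 ∧
      HasBest σ' (L.best c s X a (len + 1)) ∧ Agree bestInts bestNums σ σ' := by
  obtain ⟨h₁, h₂, h₃, h₄, h₅, h₆, h₇, h₈⟩ := hp
  have hB := Roomy.maxInt B (n := n)
  have hO := Roomy.ops (B := B) n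
  have hline : L.line c s (a + len) = if 0 < s * L.coeffY c (a + len) then
    some ((0 - L.coeffX c (a + len)) / (s * L.coeffY c (a + len)),
      L.bound (a + len) / (s * L.coeffY c (a + len))) else none := rfl
  have hC : 0 < s * L.coeffY c (a + len) → s ≠ 0 ∧ L.coeffY c (a + len) ≠ 0 := fun h =>
    ⟨left_ne_zero_of_mul h.ne', right_ne_zero_of_mul h.ne'⟩
  rcases e : L.best c s X a len with _ | l
  · rw [e] at hb
    simp only [HasBest] at hb
    by_cases h : 0 < s * L.coeffY c (a + len)
    · obtain ⟨hs, hc⟩ := hC h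
      rw [LP.best, hline, if_pos h, e]
      unfold LP.coeffX
      unfold LP.coeffY at *
      simp [bestStep, h₁, h₂, h₃, h₄, h₅, h₆, h₇, hi, hn, hb, h, h.not_ge, hs, hc, HasBest]
      and_intros
      all_goals first | omega | skip
      repeat' first | exact Agree.refl _ _ _ | refine Agree.setNum ?_ (by decide) _ |
        refine Agree.setInt ?_ (by decide) _
    · rw [LP.best, hline, if_neg h, e]
      unfold LP.coeffY at *
      simp [bestStep, h₁, h₂, h₃, h₄, h₅, h₆, h₇, hi, hn, hb, h, not_lt.1 h, HasBest]
      and_intros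
      all_goals first | omega | skip
      repeat' first | exact Agree.refl _ _ _ | refine Agree.setNum ?_ (by decide) _ |
        refine Agree.setInt ?_ (by decide) _
  · rw [e] at hb
    simp only [HasBest] at hb
    obtain ⟨b₁, b₂, b₃, b₄, b₅⟩ := hb
    by_cases h : 0 < s * L.coeffY c (a + len)
    · obtain ⟨hs, hc⟩ := hC h
      rw [LP.best, hline, if_pos h, e]
      by_cases h' : lineAt ((0 - L.coeffX c (a + len)) / (s * L.coeffY c (a + len)),
          L.bound (a + len) / (s * L.coeffY c (a + len))) X ≤ lineAt l X
      · dsimp only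
        rw [if_pos h']
        unfold LP.coeffX lineAt at *
        unfold LP.coeffY at *
        simp at h'
        simp [bestStep, h₁, h₂, h₃, h₄, h₅, h₆, h₇, hi, hn, b₁, b₂, b₃, b₄, b₅, h, h.not_ge, hs,
          hc, HasBest, h']
        and_intros
        all_goals first | omega | skip
        repeat' first | exact Agree.refl _ _ _ | refine Agree.setNum ?_ (by decide) _ |
          refine Agree.setInt ?_ (by decide) _
      · dsimp only
        rw [if_neg h']
        unfold LP.coeffX lineAt at *
        unfold LP.coeffY at *
        simp at h'
        simp [bestStep, h₁, h₂, h₃, h₄, h₅, h₆, h₇, hi, hn, b₁, b₂, b₃, h, h.not_ge, hs,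
          hc, HasBest, h']
        and_intros
        all_goals first | omega | skip
        repeat' first | exact Agree.refl _ _ _ | refine Agree.setNum ?_ (by decide) _ |
          refine Agree.setInt ?_ (by decide) _
    · rw [LP.best, hline, if_neg h, e]
      unfold LP.coeffY at *
      simp [bestStep, h₁, h₂, h₃, h₄, h₅, h₆, h₇, hi, hn, b₁, b₂, b₃, b₄, b₅, h, not_lt.1 h,
        HasBest]
      and_intros
      all_goals first | omega | skip
      repeat' first | exact Agree.refl _ _ _ | refine Agree.setNum ?_ (by decide) _ |
        refine Agree.setInt ?_ (by decide) _

/-- The time constant of `bestProg`. -/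
def bestCost : ℕ := bestProg.maxCost + bestStep.maxCost

theorem runs_bestProg {σ : State} (hp : Params c s X σ) {a len : ℕ} (ha : σ.int 26 = a)
    (hl : σ.int 27 = a + len) (ha' : a + 1 ≤ B.maxInt) :
    Runs B L bestProg σ (bestCost * (min len (n - a) + 1)) fun σ' =>
      HasBest σ' (L.best c s X a len) ∧ Agree bestInts bestNums σ σ' := by
  have hB := Roomy.maxInt B (n := n)
  -- `bestInit` caps the end of the block at `n`, so `N` is the true number of iterations.
  rw [← LP.best_min]
  set N := min len (n - a) with hN
  have h₁ : Runs B L bestInit σ bestInit.maxCost fun σ' =>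
      σ'.int 26 = a ∧ σ'.int 27 = min (a + len) n ∧ HasBest σ' (L.best c s X a 0) ∧
        Agree bestInts bestNums σ σ' := by
    apply Runs.of_wp
    simp [bestInit, ha, hl, LP.best, HasBest]
    exact ⟨fun h => ⟨h, (Agree.refl _ _ _).setInt (by decide) _⟩,
      fun h => ⟨h.le, ((Agree.refl _ _ _).setInt (by decide) _).setInt (by decide) _⟩⟩
  have h₃ : ∀ σ', (σ'.int 26 = a ∧ σ'.int 27 = min (a + len) n ∧
      HasBest σ' (L.best c s X a 0) ∧ Agree bestInts bestNums σ σ') →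
      Runs B L (.loop (.intLe (ivar 26 + ilit 1) (ivar 27)) bestStep) σ'
        (∑ i ∈ Finset.range N, ((Test.intLe (ivar 26 + ilit 1) (ivar 27)).cost + bestStep.maxCost) +
          (Test.intLe (ivar 26 + ilit 1) (ivar 27)).cost) fun σ' =>
        HasBest σ' (L.best c s X a N) ∧ Agree bestInts bestNums σ σ' := by
    rintro σ' ⟨e₁, e₂, e₃, e₄⟩
    refine Runs.loop_for (I := fun j σ' => σ'.int 26 = a + j ∧
      σ'.int 27 = min (a + len) n ∧ HasBest σ' (L.best c s X a j) ∧ Agree bestInts bestNums σ σ')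
      (c := fun _ => bestStep.maxCost) N ?_ ?_ ⟨e₁, e₂, e₃, e₄⟩
    · rintro σ₁ ⟨f₂, f₃, f₄, f₅⟩
      simp [f₂, f₃]
      exact ⟨by omega, by omega, f₄, f₅⟩
    · rintro j hj σ₁ ⟨f₂, f₃, f₄, f₅⟩
      refine ⟨by simp [f₂]; omega, by simp [f₂, f₃]; omega, ?_⟩
      refine (Runs.of_wp (wp_bestStep (hp.agree f₅) f₂ (by omega) f₄)).mono le_rfl ?_
      rintro σ₂ ⟨g₁, g₂, g₃, g₄⟩
      exact ⟨g₁, by rw [g₂, f₃], g₃, f₅.trans g₄⟩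
  refine (h₁.andThen h₃).mono ?_ fun _ h => h
  simp only [Finset.sum_const, Finset.card_range, smul_eq_mul, bestCost, bestProg,
    Program.maxCost]
  nlinarith

/-! ### Scanning a block of candidates -/

/-- Initialization of `candProg`. -/
def candInit : Program := iset 21 (ilit 0) ;; iset 26 (ivar 16 * ilit 2 * ivar 5)

/-- Save the best line of the first half and turn to the second half. -/
def candNext : Program :=
  iset 23 (ivar 28) ;; rset 10 (rvar 12) ;; rset 11 (rvar 13) ;;
  iset 26 (ivar 16 * ilit 2 * ivar 5 + ivar 5) ;; iset 27 (ivar 26 + ivar 5)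

/-- Compute the crossing of the two best lines. -/
def candCross : Program :=
  .cond (.intEq (ivar 23) (ilit 0)) .skip (.cond (.intEq (ivar 28) (ilit 0)) .skip
    (.cond (.numEq (rvar 12) (rvar 10)) .skip
      (rset 9 ((rvar 13 - rvar 11) / (rvar 10 - rvar 12)) ;; iset 21 (ilit 1))))

/-- The candidate with index in cell 16; cell 21 tells whether there is one. -/
def candProg : Program :=
  candInit ;;
  .cond (.intLe .size (ivar 26)) .skip
    (iset 27 (ivar 26 + ivar 5) ;; bestProg ;; candNext ;; bestProg ;; candCross)

/-- Integer cell 21 tells whether there is a candidate, which then is in the real cell 9. -/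
def HasCand (σ : State) : Option ℝ → Prop
  | none => σ.int 21 = 0
  -- A crossing is the quotient of two differences of numbers with at most 9 operations: `19 + 19 +
  -- 1 = 39`. It is always recomputed from the input, so the bound does not grow during the run.
  | some x => σ.int 21 = 1 ∧ (σ.num 9).val = x ∧ (σ.num 9).ops ≤ 40

abbrev candInts : Finset ℕ := {21, 23, 26, 27, 28}
abbrev candNums : Finset ℕ := {9, 10, 11, 12, 13, 14, 15}

/-- The time constant of `candProg`. -/
def candCost : ℕ := candProg.maxCost + 4 * bestCost

/-- A bound for the time needed for the candidate `i`. -/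
def candTime (n h i : ℕ) : ℕ := candCost * (1 + if i * 2 * h < n then h else 0)

theorem runs_candProg {σ : State} (hp : Params c s X σ) {i h : ℕ} (hi : σ.int 16 = i)
    (hh : σ.int 5 = h) (hh₁ : 1 ≤ h) (hib : i * 2 * h + 2 * h ≤ B.maxInt) :
    Runs B L candProg σ (candTime n h i) fun σ' =>
      HasCand σ' (L.cand c s X h i) ∧ Agree candInts candNums σ σ' := by
  have hB := Roomy.maxInt B (n := n)
  have hO := Roomy.ops (B := B) n
  -- The intermediate product has to respect the integer limit, too.
  have hi2 : i * 2 ≤ i * 2 * h := Nat.le_mul_of_pos_right _ hh₁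
  have h₁ : Runs B L candInit σ candInit.maxCost fun σ' => σ'.int 21 = 0 ∧
      σ'.int 26 = i * 2 * h ∧ Agree candInts candNums σ σ' := by
    apply Runs.of_wp
    simp [candInit, hi, hh]
    exact ⟨⟨by omega, by omega⟩, ((Agree.refl _ _ _).setInt (by decide) _).setInt (by decide) _⟩
  -- Blocks that start beyond `n` are dismissed in constant time. This keeps the cost of a scan
  -- linear in `n` plus the number of indices.
  by_cases hn : n ≤ i * 2 * h
  · have hc : L.cand c s X h i = none := by
      rw [LP.cand, LP.best_of_le hn]
    rw [hc]
    refine (h₁.andThen fun σ' h' => Runs.cond (T := 1)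
      (Q := fun σ' => HasCand σ' none ∧ Agree candInts candNums σ σ') (by simp) ?_ ?_).mono ?_
      fun _ h => h
    · rintro -
      exact Runs.of_wp (p := .skip) ⟨h'.1, h'.2.2⟩
    · intro hf
      simp [h'.2.1] at hf
      omega
    · refine le_trans ?_ (Nat.le_mul_of_pos_right candCost (by omega))
      simp only [candCost, candProg, Program.maxCost]
      omega
  · have h₂ : ∀ σ', (σ'.int 21 = 0 ∧ σ'.int 26 = i * 2 * h ∧ Agree candInts candNums σ σ') →
        Runs B L (iset 27 (ivar 26 + ivar 5)) σ' (iset 27 (ivar 26 + ivar 5)).maxCost fun σ' =>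
          σ'.int 21 = 0 ∧ σ'.int 26 = i * 2 * h ∧ σ'.int 27 = i * 2 * h + h ∧
          Agree candInts candNums σ σ' := by
      rintro σ' ⟨e₁, e₂, e₃⟩
      apply Runs.of_wp
      simp [e₁, e₂, e₃.int, hh]
      exact ⟨by omega, e₃.setInt (by decide) _⟩
    have h₃ : ∀ σ', (σ'.int 21 = 0 ∧ σ'.int 26 = i * 2 * h ∧ σ'.int 27 = i * 2 * h + h ∧
        Agree candInts candNums σ σ') → Runs B L bestProg σ' (bestCost * (h + 1)) fun σ' =>
          σ'.int 21 = 0 ∧ HasBest σ' (L.best c s X (i * 2 * h) h) ∧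
          Agree candInts candNums σ σ' := by
      rintro σ' ⟨e₁, e₂, e₃, e₄⟩
      refine (runs_bestProg (hp.agree e₄) e₂ e₃ (by omega)).mono ?_ ?_
      · exact Nat.mul_le_mul_left _ (by omega)
      · rintro σ₁ ⟨f₁, f₂⟩
        exact ⟨by rw [f₂.int 21 (by decide), e₁], f₁, e₄.trans (f₂.mono (by decide) (by decide))⟩
    have h₄ : ∀ σ', (σ'.int 21 = 0 ∧ HasBest σ' (L.best c s X (i * 2 * h) h) ∧
        Agree candInts candNums σ σ') → Runs B L candNext σ' candNext.maxCost fun σ' =>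
          σ'.int 21 = 0 ∧ σ'.int 26 = i * 2 * h + h ∧ σ'.int 27 = i * 2 * h + h + h ∧
          (match L.best c s X (i * 2 * h) h with
            | none => σ'.int 23 = 0
            | some l => σ'.int 23 = 1 ∧ (σ'.num 10).val = l.1 ∧ (σ'.num 11).val = l.2 ∧
              (σ'.num 10).ops ≤ 9 ∧ (σ'.num 11).ops ≤ 9) ∧ Agree candInts candNums σ σ' := by
      rintro σ' ⟨e₁, e₂, e₃⟩
      apply Runs.of_wp
      rcases e : L.best c s X (i * 2 * h) h with _ | l
      · rw [e] at e₂
        simp [candNext, e₁, e₃.int, hi, hh]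
        and_intros
        all_goals first | omega | skip
        · exact e₂
        · repeat' first | exact e₃ | refine Agree.setNum ?_ (by decide) _ |
            refine Agree.setInt ?_ (by decide) _
      · rw [e] at e₂
        obtain ⟨b₁, b₂, b₃, b₄, b₅⟩ := e₂
        simp [candNext, e₁, e₃.int, hi, hh, b₁, b₂, b₃, b₄, b₅]
        and_intros
        all_goals first | omega | skip
        · repeat' first | exact e₃ | refine Agree.setNum ?_ (by decide) _ |
            refine Agree.setInt ?_ (by decide) _
    have h₅ : ∀ σ', (σ'.int 21 = 0 ∧ σ'.int 26 = i * 2 * h + h ∧ σ'.int 27 = i * 2 * h + h + h ∧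
          (match L.best c s X (i * 2 * h) h with
            | none => σ'.int 23 = 0
            | some l => σ'.int 23 = 1 ∧ (σ'.num 10).val = l.1 ∧ (σ'.num 11).val = l.2 ∧
              (σ'.num 10).ops ≤ 9 ∧ (σ'.num 11).ops ≤ 9) ∧ Agree candInts candNums σ σ') →
        Runs B L bestProg σ' (bestCost * (h + 1)) fun σ' => σ'.int 21 = 0 ∧
          (match L.best c s X (i * 2 * h) h with
            | none => σ'.int 23 = 0
            | some l => σ'.int 23 = 1 ∧ (σ'.num 10).val = l.1 ∧ (σ'.num 11).val = l.2 ∧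
              (σ'.num 10).ops ≤ 9 ∧ (σ'.num 11).ops ≤ 9) ∧
          HasBest σ' (L.best c s X (i * 2 * h + h) h) ∧ Agree candInts candNums σ σ' := by
      rintro σ' ⟨e₁, e₂, e₃, e₄, e₅⟩
      refine (runs_bestProg (hp.agree e₅) e₂ e₃ (by omega)).mono ?_ ?_
      · exact Nat.mul_le_mul_left _ (by omega)
      · rintro σ₁ ⟨f₁, f₂⟩
        refine ⟨by rw [f₂.int 21 (by decide), e₁], ?_, f₁,
          e₅.trans (f₂.mono (by decide) (by decide))⟩
        rw [f₂.int 23 (by decide), f₂.num 10 (by decide), f₂.num 11 (by decide)]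
        exact e₄
    have h₆ : ∀ σ', (σ'.int 21 = 0 ∧
          (match L.best c s X (i * 2 * h) h with
            | none => σ'.int 23 = 0
            | some l => σ'.int 23 = 1 ∧ (σ'.num 10).val = l.1 ∧ (σ'.num 11).val = l.2 ∧
              (σ'.num 10).ops ≤ 9 ∧ (σ'.num 11).ops ≤ 9) ∧
          HasBest σ' (L.best c s X (i * 2 * h + h) h) ∧ Agree candInts candNums σ σ') →
        Runs B L candCross σ' candCross.maxCost fun σ' =>
          HasCand σ' (L.cand c s X h i) ∧ Agree candInts candNums σ σ' := by
      rintro σ' ⟨e₁, e₂, e₃, e₄⟩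
      apply Runs.of_wp
      unfold LP.cand
      rcases e : L.best c s X (i * 2 * h) h with _ | l
      · rw [e] at e₂
        simp at e₂
        simp [candCross, e₂, HasCand, e₁, e₄]
      rcases e' : L.best c s X (i * 2 * h + h) h with _ | l'
      · rw [e'] at e₃
        simp [HasBest] at e₃
        rw [e] at e₂
        simp at e₂
        simp [candCross, e₂, HasCand, e₁, e₃, e₄]
      rw [e] at e₂
      rw [e'] at e₃
      obtain ⟨b₁, b₂, b₃, b₄, b₅⟩ := e₂
      obtain ⟨d₁, d₂, d₃, d₄, d₅⟩ := e₃
      by_cases hl : l'.1 = l.1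
      · simp [candCross, HasCand, *]
      · simp [candCross, HasCand, hl, b₁, b₂, b₃, d₁, d₂, d₃, sub_ne_zero.2 (Ne.symm hl)]
        and_intros
        all_goals first | omega | skip
        · repeat' first | exact e₄ | refine Agree.setNum ?_ (by decide) _ |
            refine Agree.setInt ?_ (by decide) _
    refine (h₁.andThen fun σ' h' => Runs.cond
      (T := (iset 27 (ivar 26 + ivar 5)).maxCost + (bestCost * (h + 1) + (candNext.maxCost +
        (bestCost * (h + 1) + candCross.maxCost))))
      (Q := fun σ' => HasCand σ' (L.cand c s X h i) ∧ Agree candInts candNums σ σ')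
      (by simp) ?_ ?_).mono ?_ fun _ h => h
    · intro hf
      simp [h'.2.1] at hf
      omega
    · rintro -
      exact (h₂ σ' h').andThen fun σ' h' => (h₃ σ' h').andThen fun σ' h' =>
        (h₄ σ' h').andThen fun σ' h' => (h₅ σ' h').andThen h₆
    · rw [candTime, if_pos (not_le.1 hn)]
      generalize hb : iset 27 (ivar 26 + ivar 5) = p
      have h₇ : candInit.maxCost + (Test.intLe IntExpr.size (ivar 26)).cost + p.maxCost +
          candNext.maxCost + candCross.maxCost + 4 * bestCost ≤ candCost := by
        rw [← hb]
        simp only [candCost, candProg, Program.maxCost]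
        omega
      refine le_trans ?_ (Nat.mul_le_mul_right _ h₇)
      nlinarith [Nat.zero_le ((candInit.maxCost + (Test.intLe IntExpr.size (ivar 26)).cost +
        p.maxCost + candNext.maxCost + candCross.maxCost) * h), Nat.zero_le (bestCost * h)]

end

/-! ### Counting candidates -/

open Classical in
/-- The number of indices in `[a, a + len)` for which `f` has a value that satisfies `P`. -/
noncomputable def count (f : ℕ → Option ℝ) (P : ℝ → Prop) (a len : ℕ) : ℕ :=
  ∑ i ∈ Finset.range len, if ∃ x, f (a + i) = some x ∧ P x then 1 else 0

theorem count_succ_of {f : ℕ → Option ℝ} {P : ℝ → Prop} {a len : ℕ} {x : ℝ}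
    (h : f (a + len) = some x) (hP : P x) : count f P a (len + 1) = count f P a len + 1 := by
  rw [count, Finset.sum_range_succ, if_pos ⟨x, h, hP⟩]
  rfl

theorem count_succ_of_not {f : ℕ → Option ℝ} {P : ℝ → Prop} {a len : ℕ}
    (h : ∀ x, f (a + len) = some x → ¬ P x) : count f P a (len + 1) = count f P a len := by
  rw [count, Finset.sum_range_succ, if_neg (by rintro ⟨x, h₁, h₂⟩; exact h x h₁ h₂)]
  rfl

theorem count_le (f : ℕ → Option ℝ) (P : ℝ → Prop) (a len : ℕ) : count f P a len ≤ len := by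
  refine (Finset.sum_le_card_nsmul _ _ 1 fun i _ => by split_ifs <;> simp).trans (by simp)

/-- A strip stored in four consecutive real cells. -/
structure HasStrip (σ : State) (a : ℕ) (G : Strip) : Prop where
  lx : (σ.num a).val = G.lx
  lw : (σ.num (a + 1)).val = G.lw
  hx : (σ.num (a + 2)).val = G.hx
  hw : (σ.num (a + 3)).val = G.hw
  ops₀ : (σ.num a).ops ≤ 40
  ops₁ : (σ.num (a + 1)).ops ≤ 40
  ops₂ : (σ.num (a + 2)).ops ≤ 40
  ops₃ : (σ.num (a + 3)).ops ≤ 40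

theorem HasStrip.congr {σ σ' : State} {a : ℕ} {G : Strip} (h : HasStrip σ a G)
    (h' : ∀ k < 4, σ'.num (a + k) = σ.num (a + k)) : HasStrip σ' a G := by
  have h₀ := h' 0 (by norm_num)
  have h₁ := h' 1 (by norm_num)
  have h₂ := h' 2 (by norm_num)
  have h₃ := h' 3 (by norm_num)
  obtain ⟨g₁, g₂, g₃, g₄, g₅, g₆, g₇, g₈⟩ := h
  simp only [add_zero] at h₀
  constructor <;> simp_all

theorem HasStrip.agree {σ σ' : State} {a : ℕ} {G : Strip} {I R : Finset ℕ} (h : HasStrip σ a G)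
    (ha : Agree I R σ σ') (h24 : 24 ≤ a) (hR : ∀ k ∈ R, k < 24 := by decide) :
    HasStrip σ' a G :=
  h.congr fun k _ => ha.num _ fun hk => by have := hR _ hk; omega

/-- Count the candidate in cell 9 if it lies in the strip at the address in cell 22: in
cell 18, and in the cells 19 and 20 if it is at most, respectively at least, the real cell 7. -/
def countProg : Program :=
  .cond (.numLe (rvar 9 * .cell (ivar 22 + ilit 1)) (.cell (ivar 22))) .skip
    (.cond (.numLe (.cell (ivar 22 + ilit 2)) (rvar 9 * .cell (ivar 22 + ilit 3))) .skip
      (iset 18 (ivar 18 + ilit 1) ;; rset 8 (rvar 9) ;;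
        .cond (.numLe (rvar 9) (rvar 7)) (iset 19 (ivar 19 + ilit 1)) .skip ;;
        .cond (.numLe (rvar 7) (rvar 9)) (iset 20 (ivar 20 + ilit 1)) .skip))

/-- Count the candidate with index in cell 16. -/
def scanStep : Program :=
  candProg ;;
  .cond (.intEq (ivar 21) (ilit 0)) .skip countProg ;;
  iset 16 (ivar 16 + ilit 1)

/-- Initialization of `scanProg`. -/
def scanInit : Program := iset 18 (ilit 0) ;; iset 19 (ilit 0) ;; iset 20 (ilit 0)

/-- Count the candidates with index from the value of cell 16 up to that of cell 17. -/
def scanProg : Program :=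
  scanInit ;; .loop (.intLe (ivar 16 + ilit 1) (ivar 17)) scanStep

abbrev countInts : Finset ℕ := {18, 19, 20}
abbrev scanInts : Finset ℕ := {16, 18, 19, 20, 21, 23, 26, 27, 28}
abbrev scanNums : Finset ℕ := {8, 9, 10, 11, 12, 13, 14, 15}

/-- The state after the scan of a block. -/
structure Scanned (f : ℕ → Option ℝ) (G : Strip) (v : ℝ) (a len : ℕ) (σ : State) : Prop where
  total : σ.int 18 = count f G.Mem a len
  le : σ.int 19 = count f (fun x => G.Mem x ∧ x ≤ v) a len
  ge : σ.int 20 = count f (fun x => G.Mem x ∧ v ≤ x) a len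
  -- The real cell 8 remembers the candidate counted last; it is the splitter if it is the only one.
  last : 1 ≤ count f G.Mem a len → ∃ i, a ≤ i ∧ i < a + len ∧ f i = some (σ.num 8).val ∧
    G.Mem (σ.num 8).val ∧ (σ.num 8).ops ≤ 40

section

variable {B : Limits} {n : ℕ} [Roomy B n] {L : LP n} {c : ℝ × ℝ} {s X : ℝ}

/-- The time constant of `scanProg`. -/
def scanCost : ℕ := candCost + 2 * scanProg.maxCost + scanStep.maxCost

/-- A bound for the time of a scan. -/
def blockTime (n h a len : ℕ) : ℕ :=
  ∑ i ∈ Finset.range len, scanCost * (1 + if (a + i) * 2 * h < n then h else 0)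

theorem Scanned.congr {f : ℕ → Option ℝ} {G : Strip} {v : ℝ} {a len : ℕ} {σ σ' : State}
    (h : Scanned f G v a len σ) (h₁ : σ'.int 18 = σ.int 18) (h₂ : σ'.int 19 = σ.int 19)
    (h₃ : σ'.int 20 = σ.int 20) (h₄ : σ'.num 8 = σ.num 8) : Scanned f G v a len σ' := by
  obtain ⟨g₁, g₂, g₃, g₄⟩ := h
  constructor <;> simp_all

theorem wp_countProg {σ : State} {f : ℕ → Option ℝ} {G : Strip} {v : ℝ} {a j ad : ℕ}
    (h22 : σ.int 22 = ad) (had : 24 ≤ ad) (had' : ad + 3 < B.cells) (had'' : ad + 3 ≤ B.maxInt)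
    (h7 : (σ.num 7).val = v) (hG : HasStrip σ ad G)
    (hf : f (a + j) = some (σ.num 9).val) (h9 : (σ.num 9).ops ≤ 40)
    (hs : Scanned f G v a j σ) (hj : j + 1 ≤ B.maxInt) :
    countProg.wp B L σ fun σ' => Scanned f G v a (j + 1) σ' ∧ Agree countInts {8} σ σ' := by
  have hO := Roomy.ops (B := B) n
  obtain ⟨g₁, g₂, g₃, g₄, g₅, g₆, g₇, g₈⟩ := hG
  have c₁ := count_le f G.Mem a j
  have c₂ := count_le f (fun x => G.Mem x ∧ x ≤ v) a j
  have c₃ := count_le f (fun x => G.Mem x ∧ v ≤ x) a j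
  have s₁ := hs.total
  have s₂ := hs.le
  have s₃ := hs.ge
  have hskip : ¬ G.Mem (σ.num 9).val →
      Scanned f G v a (j + 1) σ ∧ Agree countInts {8} σ σ := by
    intro hm
    refine ⟨?_, Agree.refl _ _ _⟩
    have e₁ : count f G.Mem a (j + 1) = count f G.Mem a j :=
      count_succ_of_not fun x hx => by rw [hf] at hx; cases hx; exact hm
    have e₂ : count f (fun x => G.Mem x ∧ x ≤ v) a (j + 1) = count f (fun x => G.Mem x ∧ x ≤ v) a j :=
      count_succ_of_not fun x hx => by rw [hf] at hx; cases hx; exact fun h => hm h.1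
    have e₃ : count f (fun x => G.Mem x ∧ v ≤ x) a (j + 1) = count f (fun x => G.Mem x ∧ v ≤ x) a j :=
      count_succ_of_not fun x hx => by rw [hf] at hx; cases hx; exact fun h => hm h.1
    refine ⟨by rw [s₁, e₁], by rw [s₂, e₂], by rw [s₃, e₃], fun h => ?_⟩
    obtain ⟨i, hi, hi', h⟩ := hs.last (by omega)
    exact ⟨i, hi, by omega, h⟩
  by_cases hm : G.Mem (σ.num 9).val
  · have e₁ : count f G.Mem a (j + 1) = count f G.Mem a j + 1 := count_succ_of hf hm
    have e₂ : count f (fun x => G.Mem x ∧ x ≤ v) a (j + 1) =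
        count f (fun x => G.Mem x ∧ x ≤ v) a j + if (σ.num 9).val ≤ v then 1 else 0 := by
      split_ifs with h
      · exact count_succ_of hf ⟨hm, h⟩
      · exact count_succ_of_not fun x hx => by rw [hf] at hx; cases hx; exact fun h' => h h'.2
    have e₃ : count f (fun x => G.Mem x ∧ v ≤ x) a (j + 1) =
        count f (fun x => G.Mem x ∧ v ≤ x) a j + if v ≤ (σ.num 9).val then 1 else 0 := by
      split_ifs with h
      · exact count_succ_of hf ⟨hm, h⟩
      · exact count_succ_of_not fun x hx => by rw [hf] at hx; cases hx; exact fun h' => h h'.2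
    have hm₁ := hm.1
    have hm₂ := hm.2
    have hfin : ∀ σ' : State, σ'.int 18 = σ.int 18 + 1 →
        σ'.int 19 = σ.int 19 + (if (σ.num 9).val ≤ v then 1 else 0) →
        σ'.int 20 = σ.int 20 + (if v ≤ (σ.num 9).val then 1 else 0) → σ'.num 8 = σ.num 9 →
        Scanned f G v a (j + 1) σ' := by
      intro σ' d₁ d₂ d₃ d₄
      refine ⟨by omega, by omega, by omega, fun _ => ⟨a + j, by omega, by omega, ?_⟩⟩
      rw [d₄]
      exact ⟨hf, hm, h9⟩
    simp [countProg, h22, g₁, g₂, g₃, g₄, h7, NumExpr.safe_cell, hm₁.not_ge, hm₂.not_ge]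
    and_intros
    all_goals first | omega | skip
    all_goals
      intro h
      and_intros
      all_goals first | omega | skip
      all_goals
        intro h'
        and_intros
        all_goals first | omega | skip
        all_goals try exact hfin _ (by simp) (by simp [h]) (by simp [h']) (by simp)
        all_goals
          repeat' first | exact Agree.refl _ _ _ | refine Agree.setNum ?_ (by decide) _ |
              refine Agree.setInt ?_ (by decide) _
  · simp only [Strip.Mem, not_and_or, not_lt] at hm hskip
    simp [countProg, h22, g₁, g₂, g₃, g₄, h7, NumExpr.safe_cell]
    and_intros
    all_goals first | omega | skip
    · intro h
      exact hskip (Or.inl h)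
    · intro h
      and_intros
      all_goals first | omega | skip
      · intro h'
        exact hskip (Or.inr h')
      · intro h'
        rcases hm with hm | hm <;> linarith

theorem runs_scanProg {σ : State} (hp : Params c s X σ) {a len h ad : ℕ} {G : Strip} {v : ℝ}
    (h16 : σ.int 16 = a) (h17 : σ.int 17 = a + len) (h5 : σ.int 5 = h) (h22 : σ.int 22 = ad)
    (hh : 1 ≤ h) (hlen : 1 ≤ len) (hB : (a + len + 1) * 2 * h ≤ B.maxInt)
    (had : 24 ≤ ad) (had' : ad + 3 < B.cells) (had'' : ad + 3 ≤ B.maxInt)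
    (h7 : (σ.num 7).val = v) (hG : HasStrip σ ad G) :
    Runs B L scanProg σ (blockTime n h a len) fun σ' =>
      Scanned (L.cand c s X h) G v a len σ' ∧ Agree scanInts scanNums σ σ' := by
  set f := L.cand c s X h
  have hB' : a + len + 1 ≤ B.maxInt := by
    refine le_trans ?_ hB
    rw [mul_assoc]
    exact Nat.le_mul_of_pos_right _ (by omega)
  have h₁ : Runs B L scanInit σ scanInit.maxCost fun σ' => σ'.int 16 = a + 0 ∧
      Scanned f G v a 0 σ' ∧ Agree scanInts scanNums σ σ' := by
    apply Runs.of_wp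
    simp [scanInit, h16]
    refine ⟨⟨by simp [count], by simp [count], by simp [count], by simp [count]⟩, ?_⟩
    exact (((Agree.refl _ _ _).setInt (by decide) _).setInt (by decide) _).setInt (by decide) _
  have h₂ : ∀ σ', (σ'.int 16 = a + 0 ∧ Scanned f G v a 0 σ' ∧ Agree scanInts scanNums σ σ') →
      Runs B L (.loop (.intLe (ivar 16 + ilit 1) (ivar 17)) scanStep) σ'
        (∑ j ∈ Finset.range len, ((Test.intLe (ivar 16 + ilit 1) (ivar 17)).cost +
          (candTime n h (a + j) + ((Program.cond (.intEq (ivar 21) (ilit 0)) .skip countProg).maxCost +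
          (iset 16 (ivar 16 + ilit 1)).maxCost))) + (Test.intLe (ivar 16 + ilit 1) (ivar 17)).cost)
        fun σ' => Scanned f G v a len σ' ∧ Agree scanInts scanNums σ σ' := by
    intro σ' h'
    refine Runs.loop_for (I := fun j σ' => σ'.int 16 = a + j ∧ Scanned f G v a j σ' ∧
      Agree scanInts scanNums σ σ') (c := fun j => candTime n h (a + j) +
          ((Program.cond (.intEq (ivar 21) (ilit 0)) .skip countProg).maxCost +
          (iset 16 (ivar 16 + ilit 1)).maxCost)) len ?_ ?_ h'
    · rintro σ₁ ⟨e₁, e₂, e₃⟩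
      simp [e₁, e₃.int, h17]
      exact ⟨by omega, e₂, e₃⟩
    · rintro j hj σ₁ ⟨e₁, e₂, e₃⟩
      have e₄ : (a + j) * 2 * h + 2 * h ≤ B.maxInt := by
        refine le_trans ?_ hB
        have : (a + j) * 2 * h + 2 * h = (a + j + 1) * 2 * h := by ring
        rw [this]
        gcongr
      refine ⟨by simp [e₁]; omega, by simp [e₁, e₃.int, h17]; omega, ?_⟩
      refine (runs_candProg (hp.agree e₃) e₁ (by rw [e₃.int 5 (by decide), h5]) hh e₄).andThen
        (T := (Program.cond (.intEq (ivar 21) (ilit 0)) .skip countProg).maxCost +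
          (iset 16 (ivar 16 + ilit 1)).maxCost) ?_
      rintro σ₂ ⟨d₁, d₂⟩
      have d₃ := e₂.congr (d₂.int 18 (by decide)) (d₂.int 19 (by decide)) (d₂.int 20 (by decide))
        (d₂.num 8 (by decide))
      have d₄ : Agree scanInts scanNums σ σ₂ := e₃.trans (d₂.mono (by decide) (by decide))
      have d₅ : σ₂.int 16 = a + j := by rw [d₂.int 16 (by decide), e₁]
      have hfin : ∀ σ₃, Scanned f G v a (j + 1) σ₃ ∧ σ₃.int 16 = a + j ∧
          Agree scanInts scanNums σ σ₃ →
          Runs B L (iset 16 (ivar 16 + ilit 1)) σ₃ (iset 16 (ivar 16 + ilit 1)).maxCost fun σ' =>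
            σ'.int 16 = a + (j + 1) ∧ Scanned f G v a (j + 1) σ' ∧ Agree scanInts scanNums σ σ' := by
        rintro σ₃ ⟨p₁, p₂, p₃⟩
        apply Runs.of_wp
        simp [p₂]
        exact ⟨by omega, by omega, p₁.congr (by simp) (by simp) (by simp) (by simp),
          p₃.setInt (by decide) _⟩
      refine Runs.andThen (Runs.of_wp ?_) hfin
      rcases e : f (a + j) with _ | x
      · rw [show L.cand c s X h (a + j) = none from e] at d₁
        have d₁ : σ₂.int 21 = 0 := d₁
        have k : ∀ P, count f P a (j + 1) = count f P a j :=
          fun P => count_succ_of_not fun x hx => by rw [e] at hx; cases hx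
        simp [d₁, d₄, d₅]
        refine ⟨by rw [d₃.total, k], by rw [d₃.le, k], by rw [d₃.ge, k], fun h => ?_⟩
        rw [k] at h
        obtain ⟨i, hi, hi', h⟩ := d₃.last h
        exact ⟨i, hi, by omega, h⟩
      · rw [show L.cand c s X h (a + j) = some x from e] at d₁
        obtain ⟨k₁, k₂, k₃⟩ := d₁
        refine ⟨by simp, by simp [k₁], fun _ => ?_⟩
        refine Program.wp_mono (wp_countProg (a := a) (j := j) (by rw [d₄.int 22 (by decide), h22])
          had had' had'' (by rw [d₄.num 7 (by decide), h7]) (hG.agree d₄ had) (by rw [e, k₂]) k₃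
          d₃ (by omega)) ?_
        rintro σ₃ ⟨p₁, p₂⟩
        exact ⟨p₁, by rw [p₂.int 16 (by decide), d₅], d₄.trans (p₂.mono (by decide) (by decide))⟩
  refine (h₁.andThen h₂).mono ?_ fun _ h => h
  set t := (Test.intLe (ivar 16 + ilit 1) (ivar 17)).cost with ht
  set u := (Program.cond (.intEq (ivar 21) (ilit 0)) .skip countProg).maxCost with hu
  set w := (iset 16 (ivar 16 + ilit 1)).maxCost with hw
  have h₃ : candCost + 2 * (scanInit.maxCost + t) + u + w ≤ scanCost := by
    have e₁ : scanProg.maxCost = scanInit.maxCost + t := rfl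
    have e₂ : scanStep.maxCost = candProg.maxCost + (u + w) := rfl
    rw [scanCost, e₁, e₂]
    omega
  -- As there is at least one iteration, the overhead outside of the loop may be charged to every
  -- iteration.
  calc scanInit.maxCost + (∑ j ∈ Finset.range len, (t + (candTime n h (a + j) + (u + w))) + t)
      ≤ ∑ j ∈ Finset.range len, (scanInit.maxCost + t) +
          ∑ j ∈ Finset.range len, (t + (candTime n h (a + j) + (u + w))) := by
        rw [Finset.sum_const, Finset.card_range, smul_eq_mul]
        nlinarith [Nat.mul_le_mul_right (scanInit.maxCost + t) hlen]
    _ = ∑ j ∈ Finset.range len,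
          ((scanInit.maxCost + t) + (t + (candTime n h (a + j) + (u + w)))) :=
        Finset.sum_add_distrib.symm
    _ ≤ _ := by
        refine Finset.sum_le_sum fun j _ => ?_
        unfold candTime
        generalize (if (a + j) * 2 * h < n then h else 0) = z
        refine le_trans ?_ (Nat.mul_le_mul_right _ h₃)
        nlinarith [Nat.zero_le ((2 * (scanInit.maxCost + t) + u + w) * z)]

end

/-! ### Finding a splitter -/

/-- The cells used by `splitProg` may differ. -/
structure Keep (σ σ' : State) : Prop where
  int : ∀ k, k < 6 ∨ (12 ≤ k ∧ k < 16) → σ'.int k = σ.int k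
  num : ∀ k, k < 7 ∨ (16 ≤ k ∧ k < 24) → σ'.num k = σ.num k

theorem Keep.refl (σ : State) : Keep σ σ := ⟨fun _ _ => rfl, fun _ _ => rfl⟩

theorem Keep.trans {σ σ' σ'' : State} (h : Keep σ σ') (h' : Keep σ' σ'') : Keep σ σ'' :=
  ⟨fun k hk => (h'.int k hk).trans (h.int k hk), fun k hk => (h'.num k hk).trans (h.num k hk)⟩

theorem Agree.keep {σ σ' : State} {I R : Finset ℕ} (h : Agree I R σ σ')
    (hI : ∀ k ∈ I, ¬ (k < 6 ∨ (12 ≤ k ∧ k < 16)) := by decide)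
    (hR : ∀ k ∈ R, ¬ (k < 7 ∨ (16 ≤ k ∧ k < 24)) := by decide) : Keep σ σ' :=
  ⟨fun k hk => h.int k fun h' => hI k h' hk, fun k hk => h.num k fun h' => hR k h' hk⟩

theorem Keep.setInt {σ σ' : State} (h : Keep σ σ') {k : ℕ}
    (hk : ¬ (k < 6 ∨ (12 ≤ k ∧ k < 16))) (v : ℕ) : Keep σ (σ'.setInt k v) := by
  refine ⟨fun j hj => ?_, h.num⟩
  rw [State.setInt_int, if_neg (by rintro rfl; exact hk hj), h.int j hj]

theorem Keep.setNum {σ σ' : State} (h : Keep σ σ') {k : ℕ}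
    (hk : ¬ (k < 7 ∨ (16 ≤ k ∧ k < 24))) (v : Num) : Keep σ (σ'.setNum k v) := by
  refine ⟨h.int, fun j hj => ?_⟩
  rw [State.setNum_num, if_neg (by rintro rfl; exact hk hj), h.num j hj]

theorem Keep.params {σ σ' : State} {c : ℝ × ℝ} {s X : ℝ} (h : Keep σ σ') (hp : Params c s X σ) :
    Params c s X σ' :=
  hp.congr (h.num 2 (by norm_num)) (h.num 3 (by norm_num)) (h.num 4 (by norm_num))
    (h.num 5 (by norm_num))

/-- Pass to the next block with the same parent, cyclically. -/
def nextSibling : Program :=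
  iset 10 (ivar 8 * ivar 3) ;; iset 11 (ivar 7 / ivar 10 * ivar 10) ;; iset 7 (ivar 7 + ivar 8) ;;
  .cond (.intEq (ivar 7) (ivar 11 + ivar 10)) (iset 7 (ivar 11)) .skip

/-- Copy the strip at the address in cell 22 to the address below. -/
def copyStrip : Program :=
  .setNum (ivar 22 - ilit 4) (.cell (ivar 22)) ;;
  .setNum (ivar 22 - ilit 3) (.cell (ivar 22 + ilit 1)) ;;
  .setNum (ivar 22 - ilit 2) (.cell (ivar 22 + ilit 2)) ;;
  .setNum (ivar 22 - ilit 1) (.cell (ivar 22 + ilit 3))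

/-- Make the real cell 7 an end of the strip at the address `ad` or `ad - 2`. -/
def setEnd (ad ad' : IntExpr) : Program := .setNum ad (rvar 7) ;; .setNum ad' (rlit 1)

/-- A node of level `j` works in the strip at the address `28 + 4 * j`; the strip of its parent is
four cells higher, which is where `retPre` points. -/
def callPre : Program :=
  iset 16 (ivar 7) ;; iset 17 (ivar 7 + ivar 8) ;; iset 22 (ilit 28 + ilit 4 * ivar 6)

/-- A single candidate splits itself. With several candidates the search descends to the first
child, which starts at the same position. The children get a copy of the strip, because they narrow
it while the test of their splitters needs the original. -/
def callPost : Program :=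
  .cond (.intEq (ivar 18) (ilit 0)) nextSibling
    (.cond (.intEq (ivar 18) (ilit 1)) (rset 7 (rvar 8) ;; iset 9 (ilit 1))
      (copyStrip ;; iset 6 (ivar 6 - ilit 1) ;; iset 8 (ivar 8 / ivar 3)))

def retPre : Program :=
  iset 10 (ivar 8 * ivar 3) ;; iset 11 (ivar 7 / ivar 10 * ivar 10) ;; iset 16 (ivar 11) ;;
  iset 17 (ivar 11 + ivar 10) ;; iset 22 (ilit 32 + ilit 4 * ivar 6)

/-- A side of the pivot with less than a quarter of the parent's candidates is cut off from the
working strip, four cells below the address in cell 22. If neither side is that small, the pivot is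
passed on to the parent. -/
def retPost : Program :=
  .cond (.intLe (ivar 18) (ilit 4 * ivar 19))
    (.cond (.intLe (ivar 18) (ilit 4 * ivar 20))
      (iset 7 (ivar 11) ;; iset 8 (ivar 10) ;; iset 6 (ivar 6 + ilit 1))
      (setEnd (ivar 22 - ilit 2) (ivar 22 - ilit 1) ;; nextSibling ;; iset 9 (ilit 0)))
    (setEnd (ivar 22 - ilit 4) (ivar 22 - ilit 3) ;; nextSibling ;; iset 9 (ilit 0))

/-- One step of the search for a splitter: in mode 0 the candidates of the current block in the
current strip are counted, in mode 1 a splitter of the current block is tested as a splitter of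
the parent. -/
def splitBody : Program :=
  .cond (.intEq (ivar 9) (ilit 0)) (callPre ;; scanProg ;; callPost)
    (retPre ;; scanProg ;; retPost)

/-- Find a candidate in the real cell 7 that splits the candidates in a strip well. -/
def splitProg : Program := .loop (.intLe (ivar 9 + ivar 6) (ivar 2)) splitBody

/-- The fixed data of a call of `splitProg`. -/
structure SplitEnv (B : Limits) (c : ℝ × ℝ) (s X : ℝ) (h m k : ℕ) (σ₀ : State) : Prop where
  params : Params c s X σ₀
  int₂ : σ₀.int 2 = k
  int₃ : σ₀.int 3 = m
  int₅ : σ₀.int 5 = h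
  one_le : 1 ≤ h
  two_le : 2 ≤ m
  bound : (m ^ k + 1) * 4 * h ≤ B.maxInt
  cells : 31 + 4 * k < B.cells
  addr : 32 + 4 * k ≤ B.maxInt

/-- The search is at the block of size `m ^ j` that starts at `pos`. -/
structure AtNode (σ₀ : State) (m k : ℕ) (F : ℕ → Strip) (j pos mode : ℕ) (σ : State) : Prop where
  keep : Keep σ₀ σ
  int₆ : σ.int 6 = j
  int₇ : σ.int 7 = pos
  int₈ : σ.int 8 = m ^ j
  int₉ : σ.int 9 = mode
  -- `F i` is the strip in which the nodes of level `i - 1` are searched. Nothing is claimed about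
  -- the strips below the current level.
  strip : ∀ i, j < i → i ≤ k + 1 → HasStrip σ (24 + 4 * i) (F i)
  ends : ∀ i, j < i → i ≤ k + 1 → (F i).Ends

/-- The real cell 7 contains `v`. -/
def HasPivot (σ : State) (v : ℝ) : Prop := (σ.num 7).val = v ∧ (σ.num 7).ops ≤ 40

/-- At least a quarter of the candidates in the strip are on either side of `v`. -/
structure Splits (f : ℕ → Option ℝ) (G : Strip) (v : ℝ) (a len : ℕ) : Prop where
  mem : G.Mem v
  le : count f G.Mem a len ≤ 4 * count f (fun x => G.Mem x ∧ x ≤ v) a len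
  ge : count f G.Mem a len ≤ 4 * count f (fun x => G.Mem x ∧ v ≤ x) a len

/-! ### The single steps of the tree search -/

section

variable {B : Limits} {n : ℕ} [Roomy B n] {L : LP n} {c : ℝ × ℝ} {s X : ℝ} {h m k : ℕ}
  {σ₀ : State}

/-- No stack of positions is needed: rounding the position down to a multiple of `z * m` gives the
start of the parent. The return from the last child to the first makes repeated sweeps possible
without a counter. -/
theorem wp_nextSibling {σ : State} {q d z m : ℕ} (h₃ : σ.int 3 = m) (hz : 1 ≤ z) (hd : d < m)
    (h₇ : σ.int 7 = q * (z * m) + d * z) (h₈ : σ.int 8 = z)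
    (hb : (q + 1) * (z * m) ≤ B.maxInt) :
    nextSibling.wp B L σ fun σ' => σ'.int 7 = q * (z * m) + (d + 1) % m * z ∧
      Agree {7, 10, 11} ∅ σ σ' := by
  have hm : 1 ≤ m := by omega
  have hz' : 1 ≤ z * m := Nat.mul_pos hz hm
  have hdz : d * z + z ≤ z * m := by
    calc d * z + z = z * (d + 1) := by ring
      _ ≤ z * m := by gcongr; omega
  have e₁ : (q * (z * m) + d * z) / (z * m) = q := by
    rw [Nat.add_comm, Nat.add_mul_div_right _ _ hz', Nat.div_eq_of_lt (by omega), zero_add]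
  have hb' : q * (z * m) + z * m ≤ B.maxInt := by
    rw [add_mul, one_mul] at hb
    exact hb
  have hq : q ≤ q * (z * m) := Nat.le_mul_of_pos_right _ hz'
  have e₂ : d * z + z = z * m ↔ d + 1 = m := by
    constructor
    · intro h
      have : z * (d + 1) = z * m := by rw [← h]; ring
      exact Nat.eq_of_mul_eq_mul_left hz this
    · rintro rfl
      ring
  have hA : ∀ a b e : ℕ, Agree {7, 10, 11} ∅ σ (((σ.setInt 10 a).setInt 11 b).setInt 7 e) :=
    fun a b e => (((Agree.refl _ _ _).setInt (by decide) _).setInt (by decide) _).setInt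
      (by decide) _
  have hz0 : z ≠ 0 := by omega
  have hm0 : m ≠ 0 := by omega
  simp [nextSibling, h₃, h₇, h₈, e₁, hz0, hm0, add_assoc, e₂]
  and_intros
  all_goals first | omega | skip
  · rintro hd
    and_intros
    · rw [hd, Nat.mod_self]
    · exact (hA _ _ _).setInt (by decide) _
  · intro hne
    refine ⟨?_, hA _ _ _⟩
    rw [Nat.mod_eq_of_lt (by omega)]
    ring

theorem wp_copyStrip {σ : State} {ad : ℕ} {G : Strip} (h22 : σ.int 22 = ad) (hG : HasStrip σ ad G)
    (had : 28 ≤ ad) (had' : ad + 3 < B.cells) (had'' : ad + 3 ≤ B.maxInt) :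
    copyStrip.wp B L σ fun σ' => HasStrip σ' (ad - 4) G ∧ σ'.int = σ.int ∧
      ∀ i, i < ad - 4 ∨ ad ≤ i → σ'.num i = σ.num i := by
  obtain ⟨g₁, g₂, g₃, g₄, g₅, g₆, g₇, g₈⟩ := hG
  have n₁ : ad + 1 ≠ ad - 4 := by omega
  have n₂ : ad + 2 ≠ ad - 3 := by omega
  have n₃ : ad + 2 ≠ ad - 4 := by omega
  have n₄ : ad + 3 ≠ ad - 4 := by omega
  have n₅ : ad + 3 ≠ ad - 3 := by omega
  have n₆ : ad + 3 ≠ ad - 2 := by omega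
  simp [copyStrip, Program.wp_setNum, h22, g₁, g₂, g₃, g₄, n₁, n₂, n₃, n₄, n₅, n₆,
    NumExpr.safe_cell]
  and_intros
  all_goals first | omega | skip
  · have m₁ : ad - 4 + 1 = ad - 3 := by omega
    have m₂ : ad - 4 + 2 = ad - 2 := by omega
    have m₃ : ad - 4 + 3 = ad - 1 := by omega
    have k₁ : ad - 4 ≠ ad - 3 := by omega
    have k₂ : ad - 4 ≠ ad - 2 := by omega
    have k₃ : ad - 4 ≠ ad - 1 := by omega
    have k₄ : ad - 3 ≠ ad - 2 := by omega
    have k₅ : ad - 3 ≠ ad - 1 := by omega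
    have k₆ : ad - 2 ≠ ad - 1 := by omega
    constructor <;> simp [m₁, m₂, m₃, k₁, k₂, k₃, k₄, k₅, k₆, g₅, g₆, g₇, g₈]
  · intro i hi
    rw [if_neg (by omega), if_neg (by omega), if_neg (by omega), if_neg (by omega)]

theorem wp_setLo {σ : State} {ad : ℕ} {G : Strip} {v : ℝ} {e e' : IntExpr} (hG : HasStrip σ ad G)
    (hv : HasPivot σ v) (he : e.Safe B n σ) (he₁ : e.value n σ = ad)
    (he' : ∀ w, e'.Safe B n (σ.setNum ad w)) (he₂ : ∀ w, e'.value n (σ.setNum ad w) = ad + 1)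
    (had : ad + 3 < B.cells) :
    (setEnd e e').wp B L σ fun σ' => HasStrip σ' ad (G.setLo v) ∧ σ'.int = σ.int ∧
      ∀ i, i < ad ∨ ad + 4 ≤ i → σ'.num i = σ.num i := by
  obtain ⟨g₁, g₂, g₃, g₄, g₅, g₆, g₇, g₈⟩ := hG
  obtain ⟨v₁, v₂⟩ := hv
  simp [setEnd, Program.wp_setNum, he, he', he₁, he₂]
  refine ⟨by omega, by omega, ?_, fun i hi => ?_⟩
  · constructor <;> simp [Strip.setLo, *]
  · rw [if_neg (by omega), if_neg (by omega)]

theorem wp_setHi {σ : State} {ad : ℕ} {G : Strip} {v : ℝ} {e e' : IntExpr} (hG : HasStrip σ ad G)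
    (hv : HasPivot σ v) (he : e.Safe B n σ) (he₁ : e.value n σ = ad + 2)
    (he' : ∀ w, e'.Safe B n (σ.setNum (ad + 2) w))
    (he₂ : ∀ w, e'.value n (σ.setNum (ad + 2) w) = ad + 3)
    (had : ad + 3 < B.cells) :
    (setEnd e e').wp B L σ fun σ' => HasStrip σ' ad (G.setHi v) ∧ σ'.int = σ.int ∧
      ∀ i, i < ad ∨ ad + 4 ≤ i → σ'.num i = σ.num i := by
  obtain ⟨g₁, g₂, g₃, g₄, g₅, g₆, g₇, g₈⟩ := hG
  obtain ⟨v₁, v₂⟩ := hv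
  simp [setEnd, Program.wp_setNum, he, he', he₁, he₂]
  refine ⟨by omega, by omega, ?_, fun i hi => ?_⟩
  · constructor <;> simp [Strip.setHi, *]
  · rw [if_neg (by omega), if_neg (by omega)]


/-- The time constant of the search. -/
def nodeCost : ℕ := splitProg.maxCost + splitBody.maxCost + 1

/-- A bound for the time of one step of the search. -/
def stepTime (n h a len : ℕ) : ℕ := nodeCost * blockTime n h a len

theorem one_le_blockTime (n h a : ℕ) {len : ℕ} (hl : 1 ≤ len) : 1 ≤ blockTime n h a len := by
  have h₁ : 1 ≤ scanCost := by
    have : 1 ≤ scanInit.maxCost := by simp only [scanInit, Program.maxCost]; omega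
    simp only [scanCost, scanProg, Program.maxCost]
    omega
  obtain ⟨l, rfl⟩ : ∃ l, len = l + 1 := ⟨len - 1, by omega⟩
  rw [blockTime, Finset.sum_range_succ]
  have : 1 ≤ scanCost * (1 + if (a + l) * 2 * h < n then h else 0) := Nat.mul_pos h₁ (by omega)
  omega

theorem AtNode.agree {F : ℕ → Strip} {j pos mode : ℕ} {σ σ' : State} {I R : Finset ℕ}
    (ha : AtNode σ₀ m k F j pos mode σ) (h : Agree I R σ σ')
    (hI : ∀ i ∈ I, 16 ≤ i := by decide) (hR : ∀ i ∈ R, 8 ≤ i ∧ i < 16 := by decide) :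
    AtNode σ₀ m k F j pos mode σ' := by
  have hi : ∀ i < 16, σ'.int i = σ.int i := fun i hi => h.int i fun h' => by
    have := hI i h'; omega
  have hn : ∀ i, i < 8 ∨ 16 ≤ i → σ'.num i = σ.num i := fun i hi => h.num i fun h' => by
    have := hR i h'; omega
  refine ⟨ha.keep.trans ⟨fun i hi' => hi i (by omega), fun i hi' => hn i (by omega)⟩, ?_, ?_, ?_, ?_,
    fun i h₁ h₂ => (ha.strip i h₁ h₂).congr fun l hl => hn _ (by omega), ha.ends⟩
  · rw [hi 6 (by norm_num), ha.int₆]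
  · rw [hi 7 (by norm_num), ha.int₇]
  · rw [hi 8 (by norm_num), ha.int₈]
  · rw [hi 9 (by norm_num), ha.int₉]

theorem SplitEnv.int₂' (hE : SplitEnv B c s X h m k σ₀) {F : ℕ → Strip} {j pos mode : ℕ}
    {σ : State} (ha : AtNode σ₀ m k F j pos mode σ) : σ.int 2 = k := by
  rw [ha.keep.int 2 (by norm_num), hE.int₂]

theorem SplitEnv.int₃' (hE : SplitEnv B c s X h m k σ₀) {F : ℕ → Strip} {j pos mode : ℕ}
    {σ : State} (ha : AtNode σ₀ m k F j pos mode σ) : σ.int 3 = m := by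
  rw [ha.keep.int 3 (by norm_num), hE.int₃]

theorem SplitEnv.int₅' (hE : SplitEnv B c s X h m k σ₀) {F : ℕ → Strip} {j pos mode : ℕ}
    {σ : State} (ha : AtNode σ₀ m k F j pos mode σ) : σ.int 5 = h := by
  rw [ha.keep.int 5 (by norm_num), hE.int₅]

theorem SplitEnv.bound' (hE : SplitEnv B c s X h m k σ₀) {a : ℕ} (ha : a ≤ m ^ k) :
    (a + 1) * 2 * h ≤ B.maxInt ∧ 4 * a + 4 ≤ B.maxInt := by
  have h₁ := hE.bound
  have h₂ := hE.one_le
  constructor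
  · refine le_trans ?_ h₁
    gcongr
    norm_num
  · refine le_trans ?_ h₁
    nlinarith

/-- The recursion over the tree is realised by one flat loop, so no part of the program corresponds
to a recursive call. Hence the continuation style: the remainder of the run, with its own time `T`,
enters as a hypothesis. -/
theorem runs_call (hE : SplitEnv B c s X h m k σ₀) {F : ℕ → Strip} {j pos : ℕ} {σ : State}
    (ha : AtNode σ₀ m k F j pos 0 σ) (hj : j ≤ k) (hpos : pos + m ^ j ≤ m ^ k) {T : ℕ}
    {Q : State → Prop}
    (H : ∀ σ' v, AtNode σ₀ m k F j pos 0 σ' → σ'.int 22 = 28 + 4 * j →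
      Scanned (L.cand c s X h) (F (j + 1)) v pos (m ^ j) σ' →
      callPost.wp B L σ' fun σ'' => Runs B L splitProg σ'' T Q) :
    Runs B L splitProg σ (stepTime n h pos (m ^ j) + T) Q := by
  have hm : 1 ≤ m ^ j := Nat.pow_pos (by have := hE.two_le; omega)
  have hb := hE.bound' hpos
  have hcell := hE.cells
  have haddr := hE.addr
  have h₁ : Runs B L callPre σ callPre.maxCost fun σ' => AtNode σ₀ m k F j pos 0 σ' ∧
      σ'.int 16 = pos ∧ σ'.int 17 = pos + m ^ j ∧ σ'.int 22 = 28 + 4 * j := by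
    apply Runs.of_wp
    simp [callPre, ha.int₆, ha.int₇, ha.int₈]
    refine ⟨by omega, by omega, ha.agree (I := {16, 17, 22}) (R := ∅) ?_⟩
    exact (((Agree.refl _ _ _).setInt (by decide) _).setInt (by decide) _).setInt (by decide) _
  have h₂ : ∀ σ', (AtNode σ₀ m k F j pos 0 σ' ∧ σ'.int 16 = pos ∧ σ'.int 17 = pos + m ^ j ∧
      σ'.int 22 = 28 + 4 * j) → Runs B L scanProg σ' (blockTime n h pos (m ^ j)) fun σ' =>
      AtNode σ₀ m k F j pos 0 σ' ∧ σ'.int 22 = 28 + 4 * j ∧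
      -- In mode 0 the pivot is irrelevant; `v` is whatever the real cell 7 contains.
      ∃ v, Scanned (L.cand c s X h) (F (j + 1)) v pos (m ^ j) σ' := by
    rintro σ' ⟨e₁, e₂, e₃, e₄⟩
    have hG := e₁.strip (j + 1) (by omega) (by omega)
    rw [show 24 + 4 * (j + 1) = 28 + 4 * j by ring] at hG
    refine (runs_scanProg (e₁.keep.params hE.params) e₂ e₃ (hE.int₅' e₁) e₄ hE.one_le hm hb.1
      (by omega) (by omega) (by omega) rfl hG).mono le_rfl ?_
    rintro σ₁ ⟨f₁, f₂⟩
    exact ⟨e₁.agree f₂, by rw [f₂.int 22 (by decide), e₄], _, f₁⟩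
  have h₃ := h₁.andThen fun σ' h' => (h₂ σ' h').andThen fun σ₁ h'' =>
    Runs.of_wp (H σ₁ h''.2.2.choose h''.1 h''.2.1 h''.2.2.choose_spec)
  have h₄ : Runs B L splitBody σ _ _ := Runs.cond (p := callPre ;; scanProg ;; callPost)
    (q := retPre ;; scanProg ;; retPost) (by simp) (fun _ => h₃) (fun hn => by
      simp [ha.int₉] at hn)
  refine (Runs.loopStep (by simp [ha.int₉, ha.int₆]; omega) (by
    simp [ha.int₉, ha.int₆, hE.int₂' ha]; omega) h₄).mono ?_ fun _ h => h
  have hbt := one_le_blockTime n h pos hm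
  have hc : (Test.intLe (ivar 9 + ivar 6) (ivar 2)).cost + ((Test.intEq (ivar 9) (ilit 0)).cost +
      (callPre.maxCost + callPost.maxCost)) + 1 ≤ nodeCost := by
    simp only [nodeCost, splitProg, splitBody, Program.maxCost]
    omega
  rw [stepTime]
  generalize blockTime n h pos (m ^ j) = b at *
  nlinarith [Nat.mul_le_mul_right b hc]

theorem runs_ret (hE : SplitEnv B c s X h m k σ₀) {F : ℕ → Strip} {j q d : ℕ} {σ : State}
    {v : ℝ} (ha : AtNode σ₀ m k F j (q * (m ^ j * m) + d * m ^ j) 1 σ) (hv : HasPivot σ v)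
    (hj : j < k) (hd : d < m) (hq : (q + 1) * (m ^ j * m) ≤ m ^ k) {T : ℕ} {Q : State → Prop}
    (H : ∀ σ', AtNode σ₀ m k F j (q * (m ^ j * m) + d * m ^ j) 1 σ' → HasPivot σ' v →
      σ'.int 10 = m ^ j * m → σ'.int 11 = q * (m ^ j * m) → σ'.int 22 = 32 + 4 * j →
      Scanned (L.cand c s X h) (F (j + 2)) v (q * (m ^ j * m)) (m ^ j * m) σ' →
      retPost.wp B L σ' fun σ'' => Runs B L splitProg σ'' T Q) :
    Runs B L splitProg σ (stepTime n h (q * (m ^ j * m)) (m ^ j * m) + T) Q := by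
  have hz : 1 ≤ m ^ j := Nat.pow_pos (by have := hE.two_le; omega)
  have hzm : 1 ≤ m ^ j * m := Nat.mul_pos hz (by omega)
  have hq' : q * (m ^ j * m) + m ^ j * m ≤ m ^ k := by
    rw [add_mul, one_mul] at hq
    exact hq
  have hb := hE.bound' hq'
  have hcell := hE.cells
  have haddr := hE.addr
  have hdz : d * m ^ j + m ^ j ≤ m ^ j * m := by
    calc d * m ^ j + m ^ j = m ^ j * (d + 1) := by ring
      _ ≤ m ^ j * m := by gcongr; omega
  have hdiv : (q * (m ^ j * m) + d * m ^ j) / (m ^ j * m) = q := by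
    rw [Nat.add_comm, Nat.add_mul_div_right _ _ hzm, Nat.div_eq_of_lt (by omega), zero_add]
  have hqq : q ≤ q * (m ^ j * m) := Nat.le_mul_of_pos_right _ hzm
  have hz0 : m ^ j ≠ 0 := by omega
  have hm0 : m ≠ 0 := by omega
  have h₁ : Runs B L retPre σ retPre.maxCost fun σ' =>
      AtNode σ₀ m k F j (q * (m ^ j * m) + d * m ^ j) 1 σ' ∧ HasPivot σ' v ∧
      σ'.int 10 = m ^ j * m ∧ σ'.int 11 = q * (m ^ j * m) ∧
      σ'.int 16 = q * (m ^ j * m) ∧ σ'.int 17 = q * (m ^ j * m) + m ^ j * m ∧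
      σ'.int 22 = 32 + 4 * j := by
    apply Runs.of_wp
    simp only [retPre, Program.wp_seq, Program.wp_iset, Nat.reduceLT]
    simp [ha.int₆, ha.int₇, ha.int₈, hE.int₃' ha, hdiv, hm0]
    and_intros
    all_goals first | omega | skip
    · refine ⟨ha.keep.trans ?_, by simp [ha.int₆], by simp [ha.int₇], by simp [ha.int₈],
        by simp [ha.int₉], fun i h₁ h₂ => (ha.strip i h₁ h₂).congr fun _ _ => rfl, ha.ends⟩
      repeat' first | exact Keep.refl _ | refine Keep.setInt ?_ (by decide) _
    · exact hv.1
    · exact hv.2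
  have h₂ : ∀ σ', (AtNode σ₀ m k F j (q * (m ^ j * m) + d * m ^ j) 1 σ' ∧ HasPivot σ' v ∧
      σ'.int 10 = m ^ j * m ∧ σ'.int 11 = q * (m ^ j * m) ∧
      σ'.int 16 = q * (m ^ j * m) ∧ σ'.int 17 = q * (m ^ j * m) + m ^ j * m ∧
      σ'.int 22 = 32 + 4 * j) →
      Runs B L scanProg σ' (blockTime n h (q * (m ^ j * m)) (m ^ j * m)) fun σ' =>
      AtNode σ₀ m k F j (q * (m ^ j * m) + d * m ^ j) 1 σ' ∧ HasPivot σ' v ∧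
      σ'.int 10 = m ^ j * m ∧ σ'.int 11 = q * (m ^ j * m) ∧ σ'.int 22 = 32 + 4 * j ∧
      Scanned (L.cand c s X h) (F (j + 2)) v (q * (m ^ j * m)) (m ^ j * m) σ' := by
    rintro σ' ⟨e₁, e₂, e₃, e₄, e₅, e₆, e₇⟩
    have hG := e₁.strip (j + 2) (by omega) (by omega)
    rw [show 24 + 4 * (j + 2) = 32 + 4 * j by ring] at hG
    refine (runs_scanProg (e₁.keep.params hE.params) e₅ e₆ (hE.int₅' e₁) e₇ hE.one_le hzm hb.1
      (by omega) (by omega) (by omega) e₂.1 hG).mono le_rfl ?_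
    rintro σ₁ ⟨f₁, f₂⟩
    refine ⟨e₁.agree f₂, ?_, by rw [f₂.int 10 (by decide), e₃], by rw [f₂.int 11 (by decide), e₄],
      by rw [f₂.int 22 (by decide), e₇], f₁⟩
    rw [HasPivot, f₂.num 7 (by decide)]
    exact e₂
  have h₃ := h₁.andThen fun σ' h' => (h₂ σ' h').andThen fun σ₁ h'' =>
    Runs.of_wp (H σ₁ h''.1 h''.2.1 h''.2.2.1 h''.2.2.2.1 h''.2.2.2.2.1 h''.2.2.2.2.2)
  have h₄ : Runs B L splitBody σ _ _ := Runs.cond (p := callPre ;; scanProg ;; callPost)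
    (q := retPre ;; scanProg ;; retPost) (by simp) (fun hn => by
      simp [ha.int₉] at hn) (fun _ => h₃)
  refine (Runs.loopStep (by simp [ha.int₉, ha.int₆]; omega) (by
    simp [ha.int₉, ha.int₆, hE.int₂' ha]; omega) h₄).mono ?_ fun _ h => h
  have hbt := one_le_blockTime n h (q * (m ^ j * m)) hzm
  have hc : (Test.intLe (ivar 9 + ivar 6) (ivar 2)).cost + ((Test.intEq (ivar 9) (ilit 0)).cost +
      (retPre.maxCost + retPost.maxCost)) + 1 ≤ nodeCost := by
    simp only [nodeCost, splitProg, splitBody, Program.maxCost]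
    omega
  rw [stepTime]
  generalize blockTime n h (q * (m ^ j * m)) (m ^ j * m) = b at *
  nlinarith [Nat.mul_le_mul_right b hc]


theorem callPost_empty (hE : SplitEnv B c s X h m k σ₀) {F : ℕ → Strip} {j q d : ℕ} {σ : State}
    {f : ℕ → Option ℝ} {v : ℝ} (ha : AtNode σ₀ m k F j (q * (m ^ j * m) + d * m ^ j) 0 σ)
    (hd : d < m) (hq : (q + 1) * (m ^ j * m) ≤ m ^ k)
    (hs : Scanned f (F (j + 1)) v (q * (m ^ j * m) + d * m ^ j) (m ^ j) σ)
    (h0 : count f (F (j + 1)).Mem (q * (m ^ j * m) + d * m ^ j) (m ^ j) = 0) :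
    callPost.wp B L σ (AtNode σ₀ m k F j (q * (m ^ j * m) + (d + 1) % m * m ^ j) 0) := by
  have hz : 1 ≤ m ^ j := Nat.pow_pos (by have := hE.two_le; omega)
  have hN := hs.total
  rw [h0] at hN
  refine ⟨by simp, fun _ => ?_, fun hn => by simp [hN] at hn⟩
  refine Program.wp_mono (wp_nextSibling (hE.int₃' ha) hz hd ha.int₇ ha.int₈
    (by have := hE.bound' hq; omega)) ?_
  rintro σ' ⟨e₁, e₂⟩
  refine ⟨ha.keep.trans e₂.keep, by rw [e₂.int 6 (by decide), ha.int₆], e₁,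
    by rw [e₂.int 8 (by decide), ha.int₈], by rw [e₂.int 9 (by decide), ha.int₉],
    fun i h₁ h₂ => (ha.strip i h₁ h₂).agree e₂ (by omega), ha.ends⟩

/-- Both inequalities in `Splits` are weak, so the only candidate counts on both sides of itself. -/
theorem Scanned.splits_of_one {f : ℕ → Option ℝ} {G : Strip} {v : ℝ} {a len : ℕ} {σ : State}
    (hs : Scanned f G v a len σ) (h1 : count f G.Mem a len = 1) :
    Splits f G (σ.num 8).val a len := by
  obtain ⟨i, hi, hi', h₁, h₂, -⟩ := hs.last (by omega)
  have key : ∀ P : ℝ → Prop, P (σ.num 8).val → 1 ≤ count f P a len := by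
    intro P hP
    classical
    have : (1 : ℕ) ≤ if ∃ x, f (a + (i - a)) = some x ∧ P x then 1 else 0 := by
      rw [if_pos]
      rw [show a + (i - a) = i by omega]
      exact ⟨_, h₁, hP⟩
    unfold count
    refine le_trans (le_trans this (Finset.single_le_sum (f := fun i => if ∃ x, f (a + i) = some x ∧ P x then 1
      else 0) (fun _ _ => Nat.zero_le _) (Finset.mem_range.2 (show i - a < len by omega)))) (le_of_eq ?_)
    exact Finset.sum_congr rfl fun _ _ => by congr
  have k₁ := key (fun x => G.Mem x ∧ x ≤ (σ.num 8).val) ⟨h₂, le_rfl⟩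
  have k₂ := key (fun x => G.Mem x ∧ (σ.num 8).val ≤ x) ⟨h₂, le_rfl⟩
  exact ⟨h₂, by omega, by omega⟩

theorem callPost_one {F : ℕ → Strip} {j pos : ℕ} {σ : State}
    {f : ℕ → Option ℝ} {v : ℝ} (ha : AtNode σ₀ m k F j pos 0 σ)
    (hs : Scanned f (F (j + 1)) v pos (m ^ j) σ)
    (h1 : count f (F (j + 1)).Mem pos (m ^ j) = 1) :
    callPost.wp B L σ fun σ' => AtNode σ₀ m k F j pos 1 σ' ∧
      ∃ w, HasPivot σ' w ∧ Splits f (F (j + 1)) w pos (m ^ j) := by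
  have hN := hs.total
  rw [h1] at hN
  obtain ⟨i, hi, hi', h₁, h₂, h₃⟩ := hs.last (by omega)
  simp [callPost, hN]
  refine ⟨⟨ha.keep.trans ?_, by simp [ha.int₆], by simp [ha.int₇], by simp [ha.int₈],
    by simp, fun i h₁ h₂ => (ha.strip i h₁ h₂).congr fun l _ => ?_, ha.ends⟩,
    (σ.num 8).val, ⟨by simp, by simpa using h₃⟩, hs.splits_of_one h1⟩
  · repeat' first | exact Keep.refl _ | refine Keep.setInt ?_ (by decide) _ |
      refine Keep.setNum ?_ (by decide) _
  · simp
    omega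

theorem callPost_down (hE : SplitEnv B c s X h m k σ₀) {F : ℕ → Strip} {j pos : ℕ} {σ : State}
    {f : ℕ → Option ℝ} {v : ℝ} (ha : AtNode σ₀ m k F (j + 1) pos 0 σ) (hj : j + 1 ≤ k)
    (h22 : σ.int 22 = 28 + 4 * (j + 1))
    (hs : Scanned f (F (j + 2)) v pos (m ^ (j + 1)) σ)
    (h2 : 2 ≤ count f (F (j + 2)).Mem pos (m ^ (j + 1))) :
    callPost.wp B L σ
      (AtNode σ₀ m k (Function.update F (j + 1) (F (j + 2))) j pos 0) := by
  have hN := hs.total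
  have hcell := hE.cells
  have haddr := hE.addr
  have hG := ha.strip (j + 2) (by omega) (by omega)
  rw [show 24 + 4 * (j + 2) = 28 + 4 * (j + 1) by ring] at hG
  have hm := hE.two_le
  have hm0 : m ≠ 0 := by omega
  refine ⟨by simp, fun h' => ?_, fun _ => ⟨by simp, fun h' => ?_, fun _ => ?_⟩⟩
  · simp at h'
    omega
  · simp at h'
    omega
  rw [Program.wp_seq]
  refine Program.wp_mono (wp_copyStrip h22 hG (by omega) (by omega) (by omega)) ?_
  rintro σ' ⟨e₁, e₂, e₃⟩
  have hpow : m ^ (j + 1) ≤ m ^ k := Nat.pow_le_pow_right (by omega) hj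
  have hpow' : m ^ (j + 1) / m = m ^ j := by
    rw [pow_succ, Nat.mul_div_cancel _ (by omega)]
  have hle : m ^ j ≤ m ^ k := Nat.pow_le_pow_right (by omega) (by omega)
  have := (hE.bound' le_rfl).2
  simp [e₂, ha.int₆, ha.int₈, hE.int₃' ha, hm0, hpow']
  refine ⟨by omega, by omega, ?_⟩
  rw [show 28 + 4 * (j + 1) - 4 = 24 + 4 * (j + 1) by omega] at e₁ e₃
  refine ⟨ha.keep.trans ?_, by simp, by simp [e₂, ha.int₇], by simp, by simp [e₂, ha.int₉],
    fun i h₁ h₂ => ?_, fun i h₁ h₂ => ?_⟩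
  · refine Keep.setInt (Keep.setInt ?_ (by decide) _) (by decide) _
    exact ⟨fun l _ => by rw [e₂], fun l hl => e₃ l (by omega)⟩
  · rcases Nat.lt_or_eq_of_le (Nat.succ_le_of_lt h₁) with h₃ | h₃
    · rw [Function.update_of_ne (by omega)]
      exact (ha.strip i (by omega) h₂).congr fun l hl => e₃ _ (by omega)
    · obtain rfl : i = j + 1 := h₃.symm
      rw [Function.update_self]
      exact e₁.congr fun l hl => rfl
  · rcases Nat.lt_or_eq_of_le (Nat.succ_le_of_lt h₁) with h₃ | h₃
    · rw [Function.update_of_ne (by omega)]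
      exact ha.ends i (by omega) h₂
    · obtain rfl : i = j + 1 := h₃.symm
      rw [Function.update_self]
      exact ha.ends (j + 2) (by omega) (by omega)

theorem retPost_up (hE : SplitEnv B c s X h m k σ₀) {F : ℕ → Strip} {j pos ps : ℕ} {σ : State}
    {f : ℕ → Option ℝ} {v : ℝ} (ha : AtNode σ₀ m k F j pos 1 σ) (hj : j < k)
    (hv : HasPivot σ v) (h10 : σ.int 10 = m ^ j * m) (h11 : σ.int 11 = ps)
    (hps : ps + m ^ j * m ≤ m ^ k)
    (hs : Scanned f (F (j + 2)) v ps (m ^ j * m) σ) (hw : Splits f (F (j + 2)) v ps (m ^ j * m)) :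
    retPost.wp B L σ fun σ' => AtNode σ₀ m k F (j + 1) ps 1 σ' ∧ HasPivot σ' v := by
  have hN := hs.total
  have hA := hs.le
  have hB := hs.ge
  have h₁ := hw.le
  have h₂ := hw.ge
  have c₁ := count_le f (fun x => (F (j + 2)).Mem x ∧ x ≤ v) ps (m ^ j * m)
  have c₂ := count_le f (fun x => (F (j + 2)).Mem x ∧ v ≤ x) ps (m ^ j * m)
  have hb := (hE.bound' hps).2
  have hcell := hE.cells
  have haddr := hE.addr
  simp [retPost, hN, hA, hB, h₁, h₂, h10, h11, ha.int₆]
  and_intros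
  all_goals first | omega | skip
  · refine ⟨ha.keep.trans ?_, by simp, by simp, by simp [pow_succ], by simp [ha.int₉],
      fun i h₁ h₂ => (ha.strip i (by omega) h₂).congr fun l _ => rfl, fun i h₁ h₂ =>
        ha.ends i (by omega) h₂⟩
    repeat' first | exact Keep.refl _ | refine Keep.setInt ?_ (by decide) _
  · exact hv.1
  · exact hv.2

/-- The strip at level `j + 1` has been replaced by `G`, and the search goes on with the next
sibling. -/
theorem wp_retry (hE : SplitEnv B c s X h m k σ₀) {F : ℕ → Strip} {j q d : ℕ} {σ σ' : State}
    {G : Strip} (ha : AtNode σ₀ m k F j (q * (m ^ j * m) + d * m ^ j) 1 σ)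
    (hd : d < m) (hq : (q + 1) * (m ^ j * m) ≤ m ^ k)
    (hG : HasStrip σ' (24 + 4 * (j + 1)) G) (hG' : G.Ends) (hint : σ'.int = σ.int)
    (hnum : ∀ i, i < 24 + 4 * (j + 1) ∨ 24 + 4 * (j + 1) + 4 ≤ i → σ'.num i = σ.num i) :
    (nextSibling ;; iset 9 (ilit 0)).wp B L σ' (AtNode σ₀ m k (Function.update F (j + 1) G) j
      (q * (m ^ j * m) + (d + 1) % m * m ^ j) 0) := by
  have hz : 1 ≤ m ^ j := Nat.pow_pos (by have := hE.two_le; omega)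
  rw [Program.wp_seq]
  refine Program.wp_mono (wp_nextSibling (by rw [hint, hE.int₃' ha]) hz hd
    (by rw [hint, ha.int₇]) (by rw [hint, ha.int₈]) (by have := hE.bound' hq; omega)) ?_
  rintro σ₁ ⟨e₁, e₂⟩
  simp
  have hk : Keep σ σ₁ := Keep.trans ⟨fun l _ => by rw [hint], fun l hl => hnum l (by omega)⟩ e₂.keep
  have e₃ : ∀ i, σ₁.num i = σ'.num i := fun i => e₂.num i (by simp)
  refine ⟨(ha.keep.trans hk).setInt (by decide) _, ?_, by simpa using e₁, ?_, by simp,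
    fun i h₁ h₂ => ?_, fun i h₁ h₂ => ?_⟩
  · simp [e₂.int, hint, ha.int₆]
  · simp [e₂.int, hint, ha.int₈]
  · rcases Nat.lt_or_eq_of_le (Nat.succ_le_of_lt h₁) with h₃ | h₃
    · rw [Function.update_of_ne (by omega)]
      exact (ha.strip i (by omega) h₂).congr fun l hl =>
        (e₃ _).trans (hnum _ (by omega))
    · obtain rfl : i = j + 1 := h₃.symm
      rw [Function.update_self]
      exact hG.congr fun l hl => e₃ _
  · rcases Nat.lt_or_eq_of_le (Nat.succ_le_of_lt h₁) with h₃ | h₃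
    · rw [Function.update_of_ne (by omega)]
      exact ha.ends i (by omega) h₂
    · obtain rfl : i = j + 1 := h₃.symm
      rw [Function.update_self]
      exact hG'

theorem retPost_lo (hE : SplitEnv B c s X h m k σ₀) {F : ℕ → Strip} {j q d : ℕ} {σ : State}
    {f : ℕ → Option ℝ} {v : ℝ} (ha : AtNode σ₀ m k F j (q * (m ^ j * m) + d * m ^ j) 1 σ)
    (hj : j < k) (hd : d < m) (hq : (q + 1) * (m ^ j * m) ≤ m ^ k)
    (hv : HasPivot σ v) (h22 : σ.int 22 = 32 + 4 * j)
    (hs : Scanned f (F (j + 2)) v (q * (m ^ j * m)) (m ^ j * m) σ)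
    (hw : 4 * count f (fun x => (F (j + 2)).Mem x ∧ x ≤ v) (q * (m ^ j * m)) (m ^ j * m) <
      count f (F (j + 2)).Mem (q * (m ^ j * m)) (m ^ j * m)) :
    retPost.wp B L σ (AtNode σ₀ m k (Function.update F (j + 1) ((F (j + 1)).setLo v)) j
      (q * (m ^ j * m) + (d + 1) % m * m ^ j) 0) := by
  have hN := hs.total
  have hA := hs.le
  have c₁ := count_le f (fun x => (F (j + 2)).Mem x ∧ x ≤ v) (q * (m ^ j * m)) (m ^ j * m)
  rw [add_mul, one_mul] at hq
  have hb := (hE.bound' hq).2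
  have hcell := hE.cells
  have haddr := hE.addr
  refine ⟨by simp [hA]; omega, fun h' => by simp [hN, hA] at h'; omega, fun _ => ?_⟩
  rw [Program.wp_seq]
  refine Program.wp_mono (wp_setLo (ha.strip (j + 1) (by omega) (by omega)) hv ?_ ?_ ?_ ?_
    (by omega)) ?_
  · simp [h22]; omega
  · simp [h22]; omega
  · simp [h22]; omega
  · simp [h22]; omega
  · rintro σ' ⟨e₁, e₂, e₃⟩
    exact wp_retry hE ha hd (by rwa [add_mul, one_mul]) e₁
      ((ha.ends _ (by omega) (by omega)).setLo v) e₂ e₃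

theorem retPost_hi (hE : SplitEnv B c s X h m k σ₀) {F : ℕ → Strip} {j q d : ℕ} {σ : State}
    {f : ℕ → Option ℝ} {v : ℝ} (ha : AtNode σ₀ m k F j (q * (m ^ j * m) + d * m ^ j) 1 σ)
    (hj : j < k) (hd : d < m) (hq : (q + 1) * (m ^ j * m) ≤ m ^ k)
    (hv : HasPivot σ v) (h22 : σ.int 22 = 32 + 4 * j)
    (hs : Scanned f (F (j + 2)) v (q * (m ^ j * m)) (m ^ j * m) σ)
    (hw' : count f (F (j + 2)).Mem (q * (m ^ j * m)) (m ^ j * m) ≤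
      4 * count f (fun x => (F (j + 2)).Mem x ∧ x ≤ v) (q * (m ^ j * m)) (m ^ j * m))
    (hw : 4 * count f (fun x => (F (j + 2)).Mem x ∧ v ≤ x) (q * (m ^ j * m)) (m ^ j * m) <
      count f (F (j + 2)).Mem (q * (m ^ j * m)) (m ^ j * m)) :
    retPost.wp B L σ (AtNode σ₀ m k (Function.update F (j + 1) ((F (j + 1)).setHi v)) j
      (q * (m ^ j * m) + (d + 1) % m * m ^ j) 0) := by
  have hN := hs.total
  have hA := hs.le
  have hB := hs.ge
  have c₁ := count_le f (fun x => (F (j + 2)).Mem x ∧ x ≤ v) (q * (m ^ j * m)) (m ^ j * m)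
  have c₂ := count_le f (fun x => (F (j + 2)).Mem x ∧ v ≤ x) (q * (m ^ j * m)) (m ^ j * m)
  rw [add_mul, one_mul] at hq
  have hb := (hE.bound' hq).2
  have hcell := hE.cells
  have haddr := hE.addr
  refine ⟨by simp [hA]; omega, fun _ => ?_, fun h' => by simp [hN, hA] at h'; omega⟩
  refine ⟨by simp [hB]; omega, fun h' => by simp [hN, hB] at h'; omega, fun _ => ?_⟩
  rw [Program.wp_seq]
  refine Program.wp_mono (wp_setHi (ha.strip (j + 1) (by omega) (by omega)) hv ?_ ?_ ?_ ?_
    (by omega)) ?_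
  · simp [h22]; omega
  · simp [h22]; omega
  · simp [h22]; omega
  · simp [h22]; omega
  · rintro σ' ⟨e₁, e₂, e₃⟩
    exact wp_retry hE ha hd (by rwa [add_mul, one_mul]) e₁
      ((ha.ends _ (by omega) (by omega)).setHi v) e₂ e₃

end

/-! ### Counting candidates in strips that are narrowed -/

section Count

variable {f : ℕ → Option ℝ} {P R S : ℝ → Prop}

theorem sum_range_mul_eq (g : ℕ → ℕ) (a z m : ℕ) :
    ∑ i ∈ Finset.range (z * m), g (a + i) =
      ∑ d ∈ Finset.range m, ∑ i ∈ Finset.range z, g (a + d * z + i) := by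
  induction m with
  | zero => simp
  | succ m ih =>
    rw [Finset.sum_range_succ, ← ih, Nat.mul_succ, Finset.sum_range_add]
    congr 1
    refine Finset.sum_congr rfl fun i _ => ?_
    rw [mul_comm m z, add_assoc]

theorem count_mul (f : ℕ → Option ℝ) (P : ℝ → Prop) (a z m : ℕ) :
    count f P a (z * m) = ∑ d ∈ Finset.range m, count f P (a + d * z) z := by
  classical
  exact sum_range_mul_eq (fun i => if ∃ x, f i = some x ∧ P x then 1 else 0) a z m

/-- The children partition the block of their parent, so scanning each of them once costs as much as
scanning the parent once. This is why the depth of the tree enters only through the number of sweeps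
and of tests. -/
theorem blockTime_mul (n h a z m : ℕ) :
    blockTime n h a (z * m) = ∑ d ∈ Finset.range m, blockTime n h (a + d * z) z :=
  sum_range_mul_eq (fun i => scanCost * (1 + if i * 2 * h < n then h else 0)) a z m

theorem count_mono (h : ∀ x, P x → R x) (a len : ℕ) : count f P a len ≤ count f R a len := by
  refine Finset.sum_le_sum fun i _ => ?_
  split_ifs with h₁ h₂
  · exact le_rfl
  · exact (h₂ (h₁.imp fun x hx => ⟨hx.1, h x hx.2⟩)).elim
  · exact Nat.zero_le _
  · exact le_rfl

theorem count_le_add (h : ∀ x, P x → R x ∨ S x) (a len : ℕ) :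
    count f P a len ≤ count f R a len + count f S a len := by
  rw [count, count, count, ← Finset.sum_add_distrib]
  refine Finset.sum_le_sum fun i _ => ?_
  by_cases h₁ : ∃ x, f (a + i) = some x ∧ P x
  · obtain ⟨x, hx, hP⟩ := h₁
    rw [if_pos ⟨x, hx, hP⟩]
    rcases h x hP with h₂ | h₂
    · rw [if_pos (show ∃ x, f (a + i) = some x ∧ R x from ⟨x, hx, h₂⟩)]
      omega
    · rw [if_pos (show ∃ x, f (a + i) = some x ∧ S x from ⟨x, hx, h₂⟩)]
      omega
  · rw [if_neg h₁]
    omega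

theorem count_add_le (hR : ∀ x, R x → P x) (hS : ∀ x, S x → P x) (hRS : ∀ x, R x → ¬ S x)
    (a len : ℕ) : count f R a len + count f S a len ≤ count f P a len := by
  rw [count, count, count, ← Finset.sum_add_distrib]
  refine Finset.sum_le_sum fun i _ => ?_
  by_cases h₁ : ∃ x, f (a + i) = some x ∧ R x
  · obtain ⟨x, hx, hx'⟩ := h₁
    rw [if_pos (show ∃ x, f (a + i) = some x ∧ R x from ⟨x, hx, hx'⟩), if_neg,
      if_pos (show ∃ x, f (a + i) = some x ∧ P x from ⟨x, hx, hR x hx'⟩)]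
    rintro ⟨y, hy, hy'⟩
    rw [hx] at hy
    cases hy
    exact hRS x hx' hy'
  · rw [if_neg h₁, zero_add]
    by_cases h₂ : ∃ x, f (a + i) = some x ∧ S x
    · obtain ⟨x, hx, hx'⟩ := h₂
      rw [if_pos (show ∃ x, f (a + i) = some x ∧ S x from ⟨x, hx, hx'⟩),
        if_pos (show ∃ x, f (a + i) = some x ∧ P x from ⟨x, hx, hS x hx'⟩)]
    · rw [if_neg h₂]
      exact Nat.zero_le _

/-- Less than a quarter of the candidates in `G₀` lies on either side of `G`. -/
structure Narrow (f : ℕ → Option ℝ) (G₀ G : Strip) (a len : ℕ) : Prop where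
  sub : ∀ x, G.Mem x → G₀.Mem x
  lo : 4 * count f (fun x => G₀.Mem x ∧ x * G.lw ≤ G.lx) a len < count f G₀.Mem a len
  hi : 4 * count f (fun x => G₀.Mem x ∧ G.hx ≤ x * G.hw) a len < count f G₀.Mem a len

variable {G₀ G : Strip} {v : ℝ} {a len : ℕ}

/-- Less than a quarter is missing on either side, so more than half is left. -/
theorem Narrow.lt (h : Narrow f G₀ G a len) :
    count f G₀.Mem a len < 2 * count f G.Mem a len := by
  have h₁ := count_le_add (f := f) (P := G₀.Mem) (R := G.Mem)
    (S := fun x => (G₀.Mem x ∧ x * G.lw ≤ G.lx) ∨ (G₀.Mem x ∧ G.hx ≤ x * G.hw)) (fun x hx => by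
      by_cases h₁ : x * G.lw ≤ G.lx
      · exact Or.inr (Or.inl ⟨hx, h₁⟩)
      by_cases h₂ : G.hx ≤ x * G.hw
      · exact Or.inr (Or.inr ⟨hx, h₂⟩)
      · exact Or.inl ⟨not_le.1 h₁, not_le.1 h₂⟩) a len
  have h₂ := count_le_add (f := f)
    (P := fun x => (G₀.Mem x ∧ x * G.lw ≤ G.lx) ∨ (G₀.Mem x ∧ G.hx ≤ x * G.hw))
    (R := fun x => G₀.Mem x ∧ x * G.lw ≤ G.lx) (S := fun x => G₀.Mem x ∧ G.hx ≤ x * G.hw)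
    (fun x hx => hx) a len
  have h₃ := h.lo
  have h₄ := h.hi
  omega

theorem count_eq_zero_of (h : ∀ x, ¬ P x) (a len : ℕ) : count f P a len = 0 := by
  refine Finset.sum_eq_zero fun i _ => if_neg ?_
  rintro ⟨x, -, hx⟩
  exact h x hx

theorem Narrow.refl (h : 1 ≤ count f G.Mem a len) : Narrow f G G a len := by
  refine ⟨fun _ h => h, ?_, ?_⟩
  · rw [count_eq_zero_of (fun x hx => hx.2.not_gt hx.1.1)]
    exact h
  · rw [count_eq_zero_of (fun x hx => hx.2.not_gt hx.1.2)]
    exact h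

/-- The failed test counts everything in the original strip up to `v`, including what was cut off
earlier. So the bound of a quarter does not deteriorate under repeated cuts. -/
theorem Narrow.setLo (h : Narrow f G₀ G a len) (hG : G.Ends) (hv : G.Mem v)
    (hA : 4 * count f (fun x => G₀.Mem x ∧ x ≤ v) a len < count f G₀.Mem a len) :
    Narrow f G₀ (G.setLo v) a len := by
  refine ⟨fun x hx => h.sub x ((Strip.mem_setLo hG hv).1 hx).1, ?_, h.hi⟩
  simpa [Strip.setLo] using hA

theorem Narrow.setHi (h : Narrow f G₀ G a len) (hG : G.Ends) (hv : G.Mem v)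
    (hA : 4 * count f (fun x => G₀.Mem x ∧ v ≤ x) a len < count f G₀.Mem a len) :
    Narrow f G₀ (G.setHi v) a len := by
  refine ⟨fun x hx => h.sub x ((Strip.mem_setHi hG hv).1 hx).1, h.lo, ?_⟩
  simpa [Strip.setHi] using hA

/-- The points up to `v`, at least a quarter of all, are disjoint from the new strip. -/
theorem Splits.setLo (h : Splits f G v a len) (hG : G.Ends) :
    4 * count f (G.setLo v).Mem a len ≤ 3 * count f G.Mem a len := by
  have h₁ := count_add_le (f := f) (P := G.Mem) (R := (G.setLo v).Mem)
    (S := fun x => G.Mem x ∧ x ≤ v) (fun x hx => ((Strip.mem_setLo hG h.mem).1 hx).1)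
    (fun x hx => hx.1) (fun x hx hx' => ((Strip.mem_setLo hG h.mem).1 hx).2.not_ge hx'.2) a len
  have h₂ := h.le
  omega

theorem Splits.setHi (h : Splits f G v a len) (hG : G.Ends) :
    4 * count f (G.setHi v).Mem a len ≤ 3 * count f G.Mem a len := by
  have h₁ := count_add_le (f := f) (P := G.Mem) (R := (G.setHi v).Mem)
    (S := fun x => G.Mem x ∧ v ≤ x) (fun x hx => ((Strip.mem_setHi hG h.mem).1 hx).1)
    (fun x hx => hx.1) (fun x hx hx' => ((Strip.mem_setHi hG h.mem).1 hx).2.not_ge hx'.2) a len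
  have h₂ := h.ge
  omega

end Count

/-! ### Correctness and cost of the tree search -/

section

variable {B : Limits} {n : ℕ} [Roomy B n] {L : LP n} {c : ℝ × ℝ} {s X : ℝ} {h m k : ℕ}
  {σ₀ : State}

theorem AtNode.congr {F F' : ℕ → Strip} {j pos mode : ℕ} {σ : State}
    (ha : AtNode σ₀ m k F j pos mode σ) (hF : ∀ i, j < i → F i = F' i) :
    AtNode σ₀ m k F' j pos mode σ :=
  ⟨ha.keep, ha.int₆, ha.int₇, ha.int₈, ha.int₉, fun i h₁ h₂ => hF i h₁ ▸ ha.strip i h₁ h₂,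
    fun i h₁ h₂ => hF i h₁ ▸ ha.ends i h₁ h₂⟩

/-- The search at level `j` succeeds, within the time bound given by the factor `t`. -/
def Searches (B : Limits) {n : ℕ} (L : LP n) (c : ℝ × ℝ) (s X : ℝ) (h m k : ℕ) (σ₀ : State)
    (j t : ℕ) : Prop :=
  ∀ (F : ℕ → Strip) (q : ℕ) (σ : State), (q + 1) * m ^ j ≤ m ^ k →
    AtNode σ₀ m k F j (q * m ^ j) 0 σ →
    1 ≤ count (L.cand c s X h) (F (j + 1)).Mem (q * m ^ j) (m ^ j) →
    ∀ (T : ℕ) (Q : State → Prop),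
      (∀ σ' v, AtNode σ₀ m k F j (q * m ^ j) 1 σ' → HasPivot σ' v →
        Splits (L.cand c s X h) (F (j + 1)) v (q * m ^ j) (m ^ j) →
        Runs B L splitProg σ' T Q) →
      Runs B L splitProg σ (t * stepTime n h (q * m ^ j) (m ^ j) + T) Q

/-- One pass over the children of a node, from child `d` on. -/
theorem runs_sweep (hE : SplitEnv B c s X h m k σ₀) {j t : ℕ} (hj : j < k) (ht : 1 ≤ t)
    (hS : Searches B L c s X h m k σ₀ j t) {F₀ : ℕ → Strip} {q : ℕ}
    (hq : (q + 1) * (m ^ j * m) ≤ m ^ k) {T : ℕ} {Q : State → Prop}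
    (hret : ∀ σ' v, AtNode σ₀ m k F₀ (j + 1) (q * (m ^ j * m)) 1 σ' → HasPivot σ' v →
        Splits (L.cand c s X h) (F₀ (j + 2)) v (q * (m ^ j * m)) (m ^ j * m) →
        Runs B L splitProg σ' T Q) (e : ℕ) :
    ∀ d, d + e = m → ∀ (F : ℕ → Strip) (σ : State), (∀ i, j + 1 < i → F i = F₀ i) →
      Narrow (L.cand c s X h) (F₀ (j + 2)) (F (j + 1)) (q * (m ^ j * m)) (m ^ j * m) →
      -- For `d = m` this is child `0` again, so the state at the end of a sweep is a state at the
      -- start of the next one.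
      AtNode σ₀ m k F j (q * (m ^ j * m) + d % m * m ^ j) 0 σ →
      (∀ (F' : ℕ → Strip) (σ' : State), (∀ i, j + 1 < i → F' i = F₀ i) →
        Narrow (L.cand c s X h) (F₀ (j + 2)) (F' (j + 1)) (q * (m ^ j * m)) (m ^ j * m) →
        (∀ x, (F' (j + 1)).Mem x → (F (j + 1)).Mem x) →
        -- A fruitless sweep may only be left with the loss of a quarter of the candidates in every
        -- child visited. Strips only shrink, so a loss seen at one child persists during the visits
        -- to the later ones.
        (∀ b, d ≤ b → b < m →
          4 * count (L.cand c s X h) (F' (j + 1)).Mem (q * (m ^ j * m) + b * m ^ j) (m ^ j) ≤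
          3 * count (L.cand c s X h) (F (j + 1)).Mem (q * (m ^ j * m) + b * m ^ j) (m ^ j)) →
        AtNode σ₀ m k F' j (q * (m ^ j * m) + 0 % m * m ^ j) 0 σ' →
        Runs B L splitProg σ' T Q) →
      Runs B L splitProg σ (∑ b ∈ Finset.Ico d m,
        (t * stepTime n h (q * (m ^ j * m) + b * m ^ j) (m ^ j) +
          stepTime n h (q * (m ^ j * m)) (m ^ j * m)) + T) Q := by
  have hm2 := hE.two_le
  have hz : 1 ≤ m ^ j := Nat.pow_pos (by omega)
  induction e with
  | zero =>
    rintro d hd F σ hF hN ha hcont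
    obtain rfl : d = m := by omega
    rw [Finset.Ico_self, Finset.sum_empty, zero_add]
    refine hcont F σ hF hN (fun _ h => h) (fun b hb hb' => by omega) ?_
    simpa using ha
  | succ e ih =>
    rintro d hd F σ hF hN ha hcont
    have hdm : d < m := by omega
    rw [Nat.mod_eq_of_lt hdm] at ha
    rw [Finset.sum_eq_sum_Ico_succ_bot hdm]
    set P0 := q * (m ^ j * m) with hP0
    set f := L.cand c s X h
    set W := ∑ b ∈ Finset.Ico (d + 1) m,
        (t * stepTime n h (P0 + b * m ^ j) (m ^ j) + stepTime n h P0 (m ^ j * m)) with hW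
    have hposeq : P0 + d * m ^ j = (q * m + d) * m ^ j := by rw [hP0]; ring
    have hposle : (q * m + d + 1) * m ^ j ≤ m ^ k := by
      refine le_trans ?_ hq
      calc (q * m + d + 1) * m ^ j ≤ (q * m + m) * m ^ j :=
          Nat.mul_le_mul_right _ (by omega)
        _ = (q + 1) * (m ^ j * m) := by ring
    have hle : ∀ (F' : ℕ → Strip) (b : ℕ), (∀ x, (F' (j + 1)).Mem x → (F (j + 1)).Mem x) →
        count f (F' (j + 1)).Mem (P0 + b * m ^ j) (m ^ j) ≤
          count f (F (j + 1)).Mem (P0 + b * m ^ j) (m ^ j) := fun F' b h => count_mono h _ _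
    -- A child without candidates has no splitter, but it fulfils the bound on its count trivially.
    by_cases h0 : count f (F (j + 1)).Mem (P0 + d * m ^ j) (m ^ j) = 0
    · refine (runs_call hE ha hj.le (by rw [hposeq]; rwa [add_mul, one_mul] at hposle)
        (T := W + T) fun σ' v h₁ h₂ h₃ => ?_).mono ?_ fun _ h => h
      · refine Program.wp_mono (callPost_empty hE h₁ hdm hq h₃ h0) fun σ₁ h₄ => ?_
        refine ih (d + 1) (by omega) F σ₁ hF hN h₄ fun F' σ₂ k₁ k₂ k₃ k₄ k₅ => ?_
        refine hcont F' σ₂ k₁ k₂ k₃ (fun b hb hb' => ?_) k₅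
        rcases Nat.lt_or_eq_of_le hb with hb | rfl
        · exact k₄ b hb hb'
        · have := hle F' d k₃
          omega
      · have : stepTime n h (P0 + d * m ^ j) (m ^ j) ≤ t * stepTime n h (P0 + d * m ^ j) (m ^ j) :=
          Nat.le_mul_of_pos_left _ ht
        omega
    · have key : Runs B L splitProg σ (t * stepTime n h (P0 + d * m ^ j) (m ^ j) +
          (stepTime n h P0 (m ^ j * m) + (W + T))) Q := by
        rw [hposeq] at h0 ha ⊢
        refine hS F _ σ hposle ha (Nat.one_le_iff_ne_zero.2 h0) _ _ fun σ₁ v k₁ k₂ k₃ => ?_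
        rw [← hposeq] at k₁ k₃
        refine runs_ret hE k₁ k₂ hj hdm hq fun σ₂ g₁ g₂ g₃ g₄ g₅ g₆ => ?_
        rw [hF (j + 2) (by omega)] at g₆
        have hEnds := g₁.ends (j + 1) (by omega) (by omega)
        -- The common continuation after a failed test on either side, with the narrowed strip `G`.
        have hcont' : ∀ G σ₃, Narrow f (F₀ (j + 2)) G P0 (m ^ j * m) →
            (∀ x, G.Mem x → (F (j + 1)).Mem x) →
            4 * count f G.Mem (P0 + d * m ^ j) (m ^ j) ≤
              3 * count f (F (j + 1)).Mem (P0 + d * m ^ j) (m ^ j) →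
            AtNode σ₀ m k (Function.update F (j + 1) G) j (P0 + (d + 1) % m * m ^ j) 0 σ₃ →
            Runs B L splitProg σ₃ (W + T) Q := by
          intro G σ₃ hG₁ hG₂ hG₃ hG₄
          refine ih (d + 1) (by omega) _ σ₃
            (fun i hi => by rw [Function.update_of_ne (by omega), hF i hi])
            (by rwa [Function.update_self]) hG₄ fun F' σ₄ l₁ l₂ l₃ l₄ l₅ => ?_
          rw [Function.update_self] at l₃ l₄
          refine hcont F' σ₄ l₁ l₂ (fun x hx => hG₂ x (l₃ x hx)) (fun b hb hb' => ?_) l₅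
          rcases Nat.lt_or_eq_of_le hb with hb | rfl
          · refine (l₄ b hb hb').trans ?_
            exact Nat.mul_le_mul_left _ (count_mono hG₂ _ _)
          · refine le_trans ?_ hG₃
            exact Nat.mul_le_mul_left _ (count_mono l₃ _ _)
        by_cases hA : 4 * count f (fun x => (F₀ (j + 2)).Mem x ∧ x ≤ v) P0 (m ^ j * m) <
            count f (F₀ (j + 2)).Mem P0 (m ^ j * m)
        · refine Program.wp_mono (retPost_lo hE g₁ hj hdm hq g₂ g₅ (by rwa [hF _ (by omega)])
            (by rwa [hF _ (by omega)])) fun σ₃ p₁ => ?_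
          exact hcont' _ σ₃ (hN.setLo hEnds k₃.mem hA)
            (fun x hx => ((Strip.mem_setLo hEnds k₃.mem).1 hx).1) (k₃.setLo hEnds) p₁
        by_cases hB : 4 * count f (fun x => (F₀ (j + 2)).Mem x ∧ v ≤ x) P0 (m ^ j * m) <
            count f (F₀ (j + 2)).Mem P0 (m ^ j * m)
        · refine Program.wp_mono (retPost_hi hE g₁ hj hdm hq g₂ g₅ (by rwa [hF _ (by omega)])
            (by rw [hF _ (by omega)]; exact not_lt.1 hA) (by rwa [hF _ (by omega)]))
            fun σ₃ p₁ => ?_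
          exact hcont' _ σ₃ (hN.setHi hEnds k₃.mem hB)
            (fun x hx => ((Strip.mem_setHi hEnds k₃.mem).1 hx).1) (k₃.setHi hEnds) p₁
        · have hsp : Splits f (F₀ (j + 2)) v P0 (m ^ j * m) :=
            ⟨hN.sub v k₃.mem, not_lt.1 hA, not_lt.1 hB⟩
          refine Program.wp_mono (retPost_up hE g₁ hj g₂ g₃ g₄
            (by rwa [add_mul, one_mul] at hq) (by rwa [hF _ (by omega)])
            (by rwa [hF _ (by omega)])) fun σ₃ p₁ => ?_
          exact (hret σ₃ v (p₁.1.congr fun i hi => hF i hi) p₁.2 hsp).mono (by omega) fun _ h => h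
      refine key.mono (by omega) fun _ h => h

/-- The time factor of the search at level `j`. -/
def splitFactor (m : ℕ) : ℕ → ℕ
  | 0 => 1
  -- Measured in scans of the node: each of the three sweeps costs `splitFactor m j` for the
  -- searches in all children together and `m` for the tests on the node; one more scan is the first
  -- count.
  | j + 1 => 3 * splitFactor m j + 3 * m + 1

theorem one_le_splitFactor (m j : ℕ) : 1 ≤ splitFactor m j := by
  cases j <;> simp [splitFactor]

theorem count_le_of_sweep {f : ℕ → Option ℝ} {P R : ℝ → Prop} {a z m : ℕ}
    (h : ∀ b, 0 ≤ b → b < m → 4 * count f P (a + b * z) z ≤ 3 * count f R (a + b * z) z) :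
    4 * count f P a (z * m) ≤ 3 * count f R a (z * m) := by
  rw [count_mul, count_mul, Finset.mul_sum, Finset.mul_sum]
  exact Finset.sum_le_sum fun b hb => h b (Nat.zero_le _) (Finset.mem_range.1 hb)

/-- Every sweep without success leaves at most three quarters of the candidates of each child, and
hence of the node. Three such sweeps would contradict `Narrow.lt`. -/
theorem searches (hE : SplitEnv B c s X h m k σ₀) (j : ℕ) (hj : j ≤ k) :
    Searches B L c s X h m k σ₀ j (splitFactor m j) := by
  have hm2 := hE.two_le
  induction j with
  | zero =>
    intro F q σ hq ha hN T Q H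
    rw [splitFactor, one_mul]
    have h1 := count_le (L.cand c s X h) (F (0 + 1)).Mem (q * m ^ 0) (m ^ 0)
    refine runs_call hE ha hj (by rwa [add_mul, one_mul] at hq) fun σ' v h₁ h₂ h₃ => ?_
    refine Program.wp_mono (callPost_one h₁ h₃ (by rw [pow_zero] at *; omega)) ?_
    rintro σ₁ ⟨h₄, w, h₅, h₆⟩
    exact H σ₁ w h₄ h₅ h₆
  | succ j ih =>
    intro F q σ hq ha hN T Q H
    set f := L.cand c s X h
    set W := stepTime n h (q * m ^ (j + 1)) (m ^ (j + 1)) with hW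
    set t := splitFactor m j
    have ht : splitFactor m (j + 1) = 3 * t + 3 * m + 1 := rfl
    by_cases h1 : count f (F (j + 2)).Mem (q * m ^ (j + 1)) (m ^ (j + 1)) = 1
    · refine (runs_call hE ha hj (by rwa [add_mul, one_mul] at hq) (T := T)
        fun σ' v h₁ h₂ h₃ => ?_).mono ?_ fun _ h => h
      · refine Program.wp_mono (callPost_one h₁ h₃ h1) ?_
        rintro σ₁ ⟨h₄, w, h₅, h₆⟩
        exact H σ₁ w h₄ h₅ h₆
      · have : W ≤ splitFactor m (j + 1) * W := Nat.le_mul_of_pos_left _ (by omega)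
        omega
    · have hadd : ∑ b ∈ Finset.Ico 0 m, (t * stepTime n h (q * (m ^ j * m) + b * m ^ j) (m ^ j) +
          stepTime n h (q * (m ^ j * m)) (m ^ j * m)) = (t + m) * W := by
        rw [hW, pow_succ, Nat.Ico_zero_eq_range, Finset.sum_add_distrib, Finset.sum_const,
          Finset.card_range, smul_eq_mul, ← Finset.mul_sum]
        simp only [stepTime]
        rw [← Finset.mul_sum, ← blockTime_mul]
        ring
      have key : Runs B L splitProg σ (W + ((t + m) * W + ((t + m) * W + ((t + m) * W + T)))) Q := by
        have hq' : (q + 1) * (m ^ j * m) ≤ m ^ k := by rwa [pow_succ] at hq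
        refine runs_call hE ha hj (by rwa [add_mul, one_mul] at hq) fun σ₁ v h₁ h₂ h₃ => ?_
        refine Program.wp_mono (callPost_down hE h₁ hj h₂ h₃ (by
          have : 1 ≤ count f (F (j + 2)).Mem (q * m ^ (j + 1)) (m ^ (j + 1)) := hN
          change 2 ≤ count f (F (j + 2)).Mem (q * m ^ (j + 1)) (m ^ (j + 1))
          omega)) fun σ₂ h₄ => ?_
        rw [pow_succ] at hN H h₄
        have hS := ih (by omega)
        have ht1 := one_le_splitFactor m j
        have hret : ∀ T', T ≤ T' → ∀ σ' v, AtNode σ₀ m k F (j + 1) (q * (m ^ j * m)) 1 σ' →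
            HasPivot σ' v → Splits f (F (j + 2)) v (q * (m ^ j * m)) (m ^ j * m) →
            Runs B L splitProg σ' T' Q := fun T' hT σ' v k₁ k₂ k₃ =>
          (H σ' v k₁ k₂ k₃).mono hT fun _ h => h
        have hupd : (Function.update F (j + 1) (F (j + 2))) (j + 1) = F (j + 2) :=
          Function.update_self ..
        rw [← hadd]
        refine runs_sweep hE (by omega) ht1 hS hq' (hret _ (by omega)) m 0 (by omega)
          (Function.update F (j + 1) (F (j + 2))) σ₂
          (fun i hi => by rw [Function.update_of_ne (by omega)])
          (by rw [hupd]; exact Narrow.refl hN) (by simpa using h₄) ?_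
        intro F₁ σ₃ a₁ a₂ a₃ a₄ a₅
        refine runs_sweep hE (by omega) ht1 hS hq' (hret _ (by omega)) m 0 (by omega) F₁ σ₃ a₁ a₂
          a₅ ?_
        intro F₂ σ₄ b₁ b₂ b₃ b₄ b₅
        refine runs_sweep hE (by omega) ht1 hS hq' (hret _ le_rfl) m 0 (by omega) F₂ σ₄ b₁ b₂
          b₅ ?_
        intro F₃ σ₅ d₁ d₂ d₃ d₄ d₅
        -- If `N` candidates become `N₃`, the sweeps give `64 * N₃ ≤ 27 * N`, while `e₄` says `N < 2
        -- * N₃`.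
        exfalso
        rw [hupd] at a₄
        have e₁ := count_le_of_sweep a₄
        have e₂ := count_le_of_sweep b₄
        have e₃ := count_le_of_sweep d₄
        have e₄ := d₂.lt
        omega
      refine key.mono ?_ fun _ h => h
      rw [ht]
      apply le_of_eq
      ring

/-- The search for a splitter. -/
theorem runs_splitProg (hE : SplitEnv B c s X h m k σ₀) {G : Strip}
    (h₆ : σ₀.int 6 = k) (h₇ : σ₀.int 7 = 0) (h₈ : σ₀.int 8 = m ^ k) (h₉ : σ₀.int 9 = 0)
    (hG : HasStrip σ₀ (24 + 4 * (k + 1)) G) (hG' : G.Ends)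
    (hN : 1 ≤ count (L.cand c s X h) G.Mem 0 (m ^ k)) :
    Runs B L splitProg σ₀ (splitFactor m k * stepTime n h 0 (m ^ k) + nodeCost) fun σ' =>
      Keep σ₀ σ' ∧ HasStrip σ' (24 + 4 * (k + 1)) G ∧
      ∃ v, HasPivot σ' v ∧ Splits (L.cand c s X h) G v 0 (m ^ k) := by
  -- At the root only the strip with index `k + 1` matters.
  have ha : AtNode σ₀ m k (fun _ => G) k (0 * m ^ k) 0 σ₀ := by
    refine ⟨Keep.refl _, h₆, by simp [h₇], h₈, h₉, fun i h₁ h₂ => ?_, fun _ _ _ => hG'⟩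
    obtain rfl : i = k + 1 := by omega
    exact hG
  have := searches (L := L) hE k le_rfl (fun _ => G) 0 σ₀ (by simp) ha (by simpa using hN) nodeCost
    (fun σ' => Keep σ₀ σ' ∧ HasStrip σ' (24 + 4 * (k + 1)) G ∧
      ∃ v, HasPivot σ' v ∧ Splits (L.cand c s X h) G v 0 (m ^ k)) fun σ' v k₁ k₂ k₃ => ?_
  · simpa using this
  · have haddr := hE.addr
    -- The sum of mode and level exceeds `k` only in mode 1 at the root, so the loop ends exactly
    -- when the root has its splitter.
    refine (Runs.loopDone ?_ ?_ ⟨k₁.keep, k₁.strip _ (by omega) (by omega), v, k₂,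
      by simpa using k₃⟩).mono ?_ fun _ h => h
    · simp [k₁.int₉, k₁.int₆]
      omega
    · simp [k₁.int₉, k₁.int₆, hE.int₂' k₁]
    · simp only [nodeCost, splitProg, Program.maxCost]
      omega

end

/-! ### Turning to one side of a vertical line -/

/-- Integer cell 12 tells whether a line has been saved, which then is in the real cells 16
and 17. -/
def HasSaved (σ : State) : Option (ℝ × ℝ) → Prop
  | none => σ.int 12 = 0
  | some l => σ.int 12 = 1 ∧ (σ.num 16).val = l.1 ∧ (σ.num 17).val = l.2 ∧
      (σ.num 16).ops ≤ 9 ∧ (σ.num 17).ops ≤ 9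

theorem HasSaved.agree {σ σ' : State} {I R : Finset ℕ} {o : Option (ℝ × ℝ)} (h : HasSaved σ o)
    (ha : Agree I R σ σ') (hI : 12 ∉ I := by decide) (h₁ : 16 ∉ R := by decide)
    (h₂ : 17 ∉ R := by decide) : HasSaved σ' o := by
  rcases o with _ | l
  · exact (ha.int 12 hI).trans h
  · obtain ⟨e₁, e₂, e₃, e₄, e₅⟩ := h
    refine ⟨?_, ?_, ?_, ?_, ?_⟩ <;> simp only [ha.int _ hI, ha.num _ h₁, ha.num _ h₂, *]

def bothStart : Program := rset 4 (rlit 1) ;; iset 26 (ilit 0) ;; iset 27 .size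

def bothNext : Program :=
  iset 12 (ivar 28) ;; rset 16 (rvar 12) ;; rset 17 (rvar 13) ;; rset 4 (rlit (-1)) ;;
  iset 26 (ilit 0) ;; iset 27 .size

/-- Find the best lower and the best upper line at the abscissa in the real cell 5. -/
def bothProg : Program := bothStart ;; bestProg ;; bothNext ;; bestProg

abbrev bothInts : Finset ℕ := {12, 26, 27, 28}
abbrev bothNums : Finset ℕ := {4, 12, 13, 14, 15, 16, 17}

/-- The time constant of `bothProg`. -/
def bothCost : ℕ := bothProg.maxCost + 2 * bestCost

section

variable {B : Limits} {n : ℕ} [Roomy B n] {L : LP n} {c : ℝ × ℝ} {s X : ℝ}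

theorem runs_bothProg {σ : State} (hp : Params c s X σ) :
    Runs B L bothProg σ (bothCost * (n + 1)) fun σ' =>
      HasSaved σ' (L.best c 1 X 0 n) ∧ HasBest σ' (L.best c (-1) X 0 n) ∧
        Agree bothInts bothNums σ σ' := by
  have hB := Roomy.maxInt B (n := n)
  have h₁ : Runs B L bothStart σ bothStart.maxCost fun σ' => Params c 1 X σ' ∧ σ'.int 26 = 0 ∧
      σ'.int 27 = 0 + n ∧ Agree bothInts bothNums σ σ' := by
    apply Runs.of_wp
    obtain ⟨h1, h2, h3, h4, h5, h6, h7, h8⟩ := hp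
    simp [bothStart]
    refine ⟨⟨?_, ?_, ?_, ?_, ?_, ?_, ?_, ?_⟩, ?_⟩
    all_goals first | simp [*] | skip
    exact (((Agree.refl _ _ _).setNum (by decide) _).setInt (by decide) _).setInt (by decide) _
  have h₂ : ∀ σ', (Params c 1 X σ' ∧ σ'.int 26 = 0 ∧ σ'.int 27 = 0 + n ∧
      Agree bothInts bothNums σ σ') → Runs B L bestProg σ' (bestCost * (n + 1)) fun σ' =>
        Params c 1 X σ' ∧ HasBest σ' (L.best c 1 X 0 n) ∧ Agree bothInts bothNums σ σ' := by
    rintro σ' ⟨e₁, e₂, e₃, e₄⟩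
    refine (runs_bestProg e₁ e₂ e₃ (by omega)).mono (by simp) ?_
    rintro σ₁ ⟨f₁, f₂⟩
    exact ⟨e₁.agree f₂, f₁, e₄.trans (f₂.mono (by decide) (by decide))⟩
  have h₃ : ∀ σ', (Params c 1 X σ' ∧ HasBest σ' (L.best c 1 X 0 n) ∧
      Agree bothInts bothNums σ σ') → Runs B L bothNext σ' bothNext.maxCost fun σ' =>
        Params c (-1) X σ' ∧ HasSaved σ' (L.best c 1 X 0 n) ∧ σ'.int 26 = 0 ∧
        σ'.int 27 = 0 + n ∧ Agree bothInts bothNums σ σ' := by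
    rintro σ' ⟨⟨h1, h2, h3, h4, h5, h6, h7, h8⟩, e₂, e₃⟩
    apply Runs.of_wp
    simp [bothNext]
    refine ⟨⟨?_, ?_, ?_, ?_, ?_, ?_, ?_, ?_⟩, ?_, ?_⟩
    all_goals first | simp [*] | skip
    · rcases o : L.best c 1 X 0 n with _ | l
      · rw [o] at e₂
        simpa [HasSaved, HasBest] using e₂
      · rw [o] at e₂
        simpa [HasSaved, HasBest] using e₂
    · repeat' first | exact e₃ | refine Agree.setNum ?_ (by decide) _ |
        refine Agree.setInt ?_ (by decide) _
  have h₄ : ∀ σ', (Params c (-1) X σ' ∧ HasSaved σ' (L.best c 1 X 0 n) ∧ σ'.int 26 = 0 ∧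
      σ'.int 27 = 0 + n ∧ Agree bothInts bothNums σ σ') →
      Runs B L bestProg σ' (bestCost * (n + 1)) fun σ' =>
        HasSaved σ' (L.best c 1 X 0 n) ∧ HasBest σ' (L.best c (-1) X 0 n) ∧
        Agree bothInts bothNums σ σ' := by
    rintro σ' ⟨e₁, e₂, e₃, e₄, e₅⟩
    refine (runs_bestProg e₁ e₃ e₄ (by omega)).mono (by simp) ?_
    rintro σ₁ ⟨f₁, f₂⟩
    exact ⟨e₂.agree f₂, f₁, e₅.trans (f₂.mono (by decide) (by decide))⟩
  refine (h₁.andThen fun σ' h' => (h₂ σ' h').andThen fun σ' h' =>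
    (h₃ σ' h').andThen h₄).mono ?_ fun _ h => h
  have : bothStart.maxCost + bothNext.maxCost ≤ bothProg.maxCost := by
    simp only [bothProg, Program.maxCost]
    omega
  rw [bothCost]
  nlinarith [Nat.zero_le (bothProg.maxCost * n)]

/-- Integer cell 13 receives the direction in which to turn from the abscissa in the real
cell 7. -/
def turnTest : Program :=
  iset 13 (ilit 0) ;;
  .cond (.intEq (ivar 12) (ilit 0)) (iset 13 (ilit 1))
    (.cond (.intEq (ivar 28) (ilit 0)) (.cond (.numLe (rvar 16) (rlit 0)) (iset 13 (ilit 1)) .skip)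
      (.cond (.numLe (rvar 16 * rvar 7 + rvar 17 + (rvar 12 * rvar 7 + rvar 13)) (rlit 0))
        (.cond (.numLe (rvar 16) (rlit 0)) (iset 13 (ilit 1)) .skip)
        (.cond (.numLe (rlit 0) (rvar 16 + rvar 12)) .skip (iset 13 (ilit 1)))))

theorem wp_turnTest {σ : State} {v : ℝ} {o o' : Option (ℝ × ℝ)} (h : HasSaved σ o)
    (h' : HasBest σ o') (hv : HasPivot σ v) :
    turnTest.wp B L σ fun σ' => (TurnsRight v o o' ↔ σ'.int 13 = 1) ∧ Agree {13} ∅ σ σ' := by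
  obtain ⟨v₁, v₂⟩ := hv
  have hO := Roomy.ops (B := B) n
  have hA : ∀ a, Agree {13} ∅ σ (σ.setInt 13 a) := fun a => (Agree.refl _ _ _).setInt (by decide) _
  have hA' : ∀ a b, Agree {13} ∅ σ ((σ.setInt 13 a).setInt 13 b) :=
    fun a b => (hA a).setInt (by decide) _
  rcases o with _ | l
  · have h : σ.int 12 = 0 := h
    simp [turnTest, h, TurnsRight, hA']
  obtain ⟨e₁, e₂, e₃, e₄, e₅⟩ := h
  rcases o' with _ | l'
  · have h' : σ.int 28 = 0 := h'
    by_cases hl : l.1 ≤ 0 <;> simp [turnTest, e₁, h', TurnsRight, hA', hA, e₂, hl]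
    exact not_le.1 hl
  obtain ⟨f₁, f₂, f₃, f₄, f₅⟩ := h'
  by_cases hs : l.1 * v + l.2 + (l'.1 * v + l'.2) ≤ 0
  · by_cases hl : l.1 ≤ 0
    · simp [turnTest, e₁, f₁, TurnsRight, hA', hA, e₂, hl, lineAt, hs, v₁, e₃, f₂, f₃]
      omega
    · simp [turnTest, e₁, f₁, TurnsRight, hA, e₂, hl, lineAt, hs, v₁, e₃, f₂, f₃, hs.not_gt]
      exact ⟨by omega, not_le.1 hl⟩
  · by_cases hl : 0 ≤ l.1 + l'.1
    · simp [turnTest, e₁, f₁, TurnsRight, hA, e₂, hl, lineAt, hs, v₁, e₃, f₂, f₃, hl.not_gt]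
      exact ⟨by omega, fun _ => by omega⟩
    · simp [turnTest, e₁, f₁, TurnsRight, hA', hA, e₂, hl, lineAt, hs, v₁, e₃, f₂, f₃]
      exact ⟨by omega, fun h => ⟨by omega, fun h' => ⟨h, h'⟩⟩⟩

/-- The fixed data of a run with blocks of size `m ^ j`, `j ≤ k`. -/
structure Layout (B : Limits) (n k m : ℕ) : Prop where
  two_le : 2 ≤ m
  size : n ≤ m ^ k
  bound : (m ^ k + 1) * 4 * n ≤ B.maxInt
  cells : 31 + 4 * k < B.cells
  addr : 32 + 4 * k ≤ B.maxInt

/-- The permanent part of the work space: the direction `c`, the current sign `s`, the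
reference abscissa `μ`, the length `h` of the blocks, the numbers `k`, `m`, `m ^ k` and the
strip `G`. -/
structure Frame (c : ℝ × ℝ) (s μ : ℝ) (h k m : ℕ) (G : Strip) (σ : State) : Prop where
  val₂ : (σ.num 2).val = c.1
  ops₂ : (σ.num 2).ops = 0
  val₃ : (σ.num 3).val = c.2
  ops₃ : (σ.num 3).ops = 0
  -- A turn overwrites the sign and the abscissa in the cells 4 and 5; `restore` resets them from
  -- the cells 18 and 6.
  val₁₈ : (σ.num 18).val = s
  ops₁₈ : (σ.num 18).ops = 0
  val₆ : (σ.num 6).val = μ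
  ops₆ : (σ.num 6).ops ≤ 200
  int₂ : σ.int 2 = k
  int₃ : σ.int 3 = m
  int₄ : σ.int 4 = m ^ k
  int₅ : σ.int 5 = h
  strip : HasStrip σ (28 + 4 * k) G

variable {μ : ℝ} {h k m : ℕ} {G : Strip}

theorem Frame.congr {G' : Strip} {σ σ' : State} (hF : Frame c s μ h k m G σ)
    (hi : ∀ i, 2 ≤ i → i < 6 → σ'.int i = σ.int i)
    (h₂ : σ'.num 2 = σ.num 2) (h₃ : σ'.num 3 = σ.num 3) (h₁₈ : σ'.num 18 = σ.num 18)
    (h₆ : σ'.num 6 = σ.num 6) (hG : HasStrip σ' (28 + 4 * k) G') :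
    Frame c s μ h k m G' σ' := by
  obtain ⟨e1, e2, e3, e4, e5, e6, e7, e8, e9, e10, e11, e12, -⟩ := hF
  refine ⟨?_, ?_, ?_, ?_, ?_, ?_, ?_, ?_, ?_, ?_, ?_, ?_, hG⟩
  all_goals first | simpa only [h₂, h₃, h₁₈, h₆] | rwa [hi _ (by omega) (by omega)]

theorem Frame.agree {σ σ' : State} (hF : Frame c s μ h k m G σ) {I R : Finset ℕ}
    (ha : Agree I R σ σ') (hI : ∀ i ∈ I, ¬ (2 ≤ i ∧ i < 6) := by decide)
    (hR : ∀ k ∈ R, k < 24 := by decide) (h₂ : 2 ∉ R := by decide) (h₃ : 3 ∉ R := by decide)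
    (h₆ : 6 ∉ R := by decide) (h₁₈ : 18 ∉ R := by decide) : Frame c s μ h k m G σ' :=
  hF.congr (fun i h h' => ha.int i fun hi => hI i hi ⟨h, h'⟩) (ha.num _ h₂) (ha.num _ h₃)
    (ha.num _ h₁₈) (ha.num _ h₆) (hF.strip.agree ha (by omega) hR)

theorem Frame.params {σ : State} (hF : Frame c s μ h k m G σ) (h₄ : σ.num 4 = σ.num 18)
    (h₅ : σ.num 5 = σ.num 6) : Params c s μ σ := by
  obtain ⟨e1, e2, e3, e4, e5, e6, e7, e8, -⟩ := hF
  constructor <;> simp_all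

/-- Reset the sign and the abscissa. -/
def restore : Program := rset 4 (rvar 18) ;; rset 5 (rvar 6)

theorem wp_restore {σ : State} (hF : Frame c s μ h k m G σ) :
    restore.wp B L σ fun σ' => Frame c s μ h k m G σ' ∧ Params c s μ σ' := by
  simp [restore]
  have f₂ : Agree ∅ {4, 5} σ ((σ.setNum 4 ⟨(σ.num 18).val, (σ.num 18).ops⟩).setNum 5
    ⟨(σ.num 6).val, (σ.num 6).ops⟩) :=
    ((Agree.refl _ _ _).setNum (by decide) _).setNum (by decide) _
  have f₃ := hF.agree f₂
  exact ⟨f₃, f₃.params (by simp) (by simp)⟩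

def turnEnd : Program :=
  iset 22 (ilit 28 + ilit 4 * ivar 2) ;;
  .cond (.intEq (ivar 13) (ilit 1)) (setEnd (ivar 22) (ivar 22 + ilit 1))
    (setEnd (ivar 22 + ilit 2) (ivar 22 + ilit 3)) ;;
  restore

/-- Restrict the strip to one side of the abscissa in the real cell 7. -/
def turnProg : Program := rset 5 (rvar 7) ;; bothProg ;; turnTest ;; turnEnd

open Classical in
/-- The strip after the turn at `v`. -/
noncomputable def LP.turn {n : ℕ} (L : LP n) (c : ℝ × ℝ) (G : Strip) (v : ℝ) : Strip :=
  if TurnsRight v (L.best c 1 v 0 n) (L.best c (-1) v 0 n) then G.setLo v else G.setHi v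

/-- The time constant of `turnProg`. -/
def turnCost : ℕ := turnProg.maxCost + bothCost

theorem wp_turnEnd (hL : Layout B n k m) {σ : State} {v : ℝ} (hF : Frame c s μ h k m G σ)
    (hv : HasPivot σ v) (ht : TurnsRight v (L.best c 1 v 0 n) (L.best c (-1) v 0 n) ↔
      σ.int 13 = 1) :
    turnEnd.wp B L σ fun σ' => Frame c s μ h k m (L.turn c G v) σ' ∧ Params c s μ σ' := by
  have hcell := hL.cells
  have haddr := hL.addr
  have hB := Roomy.maxInt B (n := n)
  have h22 : Agree {22} ∅ σ (σ.setInt 22 (28 + 4 * k)) := (Agree.refl _ _ _).setInt (by decide) _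
  have hfin : ∀ σ' : State, HasStrip σ' (28 + 4 * k) (L.turn c G v) →
      σ'.int = (σ.setInt 22 (28 + 4 * k)).int →
      (∀ i, i < 28 + 4 * k ∨ 28 + 4 * k + 4 ≤ i → σ'.num i = (σ.setInt 22 (28 + 4 * k)).num i) →
      restore.wp B L σ' fun σ' =>
        Frame c s μ h k m (L.turn c G v) σ' ∧ Params c s μ σ' := by
    intro σ' e₁ e₂ e₃
    refine wp_restore ?_
    exact (hF.agree h22).congr (fun i _ _ => by rw [e₂]) (e₃ _ (by omega)) (e₃ _ (by omega))
      (e₃ _ (by omega)) (e₃ _ (by omega)) e₁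
  have hG := (hF.agree h22).strip
  have hv' : HasPivot (σ.setInt 22 (28 + 4 * k)) v := hv
  rw [turnEnd, Program.wp_seq]
  simp only [Program.wp_iset, IntExpr.safe_add, IntExpr.safe_mul, IntExpr.safe_lit,
    IntExpr.safe_ivar, IntExpr.value_add, IntExpr.value_mul, IntExpr.value_lit,
    IntExpr.value_cell, hF.int₂, Nat.reduceLT, Nat.reduceLeDiff, true_and]
  refine ⟨⟨by omega, by omega⟩, ?_⟩
  rw [Program.wp_seq, Program.wp_cond]
  refine ⟨by simp, fun hr => ?_, fun hr => ?_⟩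
  · have hr : σ.int 13 = 1 := by simpa using hr
    have hG' : L.turn c G v = G.setLo v := by rw [LP.turn, if_pos (ht.2 hr)]
    refine Program.wp_mono (wp_setLo hG hv' ?_ ?_ ?_ ?_ (by omega)) ?_
    · simp
    · simp
    · intro w
      simp
      omega
    · simp
    · rintro σ' ⟨e₁, e₂, e₃⟩
      rw [← hG'] at e₁
      exact hfin σ' e₁ e₂ e₃
  · have hr : σ.int 13 ≠ 1 := by simpa using hr
    have hG' : L.turn c G v = G.setHi v := by rw [LP.turn, if_neg fun h => hr (ht.1 h)]
    refine Program.wp_mono (wp_setHi hG hv' ?_ ?_ ?_ ?_ (by omega)) ?_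
    · simp
      omega
    · simp
    · intro w
      simp
      omega
    · simp
    · rintro σ' ⟨e₁, e₂, e₃⟩
      rw [← hG'] at e₁
      exact hfin σ' e₁ e₂ e₃

theorem runs_turnProg (hL : Layout B n k m) {σ : State} {v : ℝ} (hF : Frame c s μ h k m G σ)
    (hp : Params c s μ σ) (hv : HasPivot σ v) :
    Runs B L turnProg σ (turnCost * (n + 1)) fun σ' =>
      Frame c s μ h k m (L.turn c G v) σ' ∧ Params c s μ σ' := by
  have h₁ : Runs B L (rset 5 (rvar 7)) σ (rset 5 (rvar 7)).maxCost fun σ' =>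
      Frame c s μ h k m G σ' ∧ Params c s v σ' ∧ HasPivot σ' v := by
    apply Runs.of_wp
    obtain ⟨v₁, v₂⟩ := hv
    simp
    refine ⟨hF.agree ((Agree.refl {} {5} σ).setNum (by decide) _), ?_, ?_⟩
    · obtain ⟨h1, h2, h3, h4, h5, h6, h7, h8⟩ := hp
      refine ⟨?_, ?_, ?_, ?_, ?_, ?_, ?_, ?_⟩
      all_goals first | (simp [*]; done) | skip
      simp
      omega
    · exact ⟨by simp [v₁], by simp [v₂]⟩
  have h₂ : ∀ σ', (Frame c s μ h k m G σ' ∧ Params c s v σ' ∧ HasPivot σ' v) →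
      Runs B L bothProg σ' (bothCost * (n + 1)) fun σ' => Frame c s μ h k m G σ' ∧
        HasPivot σ' v ∧ HasSaved σ' (L.best c 1 v 0 n) ∧ HasBest σ' (L.best c (-1) v 0 n) := by
    rintro σ' ⟨e₁, e₂, e₃⟩
    refine (runs_bothProg e₂).mono le_rfl ?_
    rintro σ₁ ⟨f₁, f₂, f₃⟩
    refine ⟨e₁.agree f₃, ?_, f₁, f₂⟩
    rw [HasPivot, f₃.num 7 (by decide)]
    exact e₃
  have h₃ : ∀ σ', (Frame c s μ h k m G σ' ∧
        HasPivot σ' v ∧ HasSaved σ' (L.best c 1 v 0 n) ∧ HasBest σ' (L.best c (-1) v 0 n)) →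
      Runs B L turnTest σ' turnTest.maxCost fun σ' => Frame c s μ h k m G σ' ∧
        HasPivot σ' v ∧ (TurnsRight v (L.best c 1 v 0 n) (L.best c (-1) v 0 n) ↔
      σ'.int 13 = 1) := by
    rintro σ' ⟨e₁, e₂, e₃, e₄⟩
    refine Runs.of_wp (Program.wp_mono (wp_turnTest e₃ e₄ e₂) ?_)
    rintro σ₁ ⟨f₁, f₂⟩
    refine ⟨e₁.agree f₂, ?_, f₁⟩
    rw [HasPivot, f₂.num 7 (by decide)]
    exact e₂
  refine (h₁.andThen fun σ' h' => (h₂ σ' h').andThen fun σ' h' => (h₃ σ' h').andThen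
    fun σ' h' => Runs.of_wp (wp_turnEnd hL h'.1 h'.2.1 h'.2.2)).mono ?_ fun _ h => h
  have : (rset 5 (rvar 7)).maxCost + (turnTest.maxCost + turnEnd.maxCost) ≤ turnProg.maxCost := by
    simp only [turnProg, Program.maxCost]
    omega
  rw [turnCost]
  nlinarith [Nat.zero_le (turnProg.maxCost * n)]

end

/-! ### Removing all candidates from the strip -/

def countStart : Program :=
  iset 16 (ilit 0) ;; iset 17 (ivar 4) ;; iset 22 (ilit 28 + ilit 4 * ivar 2)

/-- Count the candidates in the strip. -/
def countAll : Program := countStart ;; scanProg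

def splitStart : Program :=
  iset 6 (ivar 2) ;; iset 7 (ilit 0) ;; iset 8 (ivar 4) ;; iset 9 (ilit 0)

def clearBody : Program := splitStart ;; splitProg ;; turnProg ;; countAll

/-- Restrict the strip until it contains no candidates. -/
def clearProg : Program := countAll ;; .loop (.intLe (ilit 1) (ivar 18)) clearBody

/-- The time for one round of `clearProg`. -/
def roundTime (n h k m : ℕ) : ℕ :=
  clearProg.maxCost + clearBody.maxCost + nodeCost + splitFactor m k * stepTime n h 0 (m ^ k) +
    turnCost * (n + 1) + blockTime n h 0 (m ^ k)

section

variable {B : Limits} {n : ℕ} {L : LP n} {c : ℝ × ℝ} {s μ : ℝ} {h k m : ℕ} {G : Strip}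

theorem Layout.splitEnv (hL : Layout B n k m) (hh : 1 ≤ h) (hn : h ≤ n) {σ : State}
    (hF : Frame c s μ h k m G σ) (hp : Params c s μ σ) : SplitEnv B c s μ h m k σ :=
  ⟨hp, hF.int₂, hF.int₃, hF.int₅, hh, hL.two_le,
    (Nat.mul_le_mul_left _ hn).trans hL.bound, hL.cells, hL.addr⟩

variable [Roomy B n]

theorem runs_countAll (hL : Layout B n k m) (hh : 1 ≤ h) (hn : h ≤ n) {σ : State}
    (hF : Frame c s μ h k m G σ) (hp : Params c s μ σ) :
    Runs B L countAll σ (countStart.maxCost + blockTime n h 0 (m ^ k)) fun σ' =>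
      Frame c s μ h k m G σ' ∧ Params c s μ σ' ∧
      σ'.int 18 = count (L.cand c s μ h) G.Mem 0 (m ^ k) := by
  have hcell := hL.cells
  have haddr := hL.addr
  have hm : 1 ≤ m ^ k := Nat.pow_pos (by have := hL.two_le; omega)
  have hE := hL.splitEnv hh hn hF hp
  have hb := hE.bound' le_rfl
  have h₁ : Runs B L countStart σ countStart.maxCost fun σ' => Agree {16, 17, 22} ∅ σ σ' ∧
      σ'.int 16 = 0 ∧ σ'.int 17 = 0 + m ^ k ∧ σ'.int 22 = 28 + 4 * k := by
    apply Runs.of_wp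
    simp [countStart, hF.int₂, hF.int₄]
    exact ⟨⟨by omega, by omega⟩, (((Agree.refl _ _ _).setInt (by decide) _).setInt
      (by decide) _).setInt (by decide) _⟩
  refine h₁.andThen ?_
  rintro σ' ⟨e₁, e₂, e₃, e₄⟩
  have hF' := hF.agree e₁
  refine (runs_scanProg (hp.agree e₁) e₂ e₃ hF'.int₅ e₄ hh hm (by rw [zero_add]; exact hb.1)
    (by omega) (by omega) (by omega) rfl hF'.strip).mono le_rfl ?_
  rintro σ₁ ⟨f₁, f₂⟩
  exact ⟨hF'.agree f₂, (hp.agree e₁).agree f₂, f₁.total⟩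

theorem runs_clearBody (hL : Layout B n k m) (hh : 1 ≤ h) (hn : h ≤ n) {σ : State}
    (hF : Frame c s μ h k m G σ) (hp : Params c s μ σ) (hG : G.Ends)
    (hN : 1 ≤ count (L.cand c s μ h) G.Mem 0 (m ^ k)) :
    Runs B L clearBody σ (clearBody.maxCost + nodeCost +
        splitFactor m k * stepTime n h 0 (m ^ k) + turnCost * (n + 1) + blockTime n h 0 (m ^ k))
      fun σ' => ∃ v, G.Mem v ∧ Frame c s μ h k m (L.turn c G v) σ' ∧ Params c s μ σ' ∧
        4 * count (L.cand c s μ h) (L.turn c G v).Mem 0 (m ^ k) ≤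
          3 * count (L.cand c s μ h) G.Mem 0 (m ^ k) ∧
        σ'.int 18 = count (L.cand c s μ h) (L.turn c G v).Mem 0 (m ^ k) := by
  have h₁ : Runs B L splitStart σ splitStart.maxCost fun σ' => Agree {6, 7, 8, 9} ∅ σ σ' ∧
      σ'.int 6 = k ∧ σ'.int 7 = 0 ∧ σ'.int 8 = m ^ k ∧ σ'.int 9 = 0 := by
    apply Runs.of_wp
    simp [splitStart, hF.int₂, hF.int₄]
    exact ((((Agree.refl _ _ _).setInt (by decide) _).setInt (by decide) _).setInt
      (by decide) _).setInt (by decide) _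
  have h₂ : ∀ σ', (Agree {6, 7, 8, 9} ∅ σ σ' ∧ σ'.int 6 = k ∧ σ'.int 7 = 0 ∧
      σ'.int 8 = m ^ k ∧ σ'.int 9 = 0) →
      Runs B L splitProg σ' (splitFactor m k * stepTime n h 0 (m ^ k) + nodeCost) fun σ' =>
        Frame c s μ h k m G σ' ∧ Params c s μ σ' ∧
        ∃ v, HasPivot σ' v ∧ Splits (L.cand c s μ h) G v 0 (m ^ k) := by
    rintro σ' ⟨e₁, e₂, e₃, e₄, e₅⟩
    have hF' := hF.agree e₁
    have hp' := hp.agree e₁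
    have hs := hF'.strip
    rw [show 28 + 4 * k = 24 + 4 * (k + 1) by ring] at hs
    refine (runs_splitProg (hL.splitEnv hh hn hF' hp') e₂ e₃ e₄ e₅ hs hG hN).mono le_rfl ?_
    rintro σ₁ ⟨f₁, f₂, f₃⟩
    rw [show 24 + 4 * (k + 1) = 28 + 4 * k by ring] at f₂
    exact ⟨hF'.congr (fun i _ _ => f₁.int i (by omega)) (f₁.num _ (by omega)) (f₁.num _ (by omega))
      (f₁.num _ (by omega)) (f₁.num _ (by omega)) f₂, f₁.params hp', f₃⟩
  have h₃ : ∀ σ', (Frame c s μ h k m G σ' ∧ Params c s μ σ' ∧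
        ∃ v, HasPivot σ' v ∧ Splits (L.cand c s μ h) G v 0 (m ^ k)) →
      Runs B L turnProg σ' (turnCost * (n + 1)) fun σ' => ∃ v,
        Splits (L.cand c s μ h) G v 0 (m ^ k) ∧ Frame c s μ h k m (L.turn c G v) σ' ∧
        Params c s μ σ' := by
    rintro σ' ⟨e₁, e₂, v, e₃, e₄⟩
    exact (runs_turnProg hL e₁ e₂ e₃).mono le_rfl fun σ₁ hσ₁ => ⟨v, e₄, hσ₁⟩
  have h₄ : ∀ σ', (∃ v, Splits (L.cand c s μ h) G v 0 (m ^ k) ∧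
        Frame c s μ h k m (L.turn c G v) σ' ∧ Params c s μ σ') →
      Runs B L countAll σ' (countStart.maxCost + blockTime n h 0 (m ^ k)) fun σ' =>
        ∃ v, G.Mem v ∧ Frame c s μ h k m (L.turn c G v) σ' ∧ Params c s μ σ' ∧
        4 * count (L.cand c s μ h) (L.turn c G v).Mem 0 (m ^ k) ≤
          3 * count (L.cand c s μ h) G.Mem 0 (m ^ k) ∧
        σ'.int 18 = count (L.cand c s μ h) (L.turn c G v).Mem 0 (m ^ k) := by
    rintro σ' ⟨v, e₁, e₂, e₃⟩
    refine (runs_countAll hL hh hn e₂ e₃).mono le_rfl ?_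
    rintro σ₁ ⟨f₁, f₂, f₃⟩
    refine ⟨v, e₁.mem, f₁, f₂, ?_, f₃⟩
    unfold LP.turn
    split_ifs
    · exact e₁.setLo hG
    · exact e₁.setHi hG
  refine (h₁.andThen fun σ' h' => (h₂ σ' h').andThen fun σ' h' =>
    (h₃ σ' h').andThen h₄).mono ?_ fun _ h => h
  have : splitStart.maxCost + countStart.maxCost ≤ clearBody.maxCost := by
    simp only [clearBody, countAll, Program.maxCost]
    omega
  omega

/-- The strip `G'` is a valid restriction of `G`. -/
structure LP.Refines {n : ℕ} (L : LP n) (c : ℝ × ℝ) (G G' : Strip) : Prop where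
  valid : G'.Valid
  reduces : L.Reduces c G'
  sub : ∀ x, G'.CMem x → G.CMem x

theorem LP.Refines.refl (hG : G.Valid) (hR : L.Reduces c G) : L.Refines c G G :=
  ⟨hG, hR, fun _ h => h⟩

theorem LP.Refines.trans {G' G'' : Strip} (h : L.Refines c G G') (h' : L.Refines c G' G'') :
    L.Refines c G G'' :=
  ⟨h'.valid, h'.reduces, fun x hx => h.sub x (h'.sub x hx)⟩

theorem LP.refines_turn (hG : G.Valid) (hR : L.Reduces c G) {v : ℝ} (hv : G.CMem v) :
    L.Refines c G (L.turn c G v) := by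
  unfold LP.turn
  split_ifs with ht
  · exact ⟨hG.setLo hv, hR.turnRight hG.toEnds hv ht,
      fun x hx => ((Strip.cMem_setLo hG.toEnds hv).1 hx).1⟩
  · exact ⟨hG.setHi hv, hR.turnLeft hG.toEnds hv ht,
      fun x hx => ((Strip.cMem_setHi hG.toEnds hv).1 hx).1⟩

/-- The candidates are defined by the best lines at the fixed abscissa `μ`, so they stay the same
while the strip shrinks. Each round keeps at most three quarters of those inside, so `R` rounds
suffice for fewer than `(4 / 3) ^ R` candidates. -/
theorem runs_clearLoop (hL : Layout B n k m) (hh : 1 ≤ h) (hn : h ≤ n) (R : ℕ) :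
    ∀ (G : Strip) (σ : State), Frame c s μ h k m G σ → Params c s μ σ → G.Valid →
      L.Reduces c G → σ.int 18 = count (L.cand c s μ h) G.Mem 0 (m ^ k) →
      count (L.cand c s μ h) G.Mem 0 (m ^ k) * 3 ^ R < 4 ^ R →
      Runs B L (.loop (.intLe (ilit 1) (ivar 18)) clearBody) σ
        (R * roundTime n h k m + clearProg.maxCost) fun σ' =>
        ∃ G', Frame c s μ h k m G' σ' ∧ Params c s μ σ' ∧ L.Refines c G G' ∧
          count (L.cand c s μ h) G'.Mem 0 (m ^ k) = 0 := by
  have hcost : (Test.intLe (ilit 1) (ivar 18)).cost ≤ clearProg.maxCost := by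
    simp only [clearProg, Program.maxCost]
    omega
  have hdone : ∀ (G : Strip) (σ : State) (T : ℕ), clearProg.maxCost ≤ T →
      Frame c s μ h k m G σ → Params c s μ σ → G.Valid →
      L.Reduces c G → σ.int 18 = count (L.cand c s μ h) G.Mem 0 (m ^ k) →
      count (L.cand c s μ h) G.Mem 0 (m ^ k) = 0 →
      Runs B L (.loop (.intLe (ilit 1) (ivar 18)) clearBody) σ T fun σ' =>
        ∃ G', Frame c s μ h k m G' σ' ∧ Params c s μ σ' ∧ L.Refines c G G' ∧
          count (L.cand c s μ h) G'.Mem 0 (m ^ k) = 0 := by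
    intro G σ T hT hF hp hG hR h18 h0
    exact (Runs.loopDone (by simp) (by simp [h18, h0])
      ⟨G, hF, hp, LP.Refines.refl hG hR, h0⟩).mono (hcost.trans hT) fun _ h => h
  induction R with
  | zero =>
    intro G σ hF hp hG hR h18 hc
    exact hdone G σ _ (by omega) hF hp hG hR h18 (by omega)
  | succ R ih =>
    intro G σ hF hp hG hR h18 hc
    by_cases h0 : count (L.cand c s μ h) G.Mem 0 (m ^ k) = 0
    · exact hdone G σ _ (by omega) hF hp hG hR h18 h0
    refine (Runs.loopStep (T := R * roundTime n h k m + clearProg.maxCost) (by simp)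
      (by simp [h18]; omega)
      ((runs_clearBody hL hh hn hF hp hG.toEnds (Nat.one_le_iff_ne_zero.2 h0)).mono le_rfl ?_)).mono
      ?_ fun _ h => h
    · rintro σ' ⟨v, e₁, e₂, e₃, e₄, e₅⟩
      have hr := LP.refines_turn hG hR e₁.cMem
      refine (ih _ σ' e₂ e₃ hr.valid hr.reduces e₅ ?_).mono le_rfl ?_
      · rw [pow_succ, pow_succ] at hc
        have := Nat.mul_le_mul_right (3 ^ R) e₄
        nlinarith
      · rintro σ₁ ⟨G', g₁, g₂, g₃, g₄⟩
        exact ⟨G', g₁, g₂, hr.trans g₃, g₄⟩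
    · rw [add_mul, one_mul]
      have : (Test.intLe (ilit 1) (ivar 18)).cost + (clearBody.maxCost + nodeCost +
        splitFactor m k * stepTime n h 0 (m ^ k) + turnCost * (n + 1) +
          blockTime n h 0 (m ^ k)) ≤ roundTime n h k m := by
        rw [roundTime]
        omega
      omega

theorem runs_clearProg (hL : Layout B n k m) (hh : 1 ≤ h) (hn : h ≤ n) {R : ℕ}
    (hR : m ^ k * 3 ^ R < 4 ^ R) {σ : State} (hF : Frame c s μ h k m G σ)
    (hp : Params c s μ σ) (hG : G.Valid) (hr : L.Reduces c G) :
    Runs B L clearProg σ ((R + 1) * roundTime n h k m) fun σ' =>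
        ∃ G', Frame c s μ h k m G' σ' ∧ Params c s μ σ' ∧ L.Refines c G G' ∧
          count (L.cand c s μ h) G'.Mem 0 (m ^ k) = 0 := by
  refine ((runs_countAll (L := L) hL hh hn hF hp).andThen fun σ' h' =>
    runs_clearLoop hL hh hn R G σ' h'.1 h'.2.1 hG hr h'.2.2 ?_).mono ?_ fun _ h => h
  · exact (Nat.mul_le_mul_right _ (count_le _ _ _ _)).trans_lt hR
  · rw [add_mul, one_mul]
    have h₁ : countStart.maxCost ≤ clearBody.maxCost := by
      simp only [clearBody, countAll, Program.maxCost]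
      omega
    have h₂ : countStart.maxCost + blockTime n h 0 (m ^ k) + clearProg.maxCost ≤
        roundTime n h k m := by
      rw [roundTime]
      omega
    omega

/-! ### Merging lines -/

def midStart : Program := iset 22 (ilit 28 + ilit 4 * ivar 2)

def midEnd : Program :=
  .cond (.numEq (.cell (ivar 22 + ilit 1) + .cell (ivar 22 + ilit 3)) (rlit 0)) (rset 6 (rlit 0))
    (rset 6 ((.cell (ivar 22) + .cell (ivar 22 + ilit 2)) /
      (.cell (ivar 22 + ilit 1) + .cell (ivar 22 + ilit 3)))) ;;
  restore

/-- Choose a point of the strip as the new reference abscissa. -/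
def midProg : Program := midStart ;; midEnd

theorem wp_midProg (hL : Layout B n k m) {σ : State} (hF : Frame c s μ h k m G σ) :
    midProg.wp B L σ fun σ' => Frame c s G.mid h k m G σ' ∧ Params c s G.mid σ' := by
  have hcell := hL.cells
  have haddr := hL.addr
  have hO := Roomy.ops (B := B) n
  rw [midProg, Program.wp_seq]
  have h22 : Agree {22} ∅ σ (σ.setInt 22 (28 + 4 * k)) := (Agree.refl _ _ _).setInt (by decide) _
  have hF' := hF.agree h22
  have hi : (σ.setInt 22 (28 + 4 * k)).int 22 = 28 + 4 * k := by simp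
  suffices H : ∀ σ : State, σ.int 22 = 28 + 4 * k → Frame c s μ h k m G σ → midEnd.wp B L σ fun σ' =>
      Frame c s G.mid h k m G σ' ∧ Params c s G.mid σ' by
    have := H _ hi hF'
    simp only [midStart, Program.wp_iset, IntExpr.safe_add, IntExpr.safe_mul, IntExpr.safe_lit,
      IntExpr.safe_ivar, IntExpr.value_add, IntExpr.value_mul, IntExpr.value_lit,
      IntExpr.value_cell, hF.int₂, Nat.reduceLT, Nat.reduceLeDiff, true_and]
    exact ⟨⟨by omega, by omega⟩, this⟩
  clear hi hF' h22 hF σ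
  intro σ h22 hF
  have hfin : ∀ w : Num, w.val = G.mid → w.ops ≤ 200 → restore.wp B L (σ.setNum 6 w) fun σ' => Frame c s G.mid h k m G σ' ∧ Params c s G.mid σ' := by
    intro w hw hw'
    refine wp_restore ?_
    have hs := hF.strip.agree ((Agree.refl ∅ {6} σ).setNum (k := 6) (by decide) w) (by omega)
    obtain ⟨e1, e2, e3, e4, e5, e6, e7, e8, e9, e10, e11, e12, -⟩ := hF
    refine ⟨?_, ?_, ?_, ?_, ?_, ?_, ?_, ?_, ?_, ?_, ?_, ?_, hs⟩ <;> simpa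
  obtain ⟨g₁, g₂, g₃, g₄, g₅, g₆, g₇, g₈⟩ := hF.strip
  rw [midEnd, Program.wp_seq, Program.wp_cond]
  refine ⟨?_, fun hr => ?_, fun hr => ?_⟩
  · simp [NumExpr.safe_cell, h22]
    omega
  · simp [h22, g₂, g₄] at hr
    rw [Program.wp_rset B L σ 6 _ _ (by norm_num)]
    exact ⟨trivial, hfin _ (by simp [Strip.mid, hr]) (by simp)⟩
  · simp [h22, g₂, g₄] at hr
    rw [Program.wp_rset B L σ 6 _ _ (by norm_num)]
    refine ⟨?_, hfin _ (by simp [Strip.mid, hr, h22, g₁, g₂, g₃, g₄]) (by simp [h22]; omega)⟩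
    simp [NumExpr.safe_cell, h22, g₂, g₄, hr]
    omega

def mergeEnd : Program := iset 5 (ilit 2 * ivar 5)

/-- Double the length of the blocks. -/
def mergeBody : Program := midProg ;; clearProg ;; mergeEnd

/-- Merge blocks as long as there are several of them. -/
def mergeLoop : Program := .loop (.intLe (ivar 5 + ilit 1) .size) mergeBody

def phaseStart (s : ℤ) : Program := rset 18 (rlit s) ;; iset 5 (ilit 1)

/-- Restrict the strip such that one line of sign `s` dominates. -/
def phaseProg (s : ℤ) : Program := phaseStart s ;; mergeLoop

/-- The count covers only indices below `m ^ k`. Blocks with a larger index start beyond `n`,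
contain no lines and have no candidate. -/
theorem LP.dominated_double (hG : G.Valid) {G' : Strip} (hr : L.Refines c G G')
    (hn : n ≤ m ^ k) (hh : 1 ≤ h) (hD : ∀ b, L.Dominated c s G (b * h) h)
    (hc : count (L.cand c s G.mid h) G'.Mem 0 (m ^ k) = 0) (b : ℕ) :
    L.Dominated c s G' (b * (2 * h)) (2 * h) := by
  rw [← mul_assoc]
  refine LP.Dominated.double (hD (b * 2)) ?_ hG hr.valid.toEnds hr.sub fun x hx hx' => ?_
  · have := hD (b * 2 + 1)
    rwa [add_mul, one_mul] at this
  · have hb : b < m ^ k := by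
      by_contra hb
      have h₁ : b ≤ b * 2 * h := by
        rw [mul_assoc]
        exact Nat.le_mul_of_pos_right _ (by omega)
      rw [LP.cand, LP.best_of_le (by omega)] at hx
      cases hx
    have h₁ := Finset.sum_eq_zero_iff.1 hc b (Finset.mem_range.2 hb)
    rw [zero_add, if_pos ⟨x, hx, hx'⟩] at h₁
    cases h₁

/-- Induction on a bound `S` for the number of doublings that are still needed. At the end block `0`
contains all constraints. The bound `h ≤ 2 * n` keeps the integers within the limit. -/
theorem runs_mergeLoop (hL : Layout B n k m) {R W : ℕ} (hR : m ^ k * 3 ^ R < 4 ^ R)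
    (hW : ∀ h, 1 ≤ h → h ≤ n → roundTime n h k m ≤ W) (S : ℕ) :
    ∀ (G : Strip) (σ : State) (μ : ℝ) (h : ℕ), 1 ≤ h → h ≤ 2 * n → n ≤ h * 2 ^ S →
      Frame c s μ h k m G σ → G.Valid → L.Reduces c G →
      (∀ b, L.Dominated c s G (b * h) h) →
      Runs B L mergeLoop σ (S * ((R + 1) * W + mergeBody.maxCost + mergeLoop.maxCost) +
          mergeLoop.maxCost) fun σ' =>
        ∃ G' μ' h', Frame c s μ' h' k m G' σ' ∧ L.Refines c G G' ∧ L.Dominated c s G' 0 n := by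
  have hB := Roomy.maxInt B (n := n)
  have hsize := Roomy.size B (n := n)
  induction S with
  | zero =>
    intro G σ μ h hh hh' hn hF hG hr hD
    rw [pow_zero, mul_one] at hn
    refine (Runs.loopDone (by simp [hF.int₅]; omega) (by simp [hF.int₅]; omega)
      ⟨G, μ, h, hF, LP.Refines.refl hG hr, ?_⟩).mono (by simp [mergeLoop, Program.maxCost])
      fun _ h => h
    have h0 := hD 0
    rw [zero_mul] at h0
    rcases h0 with h0 | ⟨l, ⟨i, h₁, h₂, h₃⟩, h₄⟩
    · exact Or.inl fun i hi hi' => h0 i hi (by omega)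
    · refine Or.inr ⟨l, ⟨i, h₁, ?_, h₃⟩, fun i hi hi' => h₄ i hi (by omega)⟩
      by_contra hi
      rw [LP.line_of_le (by omega)] at h₃
      cases h₃
  | succ S ih =>
    intro G σ μ h hh hh' hn hF hG hr hD
    by_cases hhn : n ≤ h
    · refine (ih G σ μ h hh hh' (hhn.trans (Nat.le_mul_of_pos_right _ (by positivity))) hF hG hr
        hD).mono (by gcongr; omega) fun _ h => h
    have h₁ : Runs B L midProg σ midProg.maxCost _ := Runs.of_wp (wp_midProg (L := L) hL hF)
    have h₂ := h₁.andThen fun σ' h' => (runs_clearProg hL hh (by omega) hR h'.1 h'.2 hG hr).andThen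
      (q := mergeEnd) (T := mergeEnd.maxCost)
      (Q := fun σ' => ∃ G', Frame c s G.mid (2 * h) k m G' σ' ∧ L.Refines c G G' ∧
        ∀ b, L.Dominated c s G' (b * (2 * h)) (2 * h)) (by
        rintro σ₁ ⟨G', f₁, f₂, f₃, f₄⟩
        apply Runs.of_wp
        simp [mergeEnd, f₁.int₅]
        refine ⟨by omega, G', ?_, f₃, LP.dominated_double hG f₃ hL.size hh hD f₄⟩
        have hs := f₁.strip.agree ((Agree.refl {5} ∅ σ₁).setInt (k := 5) (by decide) (2 * h))
          (by omega)
        obtain ⟨e1, e2, e3, e4, e5, e6, e7, e8, e9, e10, e11, e12, -⟩ := f₁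
        refine ⟨?_, ?_, ?_, ?_, ?_, ?_, ?_, ?_, ?_, ?_, ?_, ?_, hs⟩ <;> simpa)
    refine (Runs.loopStep (T := S * ((R + 1) * W + mergeBody.maxCost + mergeLoop.maxCost) +
      mergeLoop.maxCost) (by simp [hF.int₅]; omega) (by simp [hF.int₅]; omega)
      (h₂.mono le_rfl ?_)).mono ?_ fun _ h => h
    · rintro σ' ⟨G', e₁, e₂, e₃⟩
      refine (ih G' σ' _ (2 * h) (by omega) (by omega) (by rw [pow_succ] at hn; linarith) e₁
        e₂.valid e₂.reduces e₃).mono le_rfl ?_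
      rintro σ₁ ⟨G'', μ', h', g₁, g₂, g₃⟩
      exact ⟨G'', μ', h', g₁, e₂.trans g₂, g₃⟩
    · have h₃ := Nat.mul_le_mul_left (R + 1) (hW h hh (by omega))
      have h₄ : midProg.maxCost + mergeEnd.maxCost ≤ mergeBody.maxCost := by
        simp only [mergeBody, Program.maxCost]
        omega
      have h₅ : (Test.intLe (ivar 5 + ilit 1) .size).cost = mergeLoop.maxCost := by
        simp only [mergeLoop, Program.maxCost]
      rw [add_mul S, one_mul, h₅]
      omega

/-- The time for a phase. -/
def phaseTime (W R S : ℕ) : ℕ :=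
  (phaseProg 0).maxCost + S * ((R + 1) * W + mergeBody.maxCost + mergeLoop.maxCost)

theorem runs_phaseProg (hL : Layout B n k m) {R W S : ℕ} (hR : m ^ k * 3 ^ R < 4 ^ R)
    (hW : ∀ h, 1 ≤ h → h ≤ n → roundTime n h k m ≤ W) (hS : n ≤ 2 ^ S) (t : ℤ) {σ : State}
    (hF : Frame c s μ h k m G σ) (hG : G.Valid) (hr : L.Reduces c G) :
    Runs B L (phaseProg t) σ (phaseTime W R S) fun σ' =>
      ∃ G' μ' h', Frame c t μ' h' k m G' σ' ∧ L.Refines c G G' ∧ L.Dominated c t G' 0 n := by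
  have h₁ : Runs B L (phaseStart t) σ (phaseStart t).maxCost (Frame c t μ 1 k m G) := by
    apply Runs.of_wp
    simp [phaseStart]
    have hs := hF.strip.agree (((Agree.refl {5} {18} σ).setNum (k := 18) (by decide)
      ⟨t, 0⟩).setInt (k := 5) (by decide) 1) (by omega)
    obtain ⟨e1, e2, e3, e4, e5, e6, e7, e8, e9, e10, e11, e12, -⟩ := hF
    refine ⟨?_, ?_, ?_, ?_, ?_, ?_, ?_, ?_, ?_, ?_, ?_, ?_, hs⟩ <;> simpa
  have hsize := Roomy.size B (n := n)
  refine (h₁.andThen fun σ' h' => runs_mergeLoop hL hR hW S G σ' μ 1 le_rfl (by omega)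
    (by omega) h' hG hr (fun b => ?_)).mono ?_ fun _ h => h
  · exact LP.dominated_one _ _ _
  -- A literal costs one step whatever its value, so `0` stands for either sign.
  · have : (phaseStart t).maxCost + mergeLoop.maxCost = (phaseProg 0).maxCost := rfl
    rw [phaseTime]
    omega

end

/-! ### Clipping a strip -/

/-- Intersect the strip at the address in cell 22 with the set of all `x` such that `α * x` is
at least `β`, where `α` and `β` are in the real cells 14 and 15. -/
def clipProg : Program :=
  .cond (.numLe (rvar 14) (rlit 0))
    (.cond (.numLe (rlit 0) (rvar 14))
      (.cond (.numLe (rvar 15) (rlit 0)) .skip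
        -- The inequality has no solution, and the strip becomes the empty interval from `1` to `0`.
        (rset 7 (rlit 1) ;; setEnd (ivar 22) (ivar 22 + ilit 1) ;;
          rset 7 (rlit 0) ;; setEnd (ivar 22 + ilit 2) (ivar 22 + ilit 3)))
      (rset 7 (rvar 15 / rvar 14) ;;
        .cond (.numLe (.cell (ivar 22 + ilit 2)) (rvar 7 * .cell (ivar 22 + ilit 3))) .skip
          (setEnd (ivar 22 + ilit 2) (ivar 22 + ilit 3))))
    (rset 7 (rvar 15 / rvar 14) ;;
      .cond (.numLe (rvar 7 * .cell (ivar 22 + ilit 1)) (.cell (ivar 22))) .skip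
        (setEnd (ivar 22) (ivar 22 + ilit 1)))

/-- In contrast to `cMem_setLo`, `v` may be above the upper end, and then the result is empty. It
suffices that `v` is above the lower end. -/
theorem Strip.Ends.cMem_clipLo {G : Strip} (hG : G.Ends) {v x : ℝ} (h : ¬ v * G.lw ≤ G.lx) :
    (G.setLo v).CMem x ↔ G.CMem x ∧ v ≤ x := by
  simp only [Strip.CMem, Strip.setLo, mul_one]
  constructor
  · rintro ⟨h₁, h₂⟩
    exact ⟨⟨(not_le.1 h).le.trans (mul_le_mul_of_nonneg_right h₁ hG.lw_nonneg), h₂⟩, h₁⟩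
  · rintro ⟨⟨_, h₂⟩, h₁⟩
    exact ⟨h₁, h₂⟩

theorem Strip.Ends.cMem_clipHi {G : Strip} (hG : G.Ends) {v x : ℝ} (h : ¬ G.hx ≤ v * G.hw) :
    (G.setHi v).CMem x ↔ G.CMem x ∧ x ≤ v := by
  simp only [Strip.CMem, Strip.setHi, mul_one]
  constructor
  · rintro ⟨h₁, h₂⟩
    exact ⟨⟨h₁, (mul_le_mul_of_nonneg_right h₂ hG.hw_nonneg).trans (not_le.1 h).le⟩, h₂⟩
  · rintro ⟨⟨h₁, _⟩, h₂⟩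
    exact ⟨h₁, h₂⟩

/-- For an infinite lower end the hypothesis reads `0 ≤ -1`, so the comparison never mistakes `v`
for redundant. -/
theorem Strip.Ends.le_of_cMem {G : Strip} (hG : G.Ends) {v x : ℝ} (h : v * G.lw ≤ G.lx)
    (hx : G.CMem x) : v ≤ x := by
  rcases hG.lo with h₁ | ⟨h₁, h₂⟩
  · have := hx.1
    rw [h₁, mul_one] at this h
    linarith
  · rw [h₁, h₂] at h
    norm_num at h

theorem Strip.Ends.ge_of_cMem {G : Strip} (hG : G.Ends) {v x : ℝ} (h : G.hx ≤ v * G.hw)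
    (hx : G.CMem x) : x ≤ v := by
  rcases hG.hi with h₁ | ⟨h₁, h₂⟩
  · have := hx.2
    rw [h₁, mul_one] at this h
    linarith
  · rw [h₁, h₂] at h
    norm_num at h

/-- `G'` is the intersection of `G` with the set of solutions of an inequality. -/
structure Strip.Clips (G : Strip) (α β : ℝ) (G' : Strip) : Prop where
  ends : G'.Ends
  iff : ∀ x, G'.CMem x ↔ G.CMem x ∧ β ≤ α * x

section

variable {B : Limits} {n : ℕ} [Roomy B n] {L : LP n}

theorem wp_clipProg {σ : State} {ad : ℕ} {G : Strip} {α β : ℝ} (h22 : σ.int 22 = ad)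
    (had : 24 ≤ ad) (had' : ad + 3 < B.cells) (had'' : ad + 3 ≤ B.maxInt)
    (hG : HasStrip σ ad G) (hG' : G.Ends) (h14 : (σ.num 14).val = α)
    (h15 : (σ.num 15).val = β) (hops : (σ.num 15).ops + (σ.num 14).ops + 1 ≤ 40) :
    clipProg.wp B L σ fun σ' => ∃ G', HasStrip σ' ad G' ∧ G.Clips α β G' ∧
      σ'.int = σ.int ∧ ∀ i, i ≠ 7 → (i < ad ∨ ad + 4 ≤ i) → σ'.num i = σ.num i := by
  have hO := Roomy.ops (B := B) n
  have hG7 : ∀ w, HasStrip (σ.setNum 7 w) ad G := fun w =>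
    hG.agree ((Agree.refl ∅ {7} σ).setNum (k := 7) (by decide) w) had
  obtain ⟨g₁, g₂, g₃, g₄, g₅, g₆, g₇, g₈⟩ := hG
  have hskip : ∀ σ' : State, HasStrip σ' ad G → (∀ x, G.CMem x → β ≤ α * x) → σ'.int = σ.int →
      (∀ i, i ≠ 7 → (i < ad ∨ ad + 4 ≤ i) → σ'.num i = σ.num i) →
      ∃ G', HasStrip σ' ad G' ∧ G.Clips α β G' ∧ σ'.int = σ.int ∧
        ∀ i, i ≠ 7 → (i < ad ∨ ad + 4 ≤ i) → σ'.num i = σ.num i :=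
    fun σ' h h' h₁ h₂ => ⟨G, h, ⟨hG', fun x => ⟨fun hx => ⟨hx, h' x hx⟩, fun hx => hx.1⟩⟩, h₁, h₂⟩
  have hskip7 : ∀ w, (∀ x, G.CMem x → β ≤ α * x) →
      ∃ G', HasStrip (σ.setNum 7 w) ad G' ∧ G.Clips α β G' ∧ (σ.setNum 7 w).int = σ.int ∧
        ∀ i, i ≠ 7 → (i < ad ∨ ad + 4 ≤ i) → (σ.setNum 7 w).num i = σ.num i :=
    fun w h => hskip _ (hG7 w) h rfl fun i hi _ => by simp [hi]
  have a₁ : ad ≠ 7 := by omega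
  have a₂ : ad + 1 ≠ 7 := by omega
  have a₃ : ad + 2 ≠ 7 := by omega
  have a₄ : ad + 3 ≠ 7 := by omega
  rw [clipProg, Program.wp_cond]
  refine ⟨by simp, fun hr => ?_, fun hr => ?_⟩
  · have hr : α ≤ 0 := by simpa [h14] using hr
    rw [Program.wp_cond]
    refine ⟨by simp, fun hr' => ?_, fun hr' => ?_⟩
    · have hr' : 0 ≤ α := by simpa [h14] using hr'
      obtain rfl := le_antisymm hr hr'
      rw [Program.wp_cond]
      refine ⟨by simp, fun hb => ?_, fun hb => ?_⟩
      · have hb : β ≤ 0 := by simpa [h15] using hb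
        exact hskip σ ⟨g₁, g₂, g₃, g₄, g₅, g₆, g₇, g₈⟩ (fun x _ => by linarith) rfl
          fun _ _ _ => rfl
      · have hb : ¬ β ≤ 0 := by simpa [h15] using hb
        rw [Program.wp_seq, Program.wp_rset B L σ 7 _ _ (by norm_num)]
        refine ⟨by simp, ?_⟩
        rw [Program.wp_seq]
        refine Program.wp_mono (wp_setLo (v := 1) (hG7 _) ⟨by simp, by simp⟩ (by simp)
          (by simp [h22]) (fun w => by simp [h22]; omega) (by simp [h22]) had') ?_
        rintro σ₁ ⟨e₁, e₂, e₃⟩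
        rw [Program.wp_seq, Program.wp_rset B L σ₁ 7 _ _ (by norm_num)]
        refine ⟨by simp, ?_⟩
        have e₄ := e₁.agree ((Agree.refl ∅ {7} σ₁).setNum (k := 7) (by decide)
          ⟨NumExpr.value L σ₁ (rlit 0), NumExpr.ops n σ₁ (rlit 0)⟩) had
        refine Program.wp_mono (wp_setHi (v := 0) e₄ ⟨by simp, by simp⟩
          (by simp [h22, e₂]; omega)
          (by simp [h22, e₂]) (fun w => by simp [h22, e₂]; omega) (by simp [h22, e₂]) had') ?_
        rintro σ₂ ⟨f₁, f₂, f₃⟩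
        refine ⟨_, f₁, ⟨(hG'.setLo 1).setHi 0, fun x => ⟨fun hx => ?_, fun hx => ?_⟩⟩, ?_, ?_⟩
        · have h₁ := hx.1
          have h₂ := hx.2
          simp only [Strip.setLo, Strip.setHi] at h₁ h₂
          linarith
        · exact absurd hx.2 (by simpa using hb)
        · rw [f₂, State.setNum_int, e₂, State.setNum_int]
        · intro i hi hi'
          rw [f₃ i hi', State.setNum_num, if_neg hi, e₃ i hi', State.setNum_num, if_neg hi]
    · have hr' : ¬ 0 ≤ α := by simpa [h14] using hr'
      have hα : α < 0 := not_le.1 hr'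
      have key : ∀ x, β ≤ α * x ↔ x ≤ β / α := fun x => by
        rw [le_div_iff_of_neg hα, mul_comm]
      rw [Program.wp_seq, Program.wp_rset B L σ 7 _ _ (by norm_num)]
      refine ⟨by simp [h14, hα.ne]; omega, ?_⟩
      rw [Program.wp_cond]
      refine ⟨by simp [NumExpr.safe_cell, h22, a₄]; omega, fun hb => ?_, fun hb => ?_⟩
      · simp [h22, a₃, a₄, g₃, g₄, h14, h15] at hb
        exact hskip7 _ fun x hx => (key x).2 (hG'.ge_of_cMem hb hx)
      · simp [h22, a₃, a₄, g₃, g₄, h14, h15] at hb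
        refine Program.wp_mono (wp_setHi (v := β / α) (hG7 _)
          ⟨by simp [h14, h15], by simpa using hops⟩ (by simp [h22]; omega)
          (by simp [h22]) (fun w => by simp [h22]; omega) (by simp [h22]) had') ?_
        rintro σ₁ ⟨e₁, e₂, e₃⟩
        refine ⟨_, e₁, ⟨hG'.setHi _, fun x => ?_⟩, e₂, fun i hi hi' => ?_⟩
        · rw [key]
          exact hG'.cMem_clipHi (not_le.2 hb)
        · rw [e₃ i hi', State.setNum_num, if_neg hi]
  · have hα : 0 < α := by simpa [h14] using hr
    have key : ∀ x, β ≤ α * x ↔ β / α ≤ x := fun x => by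
      rw [div_le_iff₀ hα, mul_comm]
    rw [Program.wp_seq, Program.wp_rset B L σ 7 _ _ (by norm_num)]
    refine ⟨by simp [h14, hα.ne']; omega, ?_⟩
    rw [Program.wp_cond]
    refine ⟨by simp [NumExpr.safe_cell, h22, a₂]; omega, fun hb => ?_, fun hb => ?_⟩
    · simp [h22, a₁, a₂, g₁, g₂, h14, h15] at hb
      exact hskip7 _ fun x hx => (key x).2 (hG'.le_of_cMem hb hx)
    · simp [h22, a₁, a₂, g₁, g₂, h14, h15] at hb
      refine Program.wp_mono (wp_setLo (v := β / α) (hG7 _)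
        ⟨by simp [h14, h15], by simpa using hops⟩ (by simp)
        (by simp [h22]) (fun w => by simp [h22]; omega) (by simp [h22]) had') ?_
      rintro σ₁ ⟨e₁, e₂, e₃⟩
      refine ⟨_, e₁, ⟨hG'.setLo _, fun x => ?_⟩, e₂, fun i hi hi' => ?_⟩
      · rw [key]
        exact hG'.cMem_clipLo (not_le.2 hb)
      · rw [e₃ i hi', State.setNum_num, if_neg hi]

/-! ### Initialization -/

open Classical in
/-- The direction of the objective, and `(0, 1)` if the objective vanishes. -/
noncomputable def LP.dir {n : ℕ} (L : LP n) : ℝ × ℝ :=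
  if L.c₁ * L.c₁ + L.c₂ * L.c₂ = 0 then (0, 1) else (L.c₁, L.c₂)

def dirProg : Program :=
  .cond (.numEq (.inC₁ * .inC₁ + .inC₂ * .inC₂) (rlit 0)) (rset 2 (rlit 0) ;; rset 3 (rlit 1))
    (rset 2 .inC₁ ;; rset 3 .inC₂)

theorem wp_dirProg : dirProg.wp B L State.blank fun σ => (σ.num 2).val = L.dir.1 ∧
    (σ.num 2).ops = 0 ∧ (σ.num 3).val = L.dir.2 ∧ (σ.num 3).ops = 0 ∧
    Agree ∅ {2, 3} State.blank σ := by
  have hO := Roomy.ops (B := B) n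
  have hA : ∀ w w', Agree ∅ {2, 3} State.blank ((State.blank.setNum 2 w).setNum 3 w') :=
    fun w w' => ((Agree.refl _ _ _).setNum (by decide) _).setNum (by decide) _
  rw [dirProg, Program.wp_cond]
  refine ⟨by simp; omega, fun h => ?_, fun h => ?_⟩
  · simp at h
    simp [LP.dir, h, hA]
  · simp at h
    simp [LP.dir, h, hA]

/-- The smallest `r` such that `n` is at most `2 ^ (r * r)`. -/
def gridSize (n : ℕ) : ℕ := Nat.find (p := fun r => n ≤ 2 ^ (r * r))
  ⟨n, (Nat.lt_two_pow_self).le.trans (Nat.pow_le_pow_right (by norm_num) (Nat.le_mul_self n))⟩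

theorem le_gridSize (n : ℕ) : n ≤ 2 ^ (gridSize n * gridSize n) :=
  Nat.find_spec (p := fun r => n ≤ 2 ^ (r * r)) _

theorem lt_of_lt_gridSize {n r : ℕ} (h : r < gridSize n) : 2 ^ (r * r) < n :=
  not_le.1 (Nat.find_min (p := fun r => n ≤ 2 ^ (r * r)) _ h)

theorem two_le_gridSize {n : ℕ} (hn : 3 ≤ n) : 2 ≤ gridSize n := by
  by_contra h
  have h₁ := le_gridSize n
  have h₂ : gridSize n = 0 ∨ gridSize n = 1 := by omega
  rcases h₂ with h₂ | h₂ <;> rw [h₂] at h₁ <;> norm_num at h₁ <;> omega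

/-- The square in the exponent is advanced by `r + r + 1`, so the program can pass to the next grid
size by multiplications with `2 ^ r`. -/
theorem two_pow_step (r : ℕ) :
    2 ^ (r * r) * 2 ^ r * 2 ^ r * 2 = 2 ^ ((r + 1) * (r + 1)) := by
  rw [show (r + 1) * (r + 1) = r * r + r + r + 1 by ring, pow_succ, pow_add, pow_add]

theorem two_pow_step_le (r : ℕ) :
    2 ^ ((r + 1) * (r + 1)) ≤ 4 * (2 ^ (r * r) * 2 ^ (r * r)) := by
  rw [← pow_add, show (4 : ℕ) = 2 ^ 2 by norm_num, ← pow_add]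
  refine Nat.pow_le_pow_right (by norm_num) ?_
  rcases r with _ | r
  · norm_num
  · nlinarith

/-- By minimality `2 ^ (r * r) < n` for the preceding `r`, and `(r + 1) ^ 2 ≤ 2 * r ^ 2 + 2`. This
crude bound is for the integer limit; the running time uses `two_pow_sq_gridSize_le`. -/
theorem two_pow_gridSize_le {n : ℕ} (hn : 3 ≤ n) :
    2 ^ (gridSize n * gridSize n) ≤ 4 * (n * n) := by
  obtain ⟨r, hr⟩ : ∃ r, gridSize n = r + 1 := ⟨gridSize n - 1, by have := two_le_gridSize hn; omega⟩
  rw [hr]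
  have := (lt_of_lt_gridSize (n := n) (r := r) (by omega)).le
  exact (two_pow_step_le r).trans (Nat.mul_le_mul_left _ (Nat.mul_le_mul this this))

def gridStart : Program := iset 2 (ilit 1) ;; iset 3 (ilit 2) ;; iset 4 (ilit 2)

def gridStep : Program :=
  iset 4 (ivar 4 * ivar 3 * ivar 3 * ilit 2) ;; iset 3 (ilit 2 * ivar 3) ;; iset 2 (ivar 2 + ilit 1)

def gridProg : Program := gridStart ;; .loop (.intLe (ivar 4 + ilit 1) .size) gridStep

theorem runs_gridProg (σ : State) :
    Runs B L gridProg σ (gridSize n * (gridProg.maxCost + gridStep.maxCost) + gridProg.maxCost)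
      fun σ' => σ'.int 2 = gridSize n ∧ σ'.int 3 = 2 ^ gridSize n ∧
        σ'.int 4 = 2 ^ (gridSize n * gridSize n) ∧ Agree {2, 3, 4} ∅ σ σ' := by
  have hsize := Roomy.size B (n := n)
  have hB := Roomy.maxInt B (n := n)
  have hB6 := Roomy.ints (B := B) (n := n)
  have hn6 : n * n ≤ n ^ 6 := by
    rw [← pow_two]
    exact Nat.pow_le_pow_right (by omega) (by norm_num)
  have h2 := two_le_gridSize hsize
  have h₁ : Runs B L gridStart σ gridStart.maxCost fun σ' => σ'.int 2 = 0 + 1 ∧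
      σ'.int 3 = 2 ^ (0 + 1) ∧ σ'.int 4 = 2 ^ ((0 + 1) * (0 + 1)) ∧ Agree {2, 3, 4} ∅ σ σ' := by
    apply Runs.of_wp
    simp [gridStart]
    exact (((Agree.refl _ _ _).setInt (by decide) _).setInt (by decide) _).setInt (by decide) _
  refine (h₁.andThen fun σ' h' => Runs.loop_for (Q := fun σ' => σ'.int 2 = gridSize n ∧
    σ'.int 3 = 2 ^ gridSize n ∧ σ'.int 4 = 2 ^ (gridSize n * gridSize n) ∧
    Agree {2, 3, 4} ∅ σ σ') (I := fun j σ' => σ'.int 2 = j + 1 ∧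
    σ'.int 3 = 2 ^ (j + 1) ∧ σ'.int 4 = 2 ^ ((j + 1) * (j + 1)) ∧ Agree {2, 3, 4} ∅ σ σ')
    (c := fun _ => gridStep.maxCost) (gridSize n - 1) ?_ ?_ h').mono ?_ fun _ h => h
  · rintro σ₁ ⟨e₁, e₂, e₃, e₄⟩
    rw [show gridSize n - 1 + 1 = gridSize n by omega] at e₁ e₂ e₃
    have h₁ := le_gridSize n
    have h₂ := two_pow_gridSize_le hsize
    refine ⟨by simp [e₃]; omega, by simp [e₃]; omega, e₁, e₂, e₃, e₄⟩
  · rintro j hj σ₁ ⟨e₁, e₂, e₃, e₄⟩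
    have h₁ := lt_of_lt_gridSize (n := n) (r := j + 1) (by omega)
    refine ⟨by simp [e₃]; omega, by simp [e₃]; omega, Runs.of_wp ?_⟩
    have h₃ := two_pow_step (j + 1)
    have h₄ := two_pow_step_le (j + 1)
    have h₅ := Nat.mul_le_mul h₁.le h₁.le
    have h₆ : 2 ^ (j + 1) ≤ 2 ^ ((j + 1) * (j + 1)) :=
      Nat.pow_le_pow_right (by norm_num) (Nat.le_mul_self _)
    have h₇ : j + 1 < 2 ^ (j + 1) := Nat.lt_two_pow_self
    have h₈ : 2 ^ (j + 1 + 1) = 2 * 2 ^ (j + 1) := by ring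
    have h₉ : 1 ≤ 2 ^ (j + 1) := Nat.one_le_two_pow
    have h₁₀ : 2 ^ ((j + 1) * (j + 1)) * 2 ^ (j + 1) ≤
        2 ^ ((j + 1) * (j + 1)) * 2 ^ (j + 1) * 2 ^ (j + 1) := Nat.le_mul_of_pos_right _ h₉
    simp only [gridStep, Program.wp_seq, Program.wp_iset, IntExpr.safe_mul, IntExpr.safe_ivar,
      IntExpr.safe_lit, IntExpr.safe_add, IntExpr.value_mul, IntExpr.value_add, IntExpr.value_lit,
      IntExpr.value_cell, State.setInt_int, e₁, e₂, e₃, Nat.reduceLT, Nat.reduceLeDiff, true_and,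
      Nat.reduceEqDiff, if_true, if_false, h₃, ← h₈]
    refine ⟨⟨⟨by omega, by omega⟩, by omega⟩, by omega, by omega, ?_⟩
    exact ((e₄.setInt (by decide) _).setInt (by decide) _).setInt (by decide) _
  · have hc : (Test.intLe (ivar 4 + ilit 1) .size).cost + gridStart.maxCost = gridProg.maxCost := by
      simp only [gridProg, Program.maxCost]
      omega
    simp only [Finset.sum_const, Finset.card_range, smul_eq_mul]
    have := Nat.mul_le_mul (Nat.sub_le (gridSize n) 1)
      (show (Test.intLe (ivar 4 + ilit 1) .size).cost + gridStep.maxCost ≤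
        gridProg.maxCost + gridStep.maxCost by omega)
    omega

end

/-! ### The initial strip -/

/-- The whole line. -/
def Strip.univ : Strip := ⟨-1, 0, 1, 0⟩

def stripProg : Program :=
  iset 22 (ilit 28 + ilit 4 * ivar 2) ;;
  .setNum (ivar 22) (rlit (-1)) ;; .setNum (ivar 22 + ilit 1) (rlit 0) ;;
  .setNum (ivar 22 + ilit 2) (rlit 1) ;; .setNum (ivar 22 + ilit 3) (rlit 0) ;;
  iset 26 (ilit 0)

def rangeCoeff : Program :=
  rset 14 (.inA (ivar 26) * rvar 2 + .inB (ivar 26) * rvar 3)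

def rangeClip : Program :=
  .cond (.numEq (rvar 14) (rlit 0))
    (rset 14 (.inB (ivar 26) * rvar 2 - .inA (ivar 26) * rvar 3) ;;
      rset 15 (.inRhs (ivar 26)) ;; clipProg) .skip

def rangeStep : Program := rangeCoeff ;; rangeClip ;; iset 26 (ivar 26 + ilit 1)

/-- Compute the strip that is given by the constraints that do not involve `y`. -/
def rangeProg : Program :=
  stripProg ;; .loop (.intLe (ivar 26 + ilit 1) .size) rangeStep

section

variable {B : Limits} {n : ℕ} [Roomy B n] {L : LP n} {c : ℝ × ℝ}

/-- The state during the computation of the initial strip, when `i` constraints have been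
read. -/
structure AtRange (L : LP n) (c : ℝ × ℝ) (σ₀ : State) (ad i : ℕ) (σ : State) : Prop where
  int : ∀ j, j ≠ 22 → j ≠ 26 → σ.int j = σ₀.int j
  num : ∀ j, j ≠ 7 → j ≠ 14 → j ≠ 15 → j < 24 → σ.num j = σ₀.num j
  int₂₂ : σ.int 22 = ad
  int₂₆ : σ.int 26 = i
  strip : ∃ G, HasStrip σ ad G ∧ G.Ends ∧
    ∀ x, G.CMem x ↔ ∀ j < i, L.coeffY c j = 0 → L.bound j ≤ L.coeffX c j * x

theorem wp_stripProg {σ : State} {k : ℕ} (h₂ : σ.int 2 = k) (hcell : 31 + 4 * k < B.cells)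
    (haddr : 32 + 4 * k ≤ B.maxInt) : stripProg.wp B L σ (AtRange L c σ (28 + 4 * k) 0) := by
  simp [stripProg, Program.wp_setNum, h₂]
  refine ⟨by omega, by omega, by omega, by omega, by omega, by omega, by omega, by omega, ?_⟩
  refine ⟨fun j h h' => by simp [h, h'], fun j _ _ _ h => ?_, by simp, by simp,
    Strip.univ, ?_, ⟨Or.inr ⟨rfl, rfl⟩, Or.inr ⟨rfl, rfl⟩⟩, fun x => ?_⟩
  · simp
    rw [if_neg (by omega), if_neg (by omega), if_neg (by omega), if_neg (by omega)]
  · constructor <;> simp [Strip.univ]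
  · simp [Strip.univ, Strip.CMem]

theorem wp_rangeStep {σ₀ σ : State} {ad i : ℕ} (hc : (σ₀.num 2).val = c.1)
    (hc₀ : (σ₀.num 2).ops = 0) (hc' : (σ₀.num 3).val = c.2) (hc₀' : (σ₀.num 3).ops = 0)
    (had : 24 ≤ ad) (had' : ad + 3 < B.cells) (had'' : ad + 3 ≤ B.maxInt) (hi : i < n)
    (hσ : AtRange L c σ₀ ad i σ) : rangeStep.wp B L σ (AtRange L c σ₀ ad (i + 1)) := by
  have hO := Roomy.ops (B := B) n
  have hB := Roomy.maxInt B (n := n)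
  have e₂ := hσ.num 2 (by norm_num) (by norm_num) (by norm_num) (by norm_num)
  have e₃ := hσ.num 3 (by norm_num) (by norm_num) (by norm_num) (by norm_num)
  obtain ⟨G, hG, hGe, hGx⟩ := hσ.strip
  have hend : ∀ σ' : State, (∀ j, j ≠ 22 → j ≠ 26 → σ'.int j = σ₀.int j) →
      (∀ j, j ≠ 7 → j ≠ 14 → j ≠ 15 → j < 24 → σ'.num j = σ₀.num j) → σ'.int 22 = ad →
      σ'.int 26 = i → (∃ G, HasStrip σ' ad G ∧ G.Ends ∧
        ∀ x, G.CMem x ↔ ∀ j < i + 1, L.coeffY c j = 0 → L.bound j ≤ L.coeffX c j * x) →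
      (iset 26 (ivar 26 + ilit 1)).wp B L σ' (AtRange L c σ₀ ad (i + 1)) := by
    rintro σ' h₁ h₂ h₃ h₄ ⟨G', h₅, h₆, h₇⟩
    simp [h₄]
    refine ⟨by omega, ⟨fun j h h' => by simp [h', h₁ j h h'], h₂, by simpa, by simp, G', ?_, h₆, h₇⟩⟩
    exact h₅.agree ((Agree.refl {26} ∅ σ').setInt (k := 26) (by decide) _) had
  have hr : rangeCoeff.wp B L σ fun σ' => (σ'.num 14).val = L.coeffY c i ∧
      Agree ∅ {14} σ σ' := by
    simp [rangeCoeff, e₂, e₃, hc, hc₀, hc', hc₀', hσ.int₂₆, hi, LP.coeffY]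
    exact ⟨by omega, (Agree.refl _ _ _).setNum (by decide) _⟩
  rw [rangeStep, Program.wp_seq]
  refine Program.wp_mono hr ?_
  rintro σ₁ ⟨f₁, f₂⟩
  have g₂ := f₂.num 2 (by decide)
  have g₃ := f₂.num 3 (by decide)
  have g₂₆ := f₂.int 26 (by decide)
  have hGs := hG.agree f₂ had
  rw [Program.wp_seq, rangeClip, Program.wp_cond]
  refine ⟨by simp, fun h0 => ?_, fun h0 => ?_⟩
  · have h0 : L.coeffY c i = 0 := by simpa [f₁] using h0
    set σ₂ := (σ₁.setNum 14 ⟨L.coeffX c i, 3⟩).setNum 15 ⟨L.bound i, 0⟩ with hσ₂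
    have hA : Agree ∅ {14, 15} σ₁ σ₂ :=
      ((Agree.refl _ _ _).setNum (by decide) _).setNum (by decide) _
    have hcl := wp_clipProg (B := B) (L := L) (σ := σ₂) (ad := ad) (G := G) (α := L.coeffX c i)
      (β := L.bound i) (by rw [hA.int 22 (by decide), f₂.int 22 (by decide), hσ.int₂₂]) had had'
      had'' (hGs.agree hA had) hGe (by simp [hσ₂]) (by simp [hσ₂]) (by simp [hσ₂])
    have hw : (rset 14 (.inB (ivar 26) * rvar 2 - .inA (ivar 26) * rvar 3) ;;
        rset 15 (.inRhs (ivar 26))).wp B L σ₁ fun σ' => σ' = σ₂ := by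
      simp [g₂, g₃, g₂₆, e₂, e₃, hc, hc₀, hc', hc₀', hσ.int₂₆, hi, hσ₂, LP.coeffX]
      omega
    change ((rset 14 (.inB (ivar 26) * rvar 2 - .inA (ivar 26) * rvar 3) ;;
        rset 15 (.inRhs (ivar 26))) ;; clipProg).wp B L σ₁ _
    rw [Program.wp_seq]
    refine Program.wp_mono hw ?_
    rintro _ rfl
    refine Program.wp_mono hcl ?_
    rintro σ₃ ⟨G', k₁, k₂, k₃, k₄⟩
    refine hend σ₃ (fun j h h' => ?_) (fun j h h' h'' h''' => ?_) ?_ ?_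
      ⟨G', k₁, k₂.ends, fun x => ?_⟩
    · rw [k₃, hA.int j (by simp), f₂.int j (by simp), hσ.int j h h']
    · rw [k₄ j h (by omega), hA.num j (by simp [h', h'']), f₂.num j (by simp [h']),
        hσ.num j h h' h'' h''']
    · rw [k₃, hA.int _ (by simp), f₂.int _ (by simp), hσ.int₂₂]
    · rw [k₃, hA.int _ (by simp), f₂.int _ (by simp), hσ.int₂₆]
    · rw [k₂.iff, hGx]
      constructor
      · rintro ⟨h₁, h₂⟩ j hj hj'
        rcases Nat.lt_succ_iff_lt_or_eq.1 hj with hj | rfl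
        · exact h₁ j hj hj'
        · exact h₂
      · intro h
        exact ⟨fun j hj => h j (by omega), h i (by omega) h0⟩
  · have h0 : L.coeffY c i ≠ 0 := by simpa [f₁] using h0
    refine hend σ₁ (fun j h h' => ?_) (fun j h h' h'' h''' => ?_) ?_ ?_ ⟨G, hGs, hGe, fun x => ?_⟩
    · rw [f₂.int j (by simp), hσ.int j h h']
    · rw [f₂.num j (by simp [h']), hσ.num j h h' h'' h''']
    · rw [f₂.int _ (by simp), hσ.int₂₂]
    · rw [f₂.int _ (by simp), hσ.int₂₆]
    · rw [hGx]
      constructor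
      · intro h₁ j hj hj'
        rcases Nat.lt_succ_iff_lt_or_eq.1 hj with hj | rfl
        · exact h₁ j hj hj'
        · exact absurd hj' h0
      · intro h j hj
        exact h j (by omega)

theorem runs_rangeProg {σ : State} {k : ℕ} (h₂ : σ.int 2 = k) (hcell : 31 + 4 * k < B.cells)
    (haddr : 32 + 4 * k ≤ B.maxInt) (hc : (σ.num 2).val = c.1)
    (hc₀ : (σ.num 2).ops = 0) (hc' : (σ.num 3).val = c.2) (hc₀' : (σ.num 3).ops = 0) :
    Runs B L rangeProg σ ((rangeProg.maxCost + rangeStep.maxCost) * (n + 1))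
      (AtRange L c σ (28 + 4 * k) n) := by
  have hB := Roomy.maxInt B (n := n)
  refine ((Runs.of_wp (wp_stripProg (c := c) h₂ hcell haddr)).andThen fun σ' h' => Runs.loop_for
    (fun i => AtRange L c σ (28 + 4 * k) i) (fun _ => rangeStep.maxCost) n ?_ ?_ h').mono ?_
    fun _ h => h
  · intro σ₁ h₁
    exact ⟨by simp [h₁.int₂₆]; omega, by simp [h₁.int₂₆], h₁⟩
  · intro j hj σ₁ h₁
    exact ⟨by simp [h₁.int₂₆]; omega, by simp [h₁.int₂₆]; omega,
      Runs.of_wp (wp_rangeStep hc hc₀ hc' hc₀' (by omega) (by omega) (by omega) hj h₁)⟩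
  · have hc : stripProg.maxCost + (Test.intLe (ivar 26 + ilit 1) .size).cost =
        rangeProg.maxCost := by
      simp only [rangeProg, Program.maxCost]
    simp only [Finset.sum_const, Finset.card_range, smul_eq_mul]
    generalize (Test.intLe (ivar 26 + ilit 1) .size).cost = a at *
    rw [← hc]
    nlinarith [Nat.zero_le (stripProg.maxCost * n), Nat.zero_le (rangeStep.maxCost)]

end

/-! ### Answers in the rotated coordinates -/

section

variable {n : ℕ} {L : LP n}

/-- The squared length of the objective. -/
noncomputable def LP.normSq {n : ℕ} (L : LP n) : ℝ := L.c₁ * L.c₁ + L.c₂ * L.c₂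

theorem LP.dir_of_eq (h : L.normSq = 0) : L.dir = (0, 1) := if_pos h
theorem LP.dir_of_ne (h : L.normSq ≠ 0) : L.dir = (L.c₁, L.c₂) := if_neg h

theorem LP.exists_coords (x₁ x₂ : ℝ) : ∃ x y, x₁ = L.dir.1 * y - L.dir.2 * x ∧
    x₂ = L.dir.2 * y + L.dir.1 * x := by
  by_cases h : L.normSq = 0
  · rw [L.dir_of_eq h]
    exact ⟨-x₁, x₂, by simp, by simp⟩
  · rw [L.dir_of_ne h]
    refine ⟨(L.c₁ * x₂ - L.c₂ * x₁) / L.normSq, (L.c₁ * x₁ + L.c₂ * x₂) / L.normSq, ?_, ?_⟩ <;>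
    · field_simp
      rw [LP.normSq]
      ring

/-- The purpose of the rotation. The factor is nonnegative, and it vanishes exactly if the objective
does; then every feasible point is optimal. -/
theorem LP.obj_coords (x y : ℝ) :
    L.obj (L.dir.1 * y - L.dir.2 * x) (L.dir.2 * y + L.dir.1 * x) = L.normSq * y := by
  by_cases h : L.normSq = 0
  · have h₁ : L.c₁ = 0 := by
      rw [LP.normSq] at h
      nlinarith [mul_self_nonneg L.c₁, mul_self_nonneg L.c₂]
    have h₂ : L.c₂ = 0 := by
      rw [LP.normSq] at h
      nlinarith [mul_self_nonneg L.c₁, mul_self_nonneg L.c₂]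
    simp [LP.obj, h, h₁, h₂]
  · rw [L.dir_of_ne h, LP.obj, LP.normSq]
    ring

theorem LP.normSq_nonneg : 0 ≤ L.normSq :=
  add_nonneg (mul_self_nonneg _) (mul_self_nonneg _)

theorem LP.isInfeasible (h : ∀ x y, ¬ L.Feas L.dir x y) : L.IsInfeasible := by
  intro x₁ x₂ hx
  obtain ⟨x, y, rfl, rfl⟩ := L.exists_coords x₁ x₂
  exact h x y ((L.feasible_iff _ x y).1 hx)

theorem LP.isUnbounded (hc : L.normSq ≠ 0) (h : ∀ M, ∃ x y, L.Feas L.dir x y ∧ y < M) :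
    L.IsUnbounded := by
  intro M
  obtain ⟨x, y, h₁, h₂⟩ := h (M / L.normSq)
  refine ⟨_, _, (L.feasible_iff _ x y).2 h₁, ?_⟩
  rw [L.obj_coords, mul_comm]
  exact (lt_div_iff₀ (lt_of_le_of_ne L.normSq_nonneg hc.symm)).1 h₂

theorem LP.isOptimal {x y : ℝ} (hxy : L.Feas L.dir x y)
    (h : L.normSq = 0 ∨ ∀ x' y', L.Feas L.dir x' y' → y ≤ y') :
    L.IsOptimal (L.dir.1 * y - L.dir.2 * x) (L.dir.2 * y + L.dir.1 * x) := by
  refine ⟨(L.feasible_iff _ x y).2 hxy, fun y₁ y₂ hy => ?_⟩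
  obtain ⟨x', y', rfl, rfl⟩ := L.exists_coords y₁ y₂
  rw [L.obj_coords, L.obj_coords]
  rcases h with h | h
  · simp [h]
  · exact mul_le_mul_of_nonneg_left (h x' y' ((L.feasible_iff _ x' y').1 hy)) L.normSq_nonneg

end

/-! ### Writing the answer -/

def outProg : Program :=
  rset 0 (rvar 2 * rvar 9 - rvar 3 * rvar 8) ;; rset 1 (rvar 3 * rvar 9 + rvar 2 * rvar 8) ;;
  iset 0 (ilit 2)

def normTest : Test := .numEq (.inC₁ * .inC₁ + .inC₂ * .inC₂) (rlit 0)

/-- The answer if there is no lower line. -/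
def freeProg : Program :=
  .cond normTest
    (rset 8 (rvar 6) ;;
      .cond (.intEq (ivar 28) (ilit 0)) (rset 9 (rlit 0))
        (rset 9 (rlit 0 - (rvar 12 * rvar 6 + rvar 13))) ;; outProg)
    (iset 0 (ilit 1))

def lineOut : Program := rset 9 (rvar 16 * rvar 8 + rvar 17) ;; outProg

def midOut : Program :=
  .cond (.numEq (.cell (ivar 22 + ilit 1) + .cell (ivar 22 + ilit 3)) (rlit 0)) (rset 8 (rlit 0))
    (rset 8 ((.cell (ivar 22) + .cell (ivar 22 + ilit 2)) /
      (.cell (ivar 22 + ilit 1) + .cell (ivar 22 + ilit 3)))) ;;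
  lineOut

def endOut (e w : IntExpr) : Program :=
  .cond (.numEq (.cell w) (rlit 0)) (iset 0 (ilit 1)) (rset 8 (.cell e) ;; lineOut)

/-- Minimize the lower line over a nonempty strip. -/
def pickProg : Program :=
  .cond normTest midOut
    (.cond (.numLe (rvar 16) (rlit 0))
      (.cond (.numLe (rlit 0) (rvar 16)) midOut (endOut (ivar 22 + ilit 2) (ivar 22 + ilit 3)))
      (endOut (ivar 22) (ivar 22 + ilit 1)))

section

variable {B : Limits} {n : ℕ} [Roomy B n] {L : LP n}

/-- The direction of the objective is available. -/
structure HasDir (L : LP n) (σ : State) : Prop where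
  val₂ : (σ.num 2).val = L.dir.1
  ops₂ : (σ.num 2).ops = 0
  val₃ : (σ.num 3).val = L.dir.2
  ops₃ : (σ.num 3).ops = 0

theorem wp_outProg {σ : State} {x y : ℝ} (hd : HasDir L σ) (hx : (σ.num 8).val = x)
    (hxo : (σ.num 8).ops ≤ 300) (hy : (σ.num 9).val = y) (hyo : (σ.num 9).ops ≤ 400)
    (hxy : L.Feas L.dir x y) (h : L.normSq = 0 ∨ ∀ x' y', L.Feas L.dir x' y' → y ≤ y') :
    outProg.wp B L σ (Answers L) := by
  have hO := Roomy.ops (B := B) n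
  obtain ⟨h₁, h₂, h₃, h₄⟩ := hd
  have key := L.isOptimal hxy h
  simp [outProg, h₁, h₂, h₃, h₄, hx, hy]
  exact ⟨by omega, Or.inr (Or.inr ⟨by simp, by simpa using key⟩)⟩

theorem normTest_iff {σ : State} : normTest.Holds L σ ↔ L.normSq = 0 := by
  simp [normTest, LP.normSq]

theorem normTest_safe {σ : State} : normTest.Safe B L σ := by
  have hO := Roomy.ops (B := B) n
  simp [normTest]
  omega

theorem wp_unbounded {σ : State} (h : L.IsUnbounded) : (iset 0 (ilit 1)).wp B L σ (Answers L) := by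
  simp [Answers, h]

/-- Without lower lines, all sufficiently low points at `μ` are feasible. So the problem is
unbounded, except for the zero objective, where one such point is reported. -/
theorem wp_freeProg {σ : State} {μ : ℝ} {o : Option (ℝ × ℝ)} (hd : HasDir L σ)
    (h₆ : (σ.num 6).val = μ) (h₆' : (σ.num 6).ops ≤ 200) (ho : HasBest σ o)
    (hf : ∀ y, (∀ l, o = some l → lineAt l μ ≤ -y) → L.Feas L.dir μ y) :
    freeProg.wp B L σ (Answers L) := by
  have hO := Roomy.ops (B := B) n
  rw [freeProg, Program.wp_cond]
  refine ⟨normTest_safe, fun hc => ?_, fun hc => ?_⟩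
  · rw [normTest_iff] at hc
    rw [Program.wp_seq, Program.wp_rset B L σ 8 _ _ (by norm_num)]
    refine ⟨by simp, ?_⟩
    rw [Program.wp_seq]
    rcases o with _ | l
    · have ho : σ.int 28 = 0 := ho
      rw [Program.wp_cond]
      refine ⟨by simp, fun _ => ?_, fun h => absurd ho (by simpa using h)⟩
      rw [Program.wp_rset _ _ _ 9 _ _ (by norm_num)]
      refine ⟨by simp, ?_⟩
      obtain ⟨d₁, d₂, d₃, d₄⟩ := hd
      refine wp_outProg (x := μ) (y := 0) ⟨?_, ?_, ?_, ?_⟩ ?_ ?_ ?_ ?_ (hf 0 (by simp)) (Or.inl hc)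
      all_goals first | (simp [*]; done) | skip
      simp
      omega
    · obtain ⟨e₁, e₂, e₃, e₄, e₅⟩ := ho
      rw [Program.wp_cond]
      refine ⟨by simp, fun h => by simp [e₁] at h, fun _ => ?_⟩
      rw [Program.wp_rset _ _ _ 9 _ _ (by norm_num)]
      refine ⟨by simp; omega, ?_⟩
      obtain ⟨d₁, d₂, d₃, d₄⟩ := hd
      refine wp_outProg (x := μ) (y := -(lineAt l μ)) ⟨?_, ?_, ?_, ?_⟩ ?_ ?_ ?_ ?_
        (hf _ (by simp)) (Or.inl hc)
      all_goals first | (simp [*, lineAt]; done) | skip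
      · simp
        omega
      · simp
        omega
  · rw [normTest_iff] at hc
    refine wp_unbounded (L.isUnbounded hc fun M => ?_)
    rcases o with _ | l
    · exact ⟨μ, M - 1, hf _ (by simp), by linarith⟩
    · refine ⟨μ, min (M - 1) (-lineAt l μ), hf _ ?_, ?_⟩
      · rintro l' hl
        cases hl
        linarith [min_le_right (M - 1) (-lineAt l μ)]
      · linarith [min_le_left (M - 1) (-lineAt l μ)]

variable {l : ℝ × ℝ} {G : Strip} {ad : ℕ}

/-- The line `l` describes the problem over the strip `G`. -/
structure LP.Lower {n : ℕ} (L : LP n) (G : Strip) (l : ℝ × ℝ) : Prop where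
  feas : ∀ x, G.CMem x → L.Feas L.dir x (lineAt l x)
  exists_le : ∀ x y, L.Feas L.dir x y → ∃ x', G.CMem x' ∧ lineAt l x' ≤ y

/-- The state before the choice of a point of the strip `G` with lower line `l`. -/
structure AtPick (L : LP n) (σ : State) (ad : ℕ) (G : Strip) (l : ℝ × ℝ) : Prop where
  dir : HasDir L σ
  strip : HasStrip σ ad G
  int₂₂ : σ.int 22 = ad
  val₁₆ : (σ.num 16).val = l.1
  ops₁₆ : (σ.num 16).ops ≤ 9
  val₁₇ : (σ.num 17).val = l.2
  ops₁₇ : (σ.num 17).ops ≤ 9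

theorem wp_lineOut {σ : State} {x : ℝ} {w : Num} (hσ : AtPick L σ ad G l)
    (hw : w.val = x) (hw' : w.ops ≤ 300) (hL : L.Lower G l) (hx : G.CMem x)
    (h : L.normSq = 0 ∨ ∀ x', G.CMem x' → lineAt l x ≤ lineAt l x') :
    lineOut.wp B L (σ.setNum 8 w) (Answers L) := by
  have hO := Roomy.ops (B := B) n
  obtain ⟨⟨d₁, d₂, d₃, d₄⟩, -, -, e₁, e₂, e₃, e₄⟩ := hσ
  rw [lineOut, Program.wp_seq, Program.wp_rset _ _ _ 9 _ _ (by norm_num)]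
  refine ⟨by simp; omega, ?_⟩
  refine wp_outProg (x := x) (y := lineAt l x) ⟨?_, ?_, ?_, ?_⟩ ?_ ?_ ?_ ?_ (hL.feas x hx)
    (h.imp id fun h x' y' hxy => ?_)
  all_goals first | (simp [*, lineAt]; done) | skip
  · simp
    omega
  · obtain ⟨x'', h₁, h₂⟩ := hL.exists_le x' y' hxy
    exact (h x'' h₁).trans h₂

theorem wp_midOut {σ : State} (hσ : AtPick L σ ad G l) (had' : ad + 3 < B.cells)
    (had'' : ad + 3 ≤ B.maxInt) (hG : G.Valid) (hL : L.Lower G l)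
    (h : L.normSq = 0 ∨ l.1 = 0) : midOut.wp B L σ (Answers L) := by
  have hO := Roomy.ops (B := B) n
  have h22 := hσ.int₂₂
  have h' : L.normSq = 0 ∨ ∀ x', G.CMem x' → lineAt l G.mid ≤ lineAt l x' :=
    h.imp id fun h x' _ => by simp [lineAt, h]
  have hstrip := hσ.strip
  obtain ⟨g₁, g₂, g₃, g₄, g₅, g₆, g₇, g₈⟩ := hstrip
  rw [midOut, Program.wp_seq, Program.wp_cond]
  refine ⟨?_, fun hr => ?_, fun hr => ?_⟩
  · simp [NumExpr.safe_cell, h22]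
    omega
  · simp [h22, g₂, g₄] at hr
    rw [Program.wp_rset B L σ 8 _ _ (by norm_num)]
    exact ⟨trivial, wp_lineOut hσ (by simp [Strip.mid, hr]) (by simp) hL hG.cMem_mid h'⟩
  · simp [h22, g₂, g₄] at hr
    rw [Program.wp_rset B L σ 8 _ _ (by norm_num)]
    refine ⟨?_, wp_lineOut hσ (by simp [Strip.mid, hr, h22, g₁, g₂, g₃, g₄])
      (by simp [h22]; omega) hL hG.cMem_mid h'⟩
    simp [NumExpr.safe_cell, h22, g₂, g₄, hr]
    omega

/-- An affine function on a nonempty interval has its minimum at the end towards which it descends,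
and is unbounded below if that end is infinite. For slope `0` or the zero objective any point will
do, and the middle point is certain to exist. -/
theorem wp_pickProg {σ : State} (hσ : AtPick L σ ad G l) (had' : ad + 3 < B.cells)
    (had'' : ad + 3 ≤ B.maxInt) (hG : G.Valid) (hL : L.Lower G l) :
    pickProg.wp B L σ (Answers L) := by
  have h22 := hσ.int₂₂
  have hstrip := hσ.strip
  obtain ⟨g₁, g₂, g₃, g₄, g₅, g₆, g₇, g₈⟩ := hstrip
  rw [pickProg, Program.wp_cond]
  refine ⟨normTest_safe, fun hc => ?_, fun hc => ?_⟩
  · rw [normTest_iff] at hc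
    exact wp_midOut hσ had' had'' hG hL (Or.inl hc)
  rw [normTest_iff] at hc
  rw [Program.wp_cond]
  refine ⟨by simp, fun h₁ => ?_, fun h₁ => ?_⟩
  · have h₁ : l.1 ≤ 0 := by simpa [hσ.val₁₆] using h₁
    rw [Program.wp_cond]
    refine ⟨by simp, fun h₂ => ?_, fun h₂ => ?_⟩
    · have h₂ : 0 ≤ l.1 := by simpa [hσ.val₁₆] using h₂
      exact wp_midOut hσ had' had'' hG hL (Or.inr (le_antisymm h₁ h₂))
    have h₂ : l.1 < 0 := by simpa [hσ.val₁₆] using h₂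
    rw [endOut, Program.wp_cond]
    refine ⟨by simp [NumExpr.safe_cell, h22]; omega, fun h₃ => ?_, fun h₃ => ?_⟩
    · have h₃ : G.hw = 0 := by simpa [h22, g₄] using h₃
      refine wp_unbounded (L.isUnbounded hc fun M => ?_)
      -- Far enough to the right to be in the strip and strictly beyond the point at which the line
      -- has the value `M`.
      set x := max (max G.lx 0) ((M - l.2) / l.1 + 1) with hx
      have h₄ : (M - l.2) / l.1 < x := by linarith [le_max_right (max G.lx 0) ((M - l.2) / l.1 + 1)]
      have h₅ : G.lx ≤ x := (le_max_left G.lx 0).trans (le_max_left _ _)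
      rcases hG.hi with h₆ | ⟨h₆, h₇⟩
      · rw [h₃] at h₆
        norm_num at h₆
      refine ⟨x, lineAt l x, hL.feas x ⟨?_, by rw [h₃, h₇]; norm_num⟩, ?_⟩
      · rcases hG.lo with h₈ | ⟨h₈, h₉⟩
        · rwa [h₈, mul_one]
        · rw [h₈, h₉]
          norm_num
      · rw [div_lt_iff_of_neg h₂] at h₄
        rw [lineAt]
        linarith
    · have h₃ : G.hw ≠ 0 := by simpa [h22, g₄] using h₃
      rcases hG.hi with h₄ | ⟨h₄, _⟩
      swap
      · exact absurd h₄ h₃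
      have hle := hG.le
      rw [h₄, mul_one] at hle
      rw [Program.wp_seq, Program.wp_rset B L σ 8 _ _ (by norm_num)]
      refine ⟨by simp [NumExpr.safe_cell, h22]; omega, wp_lineOut (x := G.hx) hσ
        (by simp [h22, g₃]) (by simp [h22]; omega) hL ⟨hle, by rw [h₄, mul_one]⟩
        (Or.inr fun x' hx' => ?_)⟩
      have h₅ := hx'.2
      rw [h₄, mul_one] at h₅
      rw [lineAt, lineAt]
      nlinarith
  · have h₂ : 0 < l.1 := by simpa [hσ.val₁₆] using h₁
    rw [endOut, Program.wp_cond]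
    refine ⟨by simp [NumExpr.safe_cell, h22]; omega, fun h₃ => ?_, fun h₃ => ?_⟩
    · have h₃ : G.lw = 0 := by simpa [h22, g₂] using h₃
      refine wp_unbounded (L.isUnbounded hc fun M => ?_)
      set x := min (min G.hx 0) ((M - l.2) / l.1 - 1) with hx
      have h₄ : x < (M - l.2) / l.1 := by linarith [min_le_right (min G.hx 0) ((M - l.2) / l.1 - 1)]
      have h₅ : x ≤ G.hx := (min_le_left _ _).trans (min_le_left G.hx 0)
      rcases hG.lo with h₆ | ⟨h₆, h₇⟩
      · rw [h₃] at h₆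
        norm_num at h₆
      refine ⟨x, lineAt l x, hL.feas x ⟨by rw [h₃, h₇]; norm_num, ?_⟩, ?_⟩
      · rcases hG.hi with h₈ | ⟨h₈, h₉⟩
        · rwa [h₈, mul_one]
        · rw [h₈, h₉]
          norm_num
      · rw [lt_div_iff₀ h₂] at h₄
        rw [lineAt]
        linarith
    · have h₃ : G.lw ≠ 0 := by simpa [h22, g₂] using h₃
      rcases hG.lo with h₄ | ⟨h₄, _⟩
      swap
      · exact absurd h₄ h₃
      have hle := hG.le
      rw [h₄, mul_one] at hle
      rw [Program.wp_seq, Program.wp_rset B L σ 8 _ _ (by norm_num)]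
      refine ⟨by simp [NumExpr.safe_cell, h22]; omega, wp_lineOut (x := G.lx) hσ
        (by simp [h22, g₁]) (by simp [h22]; omega) hL ⟨by rw [h₄, mul_one], hle⟩
        (Or.inr fun x' hx' => ?_)⟩
      have h₅ := hx'.1
      rw [h₄, mul_one] at h₅
      rw [lineAt, lineAt]
      nlinarith

/-! ### The final step -/

def upperClip : Program :=
  .cond (.intEq (ivar 28) (ilit 0)) .skip
    (rset 14 (rlit 0 - (rvar 16 + rvar 12)) ;; rset 15 (rvar 17 + rvar 13) ;; clipProg)

/-- Continue if the strip at the address in cell 22 is nonempty. -/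
def ifValid (p : Program) : Program :=
  .cond (.numLe (.cell (ivar 22) * .cell (ivar 22 + ilit 3))
    (.cell (ivar 22 + ilit 2) * .cell (ivar 22 + ilit 1))) p .skip

/-- Solve the problem, given the best line of each sign. -/
def finishProg : Program :=
  iset 0 (ilit 0) ;; iset 22 (ilit 28 + ilit 4 * ivar 2) ;;
  .cond (.intEq (ivar 12) (ilit 0)) freeProg (upperClip ;; ifValid pickProg)

theorem ifValid_test {σ : State} (hG : HasStrip σ ad G) (h22 : σ.int 22 = ad)
    (had' : ad + 3 < B.cells) (had'' : ad + 3 ≤ B.maxInt) (p : Program) :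
    ∃ b, ifValid p = .cond b p .skip ∧ b.Safe B L σ ∧
      (b.Holds L σ ↔ G.lx * G.hw ≤ G.hx * G.lw) := by
  have hO := Roomy.ops (B := B) n
  obtain ⟨g₁, g₂, g₃, g₄, g₅, g₆, g₇, g₈⟩ := hG
  refine ⟨_, rfl, ?_, ?_⟩
  · simp [NumExpr.safe_cell, h22]
    omega
  · simp [h22, g₁, g₂, g₃, g₄]

theorem wp_ifValid_pickProg {σ : State} (hσ : AtPick L σ ad G l) (had' : ad + 3 < B.cells)
    (had'' : ad + 3 ≤ B.maxInt) (hG : G.Ends) (hL : L.Lower G l) (h0 : σ.int 0 = 0) :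
    (ifValid pickProg).wp B L σ (Answers L) := by
  obtain ⟨b, h₁, h₂, h₃⟩ := ifValid_test (L := L) hσ.strip hσ.int₂₂ had' had'' pickProg
  rw [h₁, Program.wp_cond]
  refine ⟨h₂, fun hb => ?_, fun hb => ?_⟩
  · exact wp_pickProg hσ had' had'' ⟨hG, h₃.1 hb⟩ hL
  · refine Or.inl ⟨h0, L.isInfeasible fun x y hxy => ?_⟩
    obtain ⟨x', hx', -⟩ := hL.exists_le x y hxy
    exact hb (h₃.2 (hG.valid_of_cMem hx').le)

/-- The dominating lines `l` and `l'` leave room for some `y` at `x` exactly if `l + l' ≤ 0` there,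
which is one more linear condition on `x`. Cell 0 is set to `0` beforehand, so an empty clipped
strip is reported as infeasible without further action. -/
theorem wp_finishProg {k m h : ℕ} (hLa : Layout B n k m) {s : ℝ} {σ : State}
    (hF : Frame L.dir s G.mid h k m G σ) (hR : L.Reduces L.dir G) (hG : G.Valid)
    (hd : ∀ s : ℝ, s = 1 ∨ s = -1 → L.Dominated L.dir s G 0 n)
    (h₁ : HasSaved σ (L.best L.dir 1 G.mid 0 n)) (h₂ : HasBest σ (L.best L.dir (-1) G.mid 0 n)) :
    finishProg.wp B L σ (Answers L) := by
  have hcell := hLa.cells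
  have haddr := hLa.addr
  have hO := Roomy.ops (B := B) n
  have hfeas := fun x (hx : G.CMem x) => hR.feas_iff hG hd hx
  have h22 : Agree {0, 22} ∅ σ ((σ.setInt 0 0).setInt 22 (28 + 4 * k)) :=
    ((Agree.refl _ _ _).setInt (by decide) _).setInt (by decide) _
  rw [finishProg]
  simp only [Program.wp_seq, State.setInt_int, Nat.reduceEqDiff, if_false, Program.wp_iset, IntExpr.safe_add, IntExpr.safe_mul, IntExpr.safe_lit,
    IntExpr.safe_ivar, IntExpr.value_add, IntExpr.value_mul, IntExpr.value_lit,
    IntExpr.value_cell, hF.int₂, Nat.reduceLT, Nat.reduceLeDiff, true_and]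
  refine ⟨⟨by omega, by omega⟩, ?_⟩
  replace hF := hF.agree h22
  replace h₁ := h₁.agree h22
  replace h₂ : HasBest ((σ.setInt 0 0).setInt 22 (28 + 4 * k)) (L.best L.dir (-1) G.mid 0 n) := by
    unfold HasBest at *
    simpa using h₂
  have h22' : ((σ.setInt 0 0).setInt 22 (28 + 4 * k)).int 22 = 28 + 4 * k := by simp
  have h0 : ((σ.setInt 0 0).setInt 22 (28 + 4 * k)).int 0 = 0 := by simp
  clear h22
  generalize (σ.setInt 0 0).setInt 22 (28 + 4 * k) = σ at *
  have hdir : HasDir L σ := ⟨hF.val₂, hF.ops₂, hF.val₃, hF.ops₃⟩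
  rcases e₁ : L.best L.dir 1 G.mid 0 n with _ | l
  · rw [e₁] at h₁
    have h₁ : σ.int 12 = 0 := h₁
    rw [Program.wp_cond]
    refine ⟨by simp, fun _ => ?_, fun h => absurd h₁ (by simpa using h)⟩
    refine wp_freeProg hdir hF.val₆ hF.ops₆ h₂ fun y hy => ?_
    rw [hfeas _ hG.cMem_mid, e₁]
    exact ⟨by simp, hy⟩
  rw [e₁] at h₁
  obtain ⟨s₁, s₂, s₃, s₄, s₅⟩ := h₁
  rw [Program.wp_cond]
  refine ⟨by simp, fun h => by simp [s₁] at h, fun _ => ?_⟩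
  rw [Program.wp_seq]
  have hlow : ∀ G' : Strip, (∀ x, G'.CMem x ↔ G.CMem x ∧
      ∀ l', L.best L.dir (-1) G.mid 0 n = some l' → lineAt l x + lineAt l' x ≤ 0) →
      L.Lower G' l := by
    refine fun G' hG' => ⟨fun x hx => ?_, fun x y hxy => ?_⟩
    · rw [hG'] at hx
      rw [hfeas x hx.1, e₁]
      refine ⟨fun l' hl' => by cases hl'; exact le_rfl, fun l' hl' => ?_⟩
      linarith [hx.2 l' hl']
    · obtain ⟨x', y', k₁, k₂, k₃⟩ := hR.exists_feas x y hxy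
      rw [hfeas x' k₁, e₁] at k₃
      have k₄ := k₃.1 l rfl
      refine ⟨x', (hG' x').2 ⟨k₁, fun l' hl' => ?_⟩, k₄.trans k₂⟩
      linarith [k₃.2 l' hl']
  rcases e₂ : L.best L.dir (-1) G.mid 0 n with _ | l'
  · rw [e₂] at h₂
    have h₂ : σ.int 28 = 0 := h₂
    rw [upperClip, Program.wp_cond]
    refine ⟨by simp, fun _ => ?_, fun h => absurd h₂ (by simpa using h)⟩
    refine wp_ifValid_pickProg ⟨hdir, hF.strip, h22', s₂, s₄, s₃, s₅⟩ (by omega) (by omega)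
      hG.toEnds (hlow G fun x => ?_) h0
    rw [e₂]
    simp
  · rw [e₂] at h₂
    obtain ⟨t₁, t₂, t₃, t₄, t₅⟩ := h₂
    rw [upperClip, Program.wp_cond]
    refine ⟨by simp, fun h => by simp [t₁] at h, fun _ => ?_⟩
    set σ₂ := (σ.setNum 14 ⟨0 - (l.1 + l'.1), (σ.num 16).ops + (σ.num 12).ops + 2⟩).setNum 15
      ⟨l.2 + l'.2, (σ.num 17).ops + (σ.num 13).ops + 1⟩ with hσ₂
    have hA : Agree ∅ {14, 15} σ σ₂ :=
      ((Agree.refl _ _ _).setNum (by decide) _).setNum (by decide) _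
    have hcl := wp_clipProg (B := B) (L := L) (σ := σ₂) (ad := 28 + 4 * k) (G := G)
      (α := 0 - (l.1 + l'.1)) (β := l.2 + l'.2) (by rw [hA.int 22 (by decide), h22']) (by omega)
      (by omega) (by omega) (hF.strip.agree hA (by omega)) hG.toEnds (by simp [hσ₂])
      -- Here `α` has at most 20 and `β` at most 19 operations, so the quotient has at most the 40
      -- that an end of a strip may have.
      (by simp [hσ₂]) (by simp [hσ₂]; omega)
    have hw : (rset 14 (rlit 0 - (rvar 16 + rvar 12)) ;; rset 15 (rvar 17 + rvar 13)).wp B L σ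
        fun σ' => σ' = σ₂ := by
      simp [hσ₂, s₂, s₃, t₂, t₃]
      omega
    change ((rset 14 (rlit 0 - (rvar 16 + rvar 12)) ;; rset 15 (rvar 17 + rvar 13)) ;;
      clipProg).wp B L σ _
    rw [Program.wp_seq]
    refine Program.wp_mono hw ?_
    rintro _ rfl
    refine Program.wp_mono hcl ?_
    rintro σ₃ ⟨G', k₁, k₂, k₃, k₄⟩
    have hnum : ∀ i, i ≠ 7 → i ≠ 14 → i ≠ 15 → i < 24 → σ₃.num i = σ.num i := by
      intro i hi hi' hi'' hi'''
      rw [k₄ i hi (by omega), hA.num i (by simp [hi', hi''])]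
    have n₂ := hnum 2 (by norm_num) (by norm_num) (by norm_num) (by norm_num)
    have n₃ := hnum 3 (by norm_num) (by norm_num) (by norm_num) (by norm_num)
    have n₁₆ := hnum 16 (by norm_num) (by norm_num) (by norm_num) (by norm_num)
    have n₁₇ := hnum 17 (by norm_num) (by norm_num) (by norm_num) (by norm_num)
    obtain ⟨d₁, d₂, d₃, d₄⟩ := hdir
    refine wp_ifValid_pickProg ⟨⟨?_, ?_, ?_, ?_⟩, k₁, ?_, ?_, ?_, ?_, ?_⟩ (by omega) (by omega)
      k₂.ends (hlow G' fun x => ?_) ?_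
    any_goals simpa only [n₂, n₃, n₁₆, n₁₇]
    · rw [k₃, hA.int _ (by decide), h22']
    · rw [k₂.iff, e₂]
      refine and_congr_right fun _ => ⟨fun h l₁ hl₁ => ?_, fun h => ?_⟩
      · cases hl₁
        unfold lineAt
        linarith
      · have := h l' rfl
        unfold lineAt at this
        linarith
    · rw [k₃, hA.int _ (by decide), h0]

end

/-! ### The whole program -/

def reduceProg : Program :=
  phaseProg 1 ;; phaseProg (-1) ;; midProg ;; bothProg ;; finishProg

/-- The program for linear programs in the plane. -/
def solveProg : Program := dirProg ;; gridProg ;; rangeProg ;; ifValid reduceProg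

/-- A bound for the running time of `solveProg`, given a bound `W` for the time of a round. -/
def solveTime (W R S n : ℕ) : ℕ :=
  solveProg.maxCost + gridSize n * (gridProg.maxCost + gridStep.maxCost) +
    (rangeProg.maxCost + rangeStep.maxCost) * (n + 1) + 2 * phaseTime W R S + midProg.maxCost +
    bothCost * (n + 1) + finishProg.maxCost + gridProg.maxCost

section

variable {B : Limits} {n : ℕ} [Roomy B n] {L : LP n}

theorem runs_solveProg (hcell : 31 + 4 * gridSize n < B.cells) {R W S : ℕ}
    (hR : (2 ^ gridSize n) ^ gridSize n * 3 ^ R < 4 ^ R)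
    (hW : ∀ h, 1 ≤ h → h ≤ n → roundTime n h (gridSize n) (2 ^ gridSize n) ≤ W)
    (hS : n ≤ 2 ^ S) :
    Runs B L solveProg State.blank (solveTime W R S n) (Answers L) := by
  have hsize := Roomy.size B (n := n)
  have hB := Roomy.maxInt B (n := n)
  have hB6 := Roomy.ints (B := B) (n := n)
  have hk2 := two_le_gridSize hsize
  have hM := two_pow_gridSize_le hsize
  have hn := le_gridSize n
  have hlt := lt_of_lt_gridSize (n := n) (r := gridSize n - 1) (by omega)
  have hkn : gridSize n ≤ n := by
    have h₁ : gridSize n - 1 < 2 ^ (gridSize n - 1) := Nat.lt_two_pow_self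
    have h₂ : 2 ^ (gridSize n - 1) ≤ 2 ^ ((gridSize n - 1) * (gridSize n - 1)) :=
      Nat.pow_le_pow_right (by norm_num) (Nat.le_mul_self _)
    omega
  generalize hk : gridSize n = k at *
  have hmk : (2 ^ k) ^ k = 2 ^ (k * k) := (pow_mul 2 k k).symm
  have hLa : Layout B n k (2 ^ k) := by
    refine ⟨?_, by rwa [hmk], ?_, hcell, by omega⟩
    · calc 2 = 2 ^ 1 := by norm_num
        _ ≤ 2 ^ k := Nat.pow_le_pow_right (by norm_num) (by omega)
    · rw [hmk]
      refine le_trans ?_ hB6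
      have h₃ : n ^ 3 ≤ n ^ 6 := Nat.pow_le_pow_right (by omega) (by norm_num)
      have h₄ : n ≤ n ^ 3 := Nat.le_self_pow (by norm_num) n
      have h₅ : (2 ^ (k * k) + 1) * 4 * n ≤ (4 * (n * n) + 1) * 4 * n := by gcongr
      have h₆ : (4 * (n * n) + 1) * 4 * n = 16 * n ^ 3 + 4 * n := by ring
      omega
  have h₁ := Runs.of_wp (wp_dirProg (B := B) (L := L))
  have h₂ : ∀ σ : State, ((σ.num 2).val = L.dir.1 ∧ (σ.num 2).ops = 0 ∧
      (σ.num 3).val = L.dir.2 ∧ (σ.num 3).ops = 0 ∧ Agree ∅ {2, 3} State.blank σ) →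
      Runs B L gridProg σ (k * (gridProg.maxCost + gridStep.maxCost) + gridProg.maxCost)
      fun σ' => HasDir L σ' ∧ σ'.int 2 = k ∧ σ'.int 3 = 2 ^ k ∧ σ'.int 4 = (2 ^ k) ^ k ∧
        σ'.int 0 = 0 ∧ σ'.num 6 = ⟨0, 0⟩ ∧ σ'.num 18 = ⟨0, 0⟩ := by
    rintro σ ⟨e₁, e₂, e₃, e₄, e₅⟩
    have := runs_gridProg (B := B) (L := L) σ
    rw [hk] at this
    refine this.mono le_rfl ?_
    rintro σ' ⟨f₁, f₂, f₃, f₄⟩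
    refine ⟨⟨?_, ?_, ?_, ?_⟩, f₁, f₂, by rw [hmk, f₃], ?_, ?_, ?_⟩
    any_goals simpa only [f₄.num _ (Finset.notMem_empty _)]
    · rw [f₄.int 0 (by decide), e₅.int 0 (by decide)]
      rfl
    · rw [f₄.num 6 (by decide), e₅.num 6 (by decide)]
      rfl
    · rw [f₄.num 18 (by decide), e₅.num 18 (by decide)]
      rfl
  have h₃ : ∀ σ : State, (HasDir L σ ∧ σ.int 2 = k ∧ σ.int 3 = 2 ^ k ∧ σ.int 4 = (2 ^ k) ^ k ∧
        σ.int 0 = 0 ∧ σ.num 6 = ⟨0, 0⟩ ∧ σ.num 18 = ⟨0, 0⟩) →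
      Runs B L rangeProg σ ((rangeProg.maxCost + rangeStep.maxCost) * (n + 1))
      fun σ' => ∃ G, Frame L.dir 0 0 (σ'.int 5) k (2 ^ k) G σ' ∧ σ'.int 22 = 28 + 4 * k ∧
        σ'.int 0 = 0 ∧ G.Ends ∧ ∀ x, G.CMem x ↔ L.InRange L.dir x := by
    rintro σ ⟨⟨e₁, e₂, e₃, e₄⟩, e₅, e₆, e₇, e₈, e₉, e₁₀⟩
    refine (runs_rangeProg e₅ hcell (by omega) e₁ e₂ e₃ e₄).mono le_rfl ?_
    rintro σ' ⟨f₁, f₂, f₃, f₄, G, f₅, f₆, f₇⟩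
    have g₂ := f₂ 2 (by norm_num) (by norm_num) (by norm_num) (by norm_num)
    have g₃ := f₂ 3 (by norm_num) (by norm_num) (by norm_num) (by norm_num)
    have g₆ := f₂ 6 (by norm_num) (by norm_num) (by norm_num) (by norm_num)
    have g₁₈ := f₂ 18 (by norm_num) (by norm_num) (by norm_num) (by norm_num)
    refine ⟨G, ⟨?_, ?_, ?_, ?_, ?_, ?_, ?_, ?_, ?_, ?_, ?_, rfl, f₅⟩, f₃, ?_, f₆, f₇⟩
    any_goals simp only [g₂, g₃, g₆, g₁₈, e₁, e₂, e₃, e₄, e₉, e₁₀]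
    · omega
    all_goals rw [f₁ _ (by norm_num) (by norm_num)]; assumption
  have h₄ : ∀ σ : State, (∃ G, Frame L.dir 0 0 (σ.int 5) k (2 ^ k) G σ ∧ σ.int 22 = 28 + 4 * k ∧
        σ.int 0 = 0 ∧ G.Ends ∧ ∀ x, G.CMem x ↔ L.InRange L.dir x) →
      Runs B L (ifValid reduceProg) σ ((ifValid reduceProg).maxCost + (phaseTime W R S +
        (phaseTime W R S + (midProg.maxCost + (bothCost * (n + 1) + finishProg.maxCost)))))
        (Answers L) := by
    rintro σ ⟨G, hF, h22, h0, hG, hGx⟩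
    have hinR : ∀ x y, L.Feas L.dir x y → G.CMem x := fun x y hxy => by
      rw [hGx]
      intro i hi hi'
      have := hxy i hi
      rwa [hi', zero_mul, add_zero] at this
    obtain ⟨b, hb₁, hb₂, hb₃⟩ := ifValid_test (B := B) (L := L) hF.strip h22 (by omega) (by omega) reduceProg
    have hcost : b.cost + 1 ≤ (ifValid reduceProg).maxCost := by
      rw [hb₁]
      simp only [Program.maxCost]
      omega
    rw [hb₁] at hcost ⊢
    refine (Runs.cond (T := 1 + (phaseTime W R S + (phaseTime W R S + (midProg.maxCost +
      (bothCost * (n + 1) + finishProg.maxCost))))) hb₂ (fun hv => ?_) (fun hv => ?_)).mono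
      (by omega) fun _ h => h
    · have hval : G.Valid := ⟨hG, hb₃.1 hv⟩
      have hred : L.Reduces L.dir G := ⟨fun x hx => (hGx x).1 hx,
        fun x y hxy => ⟨x, y, hinR x y hxy, le_rfl, hxy⟩⟩
      refine Runs.mono (U := 1 + (phaseTime W R S + (phaseTime W R S + (midProg.maxCost +
        (bothCost * (n + 1) + finishProg.maxCost)))))
        ((runs_phaseProg hLa hR hW hS 1 hF hval hred).andThen fun σ₁ h₁ => ?_)
        (Nat.le_add_left _ 1) fun _ h => h
      obtain ⟨G₁, μ₁, i₁, f₁, r₁, d₁⟩ := h₁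
      refine (runs_phaseProg hLa hR hW hS (-1) f₁ r₁.valid r₁.reduces).andThen fun σ₂ h₂ => ?_
      obtain ⟨G₂, μ₂, i₂, f₂, r₂, d₂⟩ := h₂
      refine (Runs.of_wp (wp_midProg hLa f₂)).andThen fun σ₃ h₃ => ?_
      obtain ⟨f₃, p₃⟩ := h₃
      refine (runs_bothProg p₃).andThen fun σ₄ h₄ => ?_
      obtain ⟨s₄, b₄, a₄⟩ := h₄
      refine Runs.of_wp (wp_finishProg hLa (f₃.agree a₄) r₂.reduces r₂.valid ?_ s₄ b₄)
      rintro s (rfl | rfl)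
      -- The second phase only shrinks the strip, so the domination reached in the first phase
      -- persists.
      · simpa using d₁.mono r₂.sub
      · simpa using d₂
    · refine (Runs.of_wp (p := .skip) ?_).mono (by simp only [Program.maxCost]; omega) fun _ h => h
      refine Or.inl ⟨h0, L.isInfeasible fun x y hxy => ?_⟩
      exact hv (hb₃.2 (hG.valid_of_cMem (hinR x y hxy)).le)
  refine (h₁.andThen fun σ₁ g₁ => (h₂ σ₁ g₁).andThen fun σ₂ g₂ => (h₃ σ₂ g₂).andThen h₄).mono ?_
    fun _ h => h
  have : dirProg.maxCost + (ifValid reduceProg).maxCost ≤ solveProg.maxCost := by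
    simp only [solveProg, Program.maxCost]
    omega
  rw [solveTime, hk]
  omega

end

/-! ### The running time -/

/-- At most `n / h + 1` blocks start before `n`, each with cost `h`; together this is at most `n + h
≤ 2 * n`. The other indices cost a constant each. -/
theorem blockTime_le {n h : ℕ} (hh : 1 ≤ h) (hn : h ≤ n) (M : ℕ) :
    blockTime n h 0 M ≤ scanCost * (M + 2 * n) := by
  rw [blockTime, ← Finset.mul_sum]
  refine Nat.mul_le_mul_left _ ?_
  rw [Finset.sum_add_distrib, Finset.sum_const, Finset.card_range, smul_eq_mul, mul_one]
  refine Nat.add_le_add_left ?_ M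
  rw [← Finset.sum_filter, Finset.sum_const, smul_eq_mul]
  have h₁ : (Finset.range M).filter (fun i => (0 + i) * 2 * h < n) ⊆ Finset.range (n / h + 1) := by
    intro i hi
    rw [Finset.mem_filter] at hi
    rw [Finset.mem_range, Nat.lt_succ_iff, Nat.le_div_iff_mul_le hh]
    nlinarith [hi.2]
  have h₂ := Finset.card_le_card h₁
  rw [Finset.card_range] at h₂
  have h₃ := Nat.mul_le_mul_right h h₂
  rw [add_mul, one_mul] at h₃
  have h₄ := Nat.div_mul_le_self n h
  omega

/-- With the summand `3 * m + 1` added, the quantity at most triples from level to level. -/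
theorem splitFactor_add_le (m j : ℕ) : splitFactor m j + (3 * m + 1) ≤ (3 * m + 2) * 3 ^ j := by
  induction j with
  | zero => simp [splitFactor]; omega
  | succ j ih =>
    rw [splitFactor, pow_succ, ← mul_assoc]
    omega

/-- Degree and depth are balanced: `3 ^ k ≤ 4 ^ k` is only the square of the degree `2 ^ k`. -/
theorem splitFactor_le (k : ℕ) : splitFactor (2 ^ k) k ≤ 5 * (2 ^ k) ^ 3 := by
  have h₁ := splitFactor_add_le (2 ^ k) k
  have h₂ : 3 ^ k ≤ (2 ^ k) ^ 2 := by
    rw [← pow_mul, mul_comm, pow_mul]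
    exact Nat.pow_le_pow_left (by norm_num) k
  have h₃ : 1 ≤ 2 ^ k := Nat.one_le_two_pow
  calc splitFactor (2 ^ k) k ≤ (3 * 2 ^ k + 2) * 3 ^ k := by omega
    _ ≤ (5 * 2 ^ k) * (2 ^ k) ^ 2 := Nat.mul_le_mul (by omega) h₂
    _ = 5 * (2 ^ k) ^ 3 := by ring

/-- Consecutive squares differ by `2 * r + 1`, so the number of leaves exceeds `n` by at most the
square of the degree. -/
theorem two_pow_sq_gridSize_le {n : ℕ} (hn : 3 ≤ n) :
    (2 ^ gridSize n) ^ gridSize n ≤ n * (2 ^ gridSize n) ^ 2 := by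
  have h2 := two_le_gridSize hn
  have hlt := lt_of_lt_gridSize (n := n) (r := gridSize n - 1) (by omega)
  obtain ⟨r, hr⟩ : ∃ r, gridSize n = r + 1 := ⟨gridSize n - 1, by omega⟩
  rw [hr] at hlt ⊢
  rw [Nat.add_sub_cancel] at hlt
  calc (2 ^ (r + 1)) ^ (r + 1) = 2 ^ (r * r) * 2 ^ (2 * r + 1) := by
        rw [← pow_mul, ← pow_add]
        congr 1
        ring
    _ ≤ n * (2 ^ (r + 1)) ^ 2 := by
        rw [← pow_mul]
        exact Nat.mul_le_mul hlt.le (Nat.pow_le_pow_right (by norm_num) (by omega))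

/-- The constant in the bound for `roundTime`. -/
def roundConst : ℕ :=
  clearProg.maxCost + clearBody.maxCost + nodeCost + 15 * (nodeCost * scanCost) + 2 * turnCost +
    3 * scanCost

/-- The exponent 5 consists of 3 for the search factor and 2 for the excess of leaves over `n`. -/
theorem roundTime_le {n h : ℕ} (hn : 3 ≤ n) (hh : 1 ≤ h) (hhn : h ≤ n) :
    roundTime n h (gridSize n) (2 ^ gridSize n) ≤ roundConst * (n * (2 ^ gridSize n) ^ 5) := by
  have hM := two_pow_sq_gridSize_le hn
  have hb := blockTime_le hh hhn ((2 ^ gridSize n) ^ gridSize n)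
  have hs := splitFactor_le (gridSize n)
  have hQ : 1 ≤ 2 ^ gridSize n := Nat.one_le_two_pow
  generalize 2 ^ gridSize n = Q at *
  have hb' : blockTime n h 0 (Q ^ gridSize n) ≤ 3 * scanCost * (n * Q ^ 2) := by
    refine hb.trans ?_
    have : n * 1 ≤ n * Q ^ 2 := Nat.mul_le_mul_left _ (Nat.one_le_pow _ _ hQ)
    calc scanCost * (Q ^ gridSize n + 2 * n) ≤ scanCost * (3 * (n * Q ^ 2)) :=
          Nat.mul_le_mul_left _ (by omega)
      _ = 3 * scanCost * (n * Q ^ 2) := by ring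
  have h₁ : splitFactor Q (gridSize n) * stepTime n h 0 (Q ^ gridSize n) ≤
      15 * (nodeCost * scanCost) * (n * Q ^ 5) := by
    rw [stepTime]
    calc splitFactor Q (gridSize n) * (nodeCost * blockTime n h 0 (Q ^ gridSize n)) ≤
          5 * Q ^ 3 * (nodeCost * (3 * scanCost * (n * Q ^ 2))) :=
          Nat.mul_le_mul hs (Nat.mul_le_mul_left _ hb')
      _ = 15 * (nodeCost * scanCost) * (n * Q ^ 5) := by ring
  have h₂ : n * Q ^ 2 ≤ n * Q ^ 5 :=
    Nat.mul_le_mul_left _ (Nat.pow_le_pow_right hQ (by norm_num))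
  have h₃ : n * 1 ≤ n * Q ^ 5 := Nat.mul_le_mul_left _ (Nat.one_le_pow _ _ hQ)
  have h₄ : turnCost * (n + 1) ≤ 2 * turnCost * (n * Q ^ 5) := by
    calc turnCost * (n + 1) ≤ turnCost * (2 * (n * Q ^ 5)) := Nat.mul_le_mul_left _ (by omega)
      _ = 2 * turnCost * (n * Q ^ 5) := by ring
  have h₅ := Nat.mul_le_mul_left (3 * scanCost) h₂
  have h₆ := Nat.le_mul_of_pos_right (clearProg.maxCost + clearBody.maxCost + nodeCost)
    (show 0 < n * Q ^ 5 by omega)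
  rw [roundTime, roundConst, add_mul _ (3 * scanCost), add_mul _ (2 * turnCost),
    add_mul _ (15 * (nodeCost * scanCost))]
  omega

/-- The constant in the bound for `solveTime`. -/
def solveConst : ℕ :=
  solveProg.maxCost + (gridProg.maxCost + gridStep.maxCost) +
    2 * (rangeProg.maxCost + rangeStep.maxCost) + 2 * (phaseProg 0).maxCost +
    2 * (4 * roundConst + (mergeBody.maxCost + mergeLoop.maxCost)) + midProg.maxCost +
    2 * bothCost + finishProg.maxCost + gridProg.maxCost

/-- The number of doublings and the number of rounds per doubling are both `O(g ^ 2)`, hence `O(Q ^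
2)` each, where `g` is the grid size and `Q = 2 ^ g`. This raises the exponent from 5 to 9. -/
theorem solveTime_le {n : ℕ} (hn : 3 ≤ n) :
    solveTime (roundConst * (n * (2 ^ gridSize n) ^ 5)) (3 * (gridSize n * gridSize n))
      (gridSize n * gridSize n) n ≤ solveConst * (n * (2 ^ gridSize n) ^ 9) := by
  have hg : gridSize n ≤ 2 ^ gridSize n := Nat.lt_two_pow_self.le
  have hQ : 1 ≤ 2 ^ gridSize n := Nat.one_le_two_pow
  rw [solveTime, phaseTime, solveConst, add_assoc (_ * _) mergeBody.maxCost]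
  generalize 2 ^ gridSize n = Q at *
  generalize gridSize n = g at *
  generalize mergeBody.maxCost + mergeLoop.maxCost = a
  have hgg : g * g ≤ Q ^ 2 := by
    rw [pow_two]
    exact Nat.mul_le_mul hg hg
  have hN : ∀ i, i ≤ 9 → Q ^ i ≤ n * Q ^ 9 := fun i hi =>
    (Nat.pow_le_pow_right hQ hi).trans (Nat.le_mul_of_pos_left _ (by omega))
  have h₁ : n * 1 ≤ n * Q ^ 9 := Nat.mul_le_mul_left _ (Nat.one_le_pow _ _ hQ)
  have h₂ : g ≤ n * Q ^ 9 := hg.trans (by simpa using hN 1 (by norm_num))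
  have h₃ : g * g * ((3 * (g * g) + 1) * (roundConst * (n * Q ^ 5)) + a) ≤
      (4 * roundConst + a) * (n * Q ^ 9) := by
    have h₄ : 3 * (g * g) + 1 ≤ 4 * Q ^ 2 := by
      have := Nat.one_le_pow 2 Q hQ
      omega
    calc g * g * ((3 * (g * g) + 1) * (roundConst * (n * Q ^ 5)) + a) ≤
          Q ^ 2 * (4 * Q ^ 2 * (roundConst * (n * Q ^ 5)) + a) := by gcongr
      _ = 4 * roundConst * (n * Q ^ 9) + a * Q ^ 2 := by ring
      _ ≤ 4 * roundConst * (n * Q ^ 9) + a * (n * Q ^ 9) :=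
          Nat.add_le_add_left (Nat.mul_le_mul_left _ (hN 2 (by norm_num))) _
      _ = (4 * roundConst + a) * (n * Q ^ 9) := by ring
  generalize g * g * ((3 * (g * g) + 1) * (roundConst * (n * Q ^ 5)) + a) = b at *
  generalize n * Q ^ 9 = N at *
  have h₄ : ∀ x : ℕ, x ≤ x * N := fun x => Nat.le_mul_of_pos_right _ (by omega)
  have h₅ := Nat.mul_le_mul_right (gridProg.maxCost + gridStep.maxCost) h₂
  have h₆ := Nat.mul_le_mul_left (rangeProg.maxCost + rangeStep.maxCost)
    (show n + 1 ≤ 2 * N by omega)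
  have h₇ := Nat.mul_le_mul_left bothCost (show n + 1 ≤ 2 * N by omega)
  linarith [h₄ solveProg.maxCost, h₄ (phaseProg 0).maxCost, h₄ midProg.maxCost,
    h₄ finishProg.maxCost, h₄ gridProg.maxCost]

open Real in
-- Take logarithms in `2 ^ (r * r) < n` for `r = gridSize n - 1`, and use `log 2 ≥ 1 / 4`.
theorem gridSize_le {n : ℕ} (hn : 3 ≤ n) : (gridSize n : ℝ) ≤ 1 + 2 * √(log n) := by
  have hlt := lt_of_lt_gridSize (n := n) (r := gridSize n - 1)
    (by have := two_le_gridSize hn; omega)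
  obtain ⟨r, hr⟩ : ∃ r, gridSize n = r + 1 :=
    ⟨gridSize n - 1, by have := two_le_gridSize hn; omega⟩
  rw [hr, Nat.add_sub_cancel] at hlt
  rw [hr]
  have h₁ : (2 : ℝ) ^ (r * r) ≤ n := by exact_mod_cast hlt.le
  have h₂ := log_le_log (by positivity) h₁
  rw [log_pow] at h₂
  push_cast at h₂ ⊢
  have h₃ : (r : ℝ) ≤ √(4 * log n) := by
    refine le_sqrt_of_sq_le ?_
    nlinarith [log_two_gt_d9, mul_self_nonneg (r : ℝ)]
  rw [sqrt_mul (by norm_num), show √(4 : ℝ) = 2 by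
    rw [show (4 : ℝ) = 2 ^ 2 by norm_num, sqrt_sq (by norm_num)]] at h₃
  linarith

open Real in
/-- The exponent of `2 ^ gridSize n` is absorbed by `n ^ ε`. -/
theorem gridSize_mul_le {n : ℕ} (hn : 3 ≤ n) {ε : ℝ} (hε : √(log (log n) / log n) < ε) :
    9 * (gridSize n : ℝ) ≤ 9 + 18 * (exp 324 + 1) + ε * log n := by
  have hl : 1 < log n := by
    rw [lt_log_iff_exp_lt (by positivity)]
    have : (3 : ℝ) ≤ n := by exact_mod_cast hn
    linarith [exp_one_lt_d9]
  have hg := gridSize_le hn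
  have hε0 : 0 < ε := (sqrt_nonneg _).trans_lt hε
  have hx : √(log n) ^ 2 = log n := sq_sqrt (by linarith)
  have hx0 : 0 ≤ √(log n) := sqrt_nonneg _
  set x := √(log n)
  -- With `x = √(log n)`, the term `18 * x` is to be absorbed. If `18 ≤ ε * x`, it is at most `ε * x
  -- ^ 2`. Otherwise the assumption gives `log (log n) < (ε * x) ^ 2 ≤ 324`, and `x` is bounded by a
  -- constant.
  rcases le_total 18 (ε * x) with h | h
  · have : 18 * x ≤ ε * log n := by
      rw [← hx]
      nlinarith
    linarith [exp_pos 324]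
  · rw [sqrt_lt' hε0, div_lt_iff₀ (by linarith), ← hx] at hε
    have h₁ : log (x ^ 2) < 324 := by
      nlinarith [mul_nonneg hε0.le hx0]
    have h₂ : x ^ 2 < exp 324 := (log_lt_iff_lt_exp (by rw [hx]; linarith)).1 h₁
    have h₃ : 0 ≤ ε * log n := by
      have : 0 ≤ log n := by linarith
      positivity
    nlinarith [sq_nonneg (x - 1)]

open Real in
theorem two_pow_gridSize_pow_le {n : ℕ} (hn : 3 ≤ n) {ε : ℝ}
    (hε : √(log (log n) / log n) < ε) :
    (n : ℝ) * (2 ^ gridSize n) ^ 9 ≤ exp (9 + 18 * (exp 324 + 1)) * (n : ℝ) ^ (1 + ε) := by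
  have hn0 : (0 : ℝ) < n := by positivity
  have h₁ : ((2 : ℝ) ^ gridSize n) ^ 9 ≤ exp (9 * gridSize n) := by
    rw [← pow_mul, mul_comm (gridSize n), pow_mul, mul_comm (9 : ℝ), exp_nat_mul]
    refine pow_le_pow_left₀ (by norm_num) ?_ _
    have h₂ := add_one_le_exp (1 : ℝ)
    calc (2 : ℝ) ^ 9 ≤ exp 1 ^ 9 := pow_le_pow_left₀ (by norm_num) (by linarith) 9
      _ = exp 9 := by rw [← exp_nat_mul]; norm_num
  rw [rpow_add hn0, rpow_one, rpow_def_of_pos hn0 ε]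
  calc (n : ℝ) * (2 ^ gridSize n) ^ 9 ≤ n * exp (9 + 18 * (exp 324 + 1) + ε * log n) := by
        refine mul_le_mul_of_nonneg_left (h₁.trans ?_) hn0.le
        exact exp_le_exp.2 (gridSize_mul_le hn hε)
    _ = exp (9 + 18 * (exp 324 + 1)) * (n * exp (log n * ε)) := by
        rw [exp_add, mul_comm ε]
        ring

open Real in
theorem roomy_logSpace {C n : ℕ} (hn : 3 ≤ n) (hC : 2000 ≤ C) : Roomy (logSpace C n) n := by
  have hl : 1 < log n := by
    rw [lt_log_iff_exp_lt (by positivity)]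
    have : (3 : ℝ) ≤ n := by exact_mod_cast hn
    linarith [exp_one_lt_d9]
  have hC' : (2000 : ℝ) ≤ C := by exact_mod_cast hC
  refine ⟨hn, ?_, ?_, hC⟩
  · refine Nat.le_floor ?_
    push_cast
    nlinarith
  -- A constant factor is absorbed by a power of `n`, since `n ≥ 3`.
  · calc 1000 * n ^ 6 ≤ 3 ^ 7 * n ^ 6 := Nat.mul_le_mul_right _ (by norm_num)
      _ ≤ n ^ 7 * n ^ 6 := Nat.mul_le_mul_right _ (Nat.pow_le_pow_left hn 7)
      _ = n ^ 13 := by ring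
      _ ≤ n ^ C := Nat.pow_le_pow_right (by omega) (by omega)

open Real in
-- One strip per level makes `O(√(log n))` cells, so there is room to spare.
theorem lt_logSpace_cells {C n : ℕ} (hn : 3 ≤ n) (hC : 2000 ≤ C) :
    31 + 4 * gridSize n < (logSpace C n).cells := by
  have hl : 1 < log n := by
    rw [lt_log_iff_exp_lt (by positivity)]
    have : (3 : ℝ) ≤ n := by exact_mod_cast hn
    linarith [exp_one_lt_d9]
  have hC' : (2000 : ℝ) ≤ C := by exact_mod_cast hC
  refine Nat.lt_of_succ_le (Nat.le_floor ?_)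
  have hg := gridSize_le hn
  have hx : √(log n) ≤ log n := by
    rw [sqrt_le_left (by linarith)]
    nlinarith
  push_cast
  nlinarith

/-- Three rounds more than halve the number of candidates, as `2 * 3 ^ 3 < 4 ^ 3`. So `3 * g ^ 2`
rounds are enough for `2 ^ (g * g)` of them. -/
theorem mul_three_pow_lt (g : ℕ) (hg : 1 ≤ g) :
    (2 ^ g) ^ g * 3 ^ (3 * (g * g)) < 4 ^ (3 * (g * g)) := by
  rw [← pow_mul, pow_mul 3, pow_mul 4, ← mul_pow]
  exact Nat.pow_lt_pow_left (by norm_num) (Nat.mul_pos hg hg).ne'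

end ReadOnlyLP

theorem theorem3 :
    ∃ (p : ReadOnlyLP.Program) (C : ℕ), ∀ n : ℕ, 3 ≤ n → ∀ L : ReadOnlyLP.LP n,
      ∃ (t : ℕ) (σ : ReadOnlyLP.State),
        ReadOnlyLP.Exec (ReadOnlyLP.logSpace C n) L p ReadOnlyLP.State.blank t σ ∧
        ReadOnlyLP.Answers L σ ∧
        ∀ ε : ℝ, √(Real.log (Real.log n) / Real.log n) < ε → ε < 1 →
          (t : ℝ) ≤ C * (n : ℝ) ^ (1 + ε) := by
  set K : ℝ := ReadOnlyLP.solveConst * Real.exp (9 + 18 * (Real.exp 324 + 1)) with hK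
  -- The summand 2000 provides for the limits, the summand `⌈K⌉₊` for the running time.
  refine ⟨ReadOnlyLP.solveProg, 2000 + ⌈K⌉₊, fun n hn L => ?_⟩
  have hC : 2000 ≤ 2000 + ⌈K⌉₊ := Nat.le_add_right _ _
  have := ReadOnlyLP.roomy_logSpace hn hC
  obtain ⟨t, σ, h₁, h₂, h₃⟩ := ReadOnlyLP.runs_solveProg (L := L)
    (ReadOnlyLP.lt_logSpace_cells hn hC)
    (ReadOnlyLP.mul_three_pow_lt _ (by have := ReadOnlyLP.two_le_gridSize hn; omega))
    (fun h hh hhn => ReadOnlyLP.roundTime_le hn hh hhn) (ReadOnlyLP.le_gridSize n)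
  -- The run does not depend on `ε`, which enters only into the estimate of its length.
  refine ⟨t, σ, h₁, h₃, fun ε hε _ => ?_⟩
  have h₄ : (t : ℝ) ≤ ReadOnlyLP.solveConst * (n * (2 ^ ReadOnlyLP.gridSize n) ^ 9) := by
    exact_mod_cast h₂.trans (ReadOnlyLP.solveTime_le hn)
  have h₅ := ReadOnlyLP.two_pow_gridSize_pow_le hn hε
  have h₆ : (0 : ℝ) ≤ (n : ℝ) ^ (1 + ε) := by positivity
  calc (t : ℝ) ≤ ReadOnlyLP.solveConst *
        (Real.exp (9 + 18 * (Real.exp 324 + 1)) * (n : ℝ) ^ (1 + ε)) :=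
        h₄.trans (mul_le_mul_of_nonneg_left h₅ (Nat.cast_nonneg _))
    _ = K * (n : ℝ) ^ (1 + ε) := by rw [hK, mul_assoc]
    _ ≤ ((2000 + ⌈K⌉₊ : ℕ) : ℝ) * (n : ℝ) ^ (1 + ε) := by
        refine mul_le_mul_of_nonneg_right ?_ h₆
        push_cast
        linarith [Nat.le_ceil K]
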